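/- **Setting.** Let $d\in\mathbb N$, let $\mathcal N=\mathbb Z^d$ or $\mathbb N^d$, and write $|a|=\max_i|a_i|$. For each $K\in\mathbb N$ let $\mathcal N_K\subset\{a\in\mathcal N: |a|\le K\}$ be a finite set and let $\mathcal Z_K=\mathcal N_K\times\{\pm1\}$. A point of $\mathbb C^{\mathcal Z_K}$ is written $z=(z_j)_{j\in\mathcal Z_K}=(\xi,\eta)$ with $z_{(a,1)}=\xi_a$, $z_{(a,-1)}=\eta_a$, and $\|z\|^2=\sum_{j\in\mathcal Z_K}|z_j|^2$. It is called real if $\eta_a=\overline{\xi_a}$ for all $a\in\mathcal N_K$. The actions are $I_a(z)=\xi_a\eta_a$ (so $I_a(z)=|\xi_a|^2$ if $z$ is real). Let $\mathcal U$ be an open subset of $\ell^2(\mathcal N\times\{\pm1\};\mathbb C)$ containing $0$, and let $\mathcal U_K\subset\mathbb C^{\mathcal Z_K}$ be its image under the coordinate projection. For a Hamiltonian $H$ on an open set of $\mathbb C^{\mathcal Z_K}$, $\varphi_H^t$ denotes the (partially defined) flow at time $t$ of $\dot\xi_a=-i\,\partial H/\partial\eta_a$, $\dot\eta_a=i\,\partial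 H/\partial\xi_a$; it is defined at $z$ if the solution starting at $z$ stays in the domain of $H$ on $[0,t]$. **Hypotheses.** Let $(\omega_a)_{a\in\mathcal N}$ be real numbers and $H_0^{(K)}=\sum_{a\in\mathcal N_K}\omega_a I_a$ on $\mathbb C^{\mathcal Z_K}$. Let $P^{(K)}:\mathcal U_K\to\mathbb C$ be $C^\infty$ in the complex variables $z_j$, real valued at the real points of $\mathcal U_K$, and vanishing at $0$ together with its derivatives of order $1$ and $2$. Suppose that there are constants $C(\ell),\beta(\ell)\ge0$ such that for all $\ell\ge2$, all $K\ge1$, all $j_1,\dots,j_\ell\in\mathcal Z_K$ and all $z\in\mathcal U_K$, $$\Big|\frac{\partial^\ell P^{(K)}}{\partial z_{j_1}\cdots\partial z_{j_\ell}}(z)\Big|\le C(\ell)K^{\beta(\ell)} .$$ Let $0<h<h_0$ satisfy the following non-resonance condition: there are constants $\gamma^*(s)>0$ and $\alpha^*(s)\in\mathbb R$, $s\in\mathbb N$, such that for all $s$, all $K\ge1$ and all $(j_1,\dots,j_s)=((a_1,\delta_1),\dots,(a_s,\delta_s))\in\mathcal Z_K^s$ that are not, up to a permutation, of the form $((b_1,1),\dots,(b_m,1),(b_1,-1),\dots,(b_m,-1))$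 with $2m=s$, $$\big|1-e^{ih(\delta_1\omega_{a_1}+\cdots+\delta_s\omega_{a_s})}\big|\ge \frac{h\,\gamma^*(s)}{K^{\alpha^*(s)}} .$$ **Theorem 1.** Let $r\ge1$ be an integer. There exist positive constants $\sigma$, $C$, $\varepsilon_0$, depending only on $r$, $h_0$, the values $C(\ell),\beta(\ell)$ for $2\le\ell\le\max(r,2)$, the constants $\gamma^*(\cdot),\alpha^*(\cdot)$, the index set $\mathcal N$ (in particular $d$) and $\mathcal U$ (and not on the sets $\mathcal N_K$, on $\omega$, $P^{(K)}$, $h$ or $K$), such that the following holds. For all $0<\varepsilon<\varepsilon_0$, all integers $1\le K\le\varepsilon^{-\sigma}$ and all real $z^0\in\mathbb C^{\mathcal Z_K}$ with $\|z^0\|\le\varepsilon$, set $$z^n=\big(\varphi^h_{H_0^{(K)}}\circ\varphi^h_{P^{(K)}}\big)^n(z^0).$$ Then $z^n$ is real for every $n$ for which it is defined; moreover $$z^n\text{ is defined and }\ \|z^n\|\le2\varepsilon\quad\text{for } n\le\varepsilon^{1-r},$$ $$z^n\text{ is defined and }\ |I_a(z^n)-I_a(z^0)|\le C\varepsilon^{5/2}\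 \text{ for all } a\in\mathcal N_K\quad\text{for } n\le\varepsilon^{2-r}.$$ -/

import Mathlib

noncomputable section

namespace Splitting

/-- The phase space `ℂ^{A × {±1}}` with norm `‖z‖² = ∑ |z_j|²`.  For `j = (a, δ)`, the coordinate
`z j` is `ξ_a` if `δ = 1` and `η_a` if `δ = -1`. -/
abbrev Phase (A : Type) [Fintype A] : Type := EuclideanSpace ℂ (A × ℤˣ)

section Hamiltonian

variable {A : Type} [Fintype A] [DecidableEq A]

/-- The conjugate index of `(a, δ)` is `(a, -δ)`. -/
def bar (j : A × ℤˣ) : A × ℤˣ := (j.1, -j.2)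

/-- `z` is real if `z_{bar j}` is the complex conjugate of `z_j` for all `j`. -/
def IsReal (z : Phase A) : Prop := ∀ j, z (bar j) = (starRingEnd ℂ) (z j)

/-- A Hamiltonian on `U` is real if its values at the real points of `U` are real numbers. -/
def IsRealHam (U : Set (Phase A)) (H : Phase A → ℂ) : Prop :=
  ∀ z ∈ U, IsReal z → (H z).im = 0

/-- The partial derivative of order `ℓ`, with respect to the complex variables
`z_{j 0}, …, z_{j (ℓ-1)}`. -/
def partialDeriv {ℓ : ℕ} (H : Phase A → ℂ) (j : Fin ℓ → A × ℤˣ) (z : Phase A) : ℂ :=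
  iteratedFDeriv ℂ ℓ H z fun i => EuclideanSpace.single (j i) (1 : ℂ)

/-- The Hamiltonian vector field for `i ∑ dξ_a ∧ dη_a`, that is
`ξ_a' = -i ∂H/∂η_a` and `η_a' = i ∂H/∂ξ_a`. -/
def hamVF (H : Phase A → ℂ) (z : Phase A) : Phase A :=
  WithLp.toLp 2 fun j =>
    -Complex.I * ((j.2 : ℤ) : ℂ) * fderiv ℂ H z (EuclideanSpace.single (bar j) (1 : ℂ))

/-- `γ` solves the Hamiltonian system of `H` on `[0, T]`, starts at `z` and stays in the domain
`U` of `H`. -/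
def IsTrajectory (U : Set (Phase A)) (H : Phase A → ℂ) (T : ℝ) (z : Phase A)
    (γ : ℝ → Phase A) : Prop :=
  γ 0 = z ∧ ∀ t ∈ Set.Icc 0 T,
    γ t ∈ U ∧ HasDerivWithinAt γ (hamVF H (γ t)) (Set.Icc 0 T) t

/-- The flow at time `T ≥ 0` of the Hamiltonian `H` with domain `U`, a partial map: it is defined
at `z` if the solution that starts at `z` exists in `U` on the whole of `[0, T]`.  (For smooth `H`
on an open `U` that solution is unique on `[0, T]`, so the choice below does not matter.) -/
def flow (U : Set (Phase A)) (H : Phase A → ℂ) (T : ℝ) : Phase A →. Phase A := fun z =>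
  ⟨∃ γ, IsTrajectory U H T z γ, fun hz => hz.choose T⟩

/-- The action `I_a(z) = ξ_a η_a`. -/
def action (a : A) (z : Phase A) : ℂ := z (a, 1) * z (a, -1)

/-- The quadratic Hamiltonian `H₀ = ∑ ω_a I_a`. -/
def quadHam (ω : A → ℝ) (z : Phase A) : ℂ := ∑ a, (ω a : ℂ) * action a z

/-- `z^n = (φ^h_{H₀} ∘ φ^h_P)^n (z⁰)`, as a partial value: it is undefined once one of the flows
is not defined up to time `h`. -/
def iterates (U : Set (Phase A)) (ω : A → ℝ) (P : Phase A → ℂ) (h : ℝ) (z₀ : Phase A)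
    (n : ℕ) : Part (Phase A) :=
  (fun w : Part (Phase A) =>
    w.bind ((flow Set.univ (quadHam ω) h).comp (flow U P h)))^[n] (Part.some z₀)

end Hamiltonian

/-- `Ω(j) = δ₁ ω_{a₁} + ⋯ + δ_s ω_{a_s}` for `j = ((a₁, δ₁), …, (a_s, δ_s))`. -/
def Omega {A : Type} (ω : A → ℝ) {s : ℕ} (j : Fin s → A × ℤˣ) : ℝ :=
  ∑ i, (((j i).2 : ℤ) : ℝ) * ω (j i).1

/-- `j` depends only on the actions: up to a permutation,
`j = ((a₁, 1), …, (a_m, 1), (a₁, -1), …, (a_m, -1))`. -/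
def DependsOnlyOnActions {A : Type} {s : ℕ} (j : Fin s → A × ℤˣ) : Prop :=
  ∃ (m : ℕ) (e : Fin m ⊕ Fin m ≃ Fin s) (a : Fin m → A),
    ∀ i, j (e (Sum.inl i)) = (a i, 1) ∧ j (e (Sum.inr i)) = (a i, -1)

section Discretization

variable {d : ℕ} {N : Set (Fin d → ℤ)}

/-- `ℓ²` of the full index set `N × {±1}`. -/
abbrev FullPhase (N : Set (Fin d → ℤ)) : Type := lp (fun _ : N × ℤˣ => ℂ) 2

/-- The natural projection of `ℓ²` onto the coordinates with index in `NK × {±1}`. -/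
def proj (NK : Finset N) (u : FullPhase N) : Phase NK :=
  WithLp.toLp 2 fun j => u ((j.1 : N), j.2)

/-- The non-resonance condition on the step size `h`, uniform in `K`: for every length `s`, and
every `K ≥ 1`, tuples that do not depend only on the actions satisfy
`|1 - exp (i h Ω(j))| ≥ h γ(s) / K^{α(s)}`. -/
def NonResonant (NK : ℕ → Finset N) (ω : N → ℝ) (h : ℝ) (γ α : ℕ → ℝ) : Prop :=
  ∀ s : ℕ, ∀ K : ℕ, 1 ≤ K → ∀ j : Fin s → NK K × ℤˣ, ¬ DependsOnlyOnActions j →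
    h * γ s / (K : ℝ) ^ α s ≤
      ‖1 - Complex.exp (Complex.I * (h * Omega (fun a : NK K => ω a) j : ℝ))‖

end Discretization

end Splitting

end

/-!
Near the origin `P` is close to a Taylor polynomial `Q`, and composition with a step of the
splitting is, up to high order, the formal operator `E R`: `R` is the rotation by `H₀` and `E` is
the flow of `h Q`, a power series in Poisson brackets. We look for generators `Y` and resonant `Z`
such that the flow of `Y` conjugates `E R` to `R` followed by the flow of `Z`. Order by order this
is the homological equation `Y m - R (Y m) + Z m = G m`, where `G m` depends on lower orders only:
`Z m` is the resonant part of `G m`, and `1 - R` is inverted on the nonresonant monomials, where its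
eigenvalues `1 - exp (-i h Ω)` are bounded from below by the non-resonance condition. A resonant
`Z` commutes with the actions, so their images under the flow of `Y` are formal integrals of the
step. Truncated at order `M`, they are `ε ^ 3`-close to `I_a` and change by `ε ^ (M + 3)` per
step. At real points `‖z‖² = 2 ∑ I_a`, so slow drift of the actions keeps the orbit in the ball of
radius `2 ε`, where the next step is defined and the argument can be repeated.

All constants (small divisors, the number of sites, Cauchy estimates for the derivatives of `P` of
order above two) are powers of `Λ = 2 K`, with exponents that depend only on the truncation order;
`K ≤ ε ^ (-σ)` with small `σ` absorbs them in half a power of `ε`.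
-/

noncomputable section

namespace Splitting

open Finset.HasAntidiagonal (antidiagonal mem_antidiagonal)
open MvPolynomial (idealOfVars)
open Filter Topology

section CauchyProduct

variable {k M N P : Type*} [CommSemiring k] [AddCommMonoid M] [AddCommMonoid N] [AddCommMonoid P]
  [Module k M] [Module k N] [Module k P]

/-- The Cauchy product of two sequences along a bilinear map. A sequence stands for the
coefficients of a formal power series in the step size, and the Cauchy product for the bilinear
map applied to two such series. -/
def cauchyProd (B : M →ₗ[k] N →ₗ[k] P) (f : ℕ → M) (g : ℕ → N) (n : ℕ) : P :=
  ∑ p ∈ antidiagonal n, B (f p.1) (g p.2)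

/-- The derivative of a formal power series, in terms of its coefficient sequence. -/
def formalDeriv (f : ℕ → M) (n : ℕ) : M := (n + 1) • f (n + 1)

variable (B : M →ₗ[k] N →ₗ[k] P)

theorem cauchyProd_add_right (f : ℕ → M) (g g' : ℕ → N) :
    cauchyProd B f (g + g') = cauchyProd B f g + cauchyProd B f g' := by
  funext n
  simp only [cauchyProd, Pi.add_apply, map_add, Finset.sum_add_distrib]

theorem cauchyProd_add_left (f f' : ℕ → M) (g : ℕ → N) :
    cauchyProd B (f + f') g = cauchyProd B f g + cauchyProd B f' g := by
  funext n
  simp only [cauchyProd, Pi.add_apply, map_add, LinearMap.add_apply, Finset.sum_add_distrib]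

theorem formalDeriv_cauchyProd (f : ℕ → M) (g : ℕ → N) :
    formalDeriv (cauchyProd B f g)
      = cauchyProd B (formalDeriv f) g + cauchyProd B f (formalDeriv g) := by
  funext n
  have hsplit : formalDeriv (cauchyProd B f g) n
      = ∑ p ∈ antidiagonal (n + 1), p.1 • B (f p.1) (g p.2)
        + ∑ p ∈ antidiagonal (n + 1), p.2 • B (f p.1) (g p.2) := by
    rw [formalDeriv, cauchyProd, Finset.smul_sum, ← Finset.sum_add_distrib]
    refine Finset.sum_congr rfl fun p hp => ?_
    rw [← add_smul, mem_antidiagonal.mp hp]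
  rw [hsplit, Finset.Nat.sum_antidiagonal_succ, Finset.Nat.sum_antidiagonal_succ']
  simp only [zero_smul, zero_add, Pi.add_apply, cauchyProd, formalDeriv, map_nsmul,
    LinearMap.smul_apply]

theorem sum_antidiagonal_antidiagonal_right_comm {P : Type*} [AddCommMonoid P]
    (f : ℕ → ℕ → ℕ → P) (n : ℕ) :
    ∑ p ∈ antidiagonal n, ∑ q ∈ antidiagonal p.1, f q.1 q.2 p.2
      = ∑ p ∈ antidiagonal n, ∑ q ∈ antidiagonal p.1, f q.1 p.2 q.2 := by
  rw [Finset.sum_sigma', Finset.sum_sigma']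
  refine Finset.sum_nbij' (fun x => ⟨(x.2.1 + x.1.2, x.2.2), (x.2.1, x.1.2)⟩)
    (fun x => ⟨(x.2.1 + x.1.2, x.2.2), (x.2.1, x.1.2)⟩) ?_ ?_ ?_ ?_ ?_
  all_goals
    rintro ⟨⟨i, j⟩, ⟨u, v⟩⟩ hx
    simp only [Finset.mem_sigma, mem_antidiagonal] at hx ⊢
  · exact ⟨by omega, trivial⟩
  · exact ⟨by omega, trivial⟩
  · rw [hx.2]
  · rw [hx.2]

theorem sum_antidiagonal_antidiagonal_assoc {P : Type*} [AddCommMonoid P]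
    (f : ℕ → ℕ → ℕ → P) (n : ℕ) :
    ∑ p ∈ antidiagonal n, ∑ q ∈ antidiagonal p.1, f q.1 q.2 p.2
      = ∑ p ∈ antidiagonal n, ∑ q ∈ antidiagonal p.2, f p.1 q.1 q.2 := by
  rw [Finset.sum_sigma', Finset.sum_sigma']
  refine Finset.sum_nbij' (fun x => ⟨(x.2.1, x.2.2 + x.1.2), (x.2.2, x.1.2)⟩)
    (fun x => ⟨(x.1.1 + x.2.1, x.2.2), (x.1.1, x.2.1)⟩) ?_ ?_ ?_ ?_ ?_
  all_goals
    rintro ⟨⟨i, j⟩, ⟨u, v⟩⟩ hx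
    simp only [Finset.mem_sigma, mem_antidiagonal] at hx ⊢
  · exact ⟨by omega, trivial⟩
  · exact ⟨by omega, trivial⟩
  · rw [hx.2]
  · rw [hx.2]

end CauchyProduct

section Leibniz

variable {k L : Type*} [CommSemiring k] [AddCommMonoid L] [Module k L]

/-- The Jacobi identity in Leibniz form: `B · z` is a derivation of the product `B`. -/
def IsLeibniz (B : L →ₗ[k] L →ₗ[k] L) : Prop :=
  ∀ x y z, B (B x y) z = B (B x z) y + B x (B y z)

theorem IsLeibniz.cauchyProd {B : L →ₗ[k] L →ₗ[k] L} (hB : IsLeibniz B) (f g u : ℕ → L) :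
    cauchyProd B (cauchyProd B f g) u
      = cauchyProd B (cauchyProd B f u) g + cauchyProd B f (cauchyProd B g u) := by
  funext n
  simp only [Splitting.cauchyProd, Pi.add_apply, map_sum, LinearMap.sum_apply, hB _ _ (u _),
    Finset.sum_add_distrib]
  rw [sum_antidiagonal_antidiagonal_right_comm fun i j l => B (B (f i) (u l)) (g j),
    sum_antidiagonal_antidiagonal_assoc fun i j l => B (f i) (B (g j) (u l))]

end Leibniz

section Evolution

variable {k L : Type*} [Field k] [AddCommGroup L] [Module k L]
  (B : L →ₗ[k] L →ₗ[k] L) (Y : ℕ → L) (R : L →ₗ[k] L)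

/-- The coefficients of the formal solution of `E' = B E Y`, `E 0 = R`: if `B` is the Poisson
bracket then `E` is the pull-back by the flow of `Y`, after the pull-back `R`. -/
def evol : ℕ → L →ₗ[k] L
  | 0 => R
  | m + 1 => ((m + 1 : ℕ) : k)⁻¹ • ∑ i : Fin (m + 1), B.flip (Y (m - i)) ∘ₗ evol i

/-- The evolution `evol` applied to a formal power series. -/
def evolve (F : ℕ → L) : ℕ → L := cauchyProd LinearMap.id (evol B Y R) F

theorem evol_zero : evol B Y R 0 = R := by
  rw [evol]

theorem evol_succ_apply (m : ℕ) (F : L) :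
    evol B Y R (m + 1) F
      = ((m + 1 : ℕ) : k)⁻¹ • ∑ p ∈ antidiagonal m, B (evol B Y R p.1 F) (Y p.2) := by
  rw [evol, Finset.Nat.sum_antidiagonal_eq_sum_range_succ
    (fun i j => B (evol B Y R i F) (Y j)), ← Fin.sum_univ_eq_sum_range
    (fun i => B (evol B Y R i F) (Y (m - i)))]
  simp [LinearMap.sum_apply]

variable {Y} in
theorem evol_congr {Y' : ℕ → L} {m : ℕ} (h : ∀ i < m, Y i = Y' i) :
    evol B Y R m = evol B Y' R m := by
  induction m using Nat.strong_induction_on with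
  | _ m ih =>
    cases m with
    | zero => simp only [evol_zero]
    | succ m =>
      ext F
      simp only [evol_succ_apply]
      refine congrArg _ (Finset.sum_congr rfl fun p hp => ?_)
      rw [mem_antidiagonal] at hp
      rw [ih p.1 (by omega) fun i hi => h i (by omega), h p.2 (by omega)]

theorem evol_single_zero (q : L) (m : ℕ) (F : L) :
    evol B (Pi.single 0 q) R m F = ((m.factorial : ℕ) : k)⁻¹ • (B.flip q)^[m] (R F) := by
  induction m with
  | zero => simp [evol_zero]
  | succ m ih =>
    rw [evol_succ_apply, Finset.sum_eq_single (m, 0), Pi.single_eq_same, ih,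
      Function.iterate_succ_apply', map_smul, LinearMap.smul_apply, smul_smul, ← mul_inv,
      ← Nat.cast_mul, ← Nat.factorial_succ, LinearMap.flip_apply]
    · intro p hp hne
      rw [mem_antidiagonal] at hp
      have : p.2 ≠ 0 := fun h0 => hne (Prod.ext (by omega) h0)
      rw [Pi.single_eq_of_ne this, map_zero]
    · simp

theorem evolve_add (F G : ℕ → L) :
    evolve B Y R (F + G) = evolve B Y R F + evolve B Y R G :=
  cauchyProd_add_right _ _ _ _

theorem evolve_zero (F : ℕ → L) : evolve B Y R F 0 = R (F 0) := by
  simp [evolve, cauchyProd, evol_zero]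

theorem evolve_succ (F : ℕ → L) (m : ℕ) :
    evolve B Y R F (m + 1)
      = R (F (m + 1)) + ∑ p ∈ antidiagonal m, evol B Y R (p.1 + 1) (F p.2) := by
  rw [evolve, cauchyProd, Finset.Nat.sum_antidiagonal_succ, evol_zero]
  rfl

theorem evolve_single_zero (I : L) : evolve B Y R (Pi.single 0 I) = fun m => evol B Y R m I := by
  funext m
  rw [evolve, cauchyProd, Finset.sum_eq_single (m, 0)]
  · simp
  · intro p hp hne
    rw [mem_antidiagonal] at hp
    have : p.2 ≠ 0 := fun h0 => hne (Prod.ext (by omega) h0)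
    rw [Pi.single_eq_of_ne this, map_zero]
  · simp

variable [CharZero k]

theorem formalDeriv_evol (F : L) :
    formalDeriv (fun m => evol B Y R m F) = cauchyProd B (fun m => evol B Y R m F) Y := by
  funext m
  rw [formalDeriv, evol_succ_apply, ← Nat.cast_smul_eq_nsmul k, smul_smul, mul_inv_cancel₀
    (Nat.cast_ne_zero.mpr m.succ_ne_zero), one_smul, cauchyProd]

theorem formalDeriv_evolve (F : ℕ → L) :
    formalDeriv (evolve B Y R F)
      = cauchyProd B (evolve B Y R F) Y + evolve B Y R (formalDeriv F) := by
  rw [evolve, formalDeriv_cauchyProd]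
  refine congrArg (· + _) (funext fun n => ?_)
  have hderiv (p : ℕ × ℕ) : formalDeriv (evol B Y R) p.1 (F p.2)
      = ∑ q ∈ antidiagonal p.1, B (evol B Y R q.1 (F p.2)) (Y q.2) :=
    congrFun (formalDeriv_evol B Y R (F p.2)) p.1
  simp only [cauchyProd, LinearMap.id_apply, hderiv, map_sum, LinearMap.sum_apply]
  exact sum_antidiagonal_antidiagonal_right_comm (fun i j l => B (evol B Y R i (F l)) (Y j)) n

theorem eq_succ_of_formalDeriv_eq {F G : ℕ → L} {n : ℕ} (k : Type*) [Field k] [CharZero k]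
    [Module k L] (h : formalDeriv F n = formalDeriv G n) : F (n + 1) = G (n + 1) := by
  rw [formalDeriv, formalDeriv, ← Nat.cast_smul_eq_nsmul k, ← Nat.cast_smul_eq_nsmul k] at h
  exact smul_right_injective L (Nat.cast_ne_zero.mpr n.succ_ne_zero) h

theorem eq_of_formalDeriv_eq_cauchyProd {V F G : ℕ → L} (h0 : F 0 = G 0)
    (hF : formalDeriv F = cauchyProd B F V) (hG : formalDeriv G = cauchyProd B G V) : F = G := by
  funext n
  induction n using Nat.strong_induction_on with
  | _ n ih =>
    cases n with
    | zero => exact h0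
    | succ n =>
      refine eq_succ_of_formalDeriv_eq k ?_
      rw [hF, hG]
      refine Finset.sum_congr rfl fun p hp => ?_
      rw [ih p.1 (Nat.lt_succ_of_le (Finset.HasAntidiagonal.antidiagonal.fst_le hp))]

variable {B R} in
theorem evolve_cauchyProd (hB : IsLeibniz B) (hR : ∀ F G, R (B F G) = B (R F) (R G))
    (F G : ℕ → L) :
    evolve B Y R (cauchyProd B F G) = cauchyProd B (evolve B Y R F) (evolve B Y R G) := by
  funext n
  induction n using Nat.strong_induction_on generalizing F G with
  | _ n ih =>
    cases n with
    | zero => simp [evolve_zero, cauchyProd, hR]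
    | succ n =>
      have hleft : formalDeriv (evolve B Y R (cauchyProd B F G))
          = cauchyProd B (evolve B Y R (cauchyProd B F G)) Y
            + (evolve B Y R (cauchyProd B (formalDeriv F) G)
              + evolve B Y R (cauchyProd B F (formalDeriv G))) := by
        rw [formalDeriv_evolve, formalDeriv_cauchyProd, evolve_add]
      have hright : formalDeriv (cauchyProd B (evolve B Y R F) (evolve B Y R G))
          = cauchyProd B (cauchyProd B (evolve B Y R F) (evolve B Y R G)) Y
            + (cauchyProd B (evolve B Y R (formalDeriv F)) (evolve B Y R G)
              + cauchyProd B (evolve B Y R F) (evolve B Y R (formalDeriv G))) := by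
        rw [formalDeriv_cauchyProd, formalDeriv_evolve, formalDeriv_evolve, hB.cauchyProd,
          cauchyProd_add_right, cauchyProd_add_left]
        abel
      refine eq_succ_of_formalDeriv_eq k ?_
      rw [hleft, hright]
      refine congrArg₂ (· + ·) (Finset.sum_congr rfl fun p hp => ?_)
        (congrArg₂ (· + ·) (ih n n.lt_succ_self _ _) (ih n n.lt_succ_self _ _))
      rw [ih p.1 (Nat.lt_succ_of_le (Finset.HasAntidiagonal.antidiagonal.fst_le hp))]

end Evolution

section NormalForm

variable {k L : Type*} [Field k] [AddCommGroup L] [Module k L]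
  (B : L →ₗ[k] L →ₗ[k] L) (Q : ℕ → L) (R : L →ₗ[k] L)

/-- The right-hand side of the homological equation `Y m - R (Y m) + Z m = homologicalRhs m`, which
collects all terms of `evolve B Q R Y + Q - Y = evolve B Y id Z` in which only orders below `m` of
`Y` and `Z` enter. -/
def homologicalRhs (Y Z : ℕ → L) : ℕ → L
  | 0 => Q 0
  | m + 1 => Q (m + 1) + ∑ p ∈ antidiagonal m,
      (evol B Q R (p.1 + 1) (Y p.2) - evol B Y LinearMap.id (p.1 + 1) (Z p.2))

theorem homologicalRhs_congr {Y Y' Z Z' : ℕ → L} {m : ℕ} (hY : ∀ i < m, Y i = Y' i)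
    (hZ : ∀ i < m, Z i = Z' i) : homologicalRhs B Q R Y Z m = homologicalRhs B Q R Y' Z' m := by
  cases m with
  | zero => rfl
  | succ m =>
    refine congrArg (Q (m + 1) + ·) (Finset.sum_congr rfl fun p hp => ?_)
    rw [mem_antidiagonal] at hp
    rw [hY p.2 (by omega), hZ p.2 (by omega), evol_congr B LinearMap.id fun i hi => hY i (by omega)]

variable (δ π : L → L)

/-- The solution `(Y, Z)` of the homological equation, by recursion on the order: `δ` inverts
`1 - R` on a complement of the range of the projection `π` to the resonant part. -/
def normalPair (m : ℕ) : L × L :=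
  let G := homologicalRhs B Q R (fun i => if _ : i < m then (normalPair i).1 else 0)
    (fun i => if _ : i < m then (normalPair i).2 else 0) m
  (δ G, π G)

/-- The generator of the normalizing transformation. -/
def normalGenerator (m : ℕ) : L := (normalPair B Q R δ π m).1

/-- The resonant normal form. -/
def normalForm (m : ℕ) : L := (normalPair B Q R δ π m).2

/-- The right-hand side of the homological equation along its solution. -/
def normalRhs : ℕ → L :=
  homologicalRhs B Q R (normalGenerator B Q R δ π) (normalForm B Q R δ π)

theorem normalPair_eq (m : ℕ) :
    normalPair B Q R δ π m = (δ (normalRhs B Q R δ π m), π (normalRhs B Q R δ π m)) := by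
  rw [normalPair]
  exact congrArg (fun G => (δ G, π G))
    (homologicalRhs_congr B Q R (fun i hi => dif_pos hi) fun i hi => dif_pos hi)

theorem normalGenerator_eq (m : ℕ) :
    normalGenerator B Q R δ π m = δ (normalRhs B Q R δ π m) :=
  congrArg Prod.fst (normalPair_eq B Q R δ π m)

theorem normalForm_eq (m : ℕ) : normalForm B Q R δ π m = π (normalRhs B Q R δ π m) :=
  congrArg Prod.snd (normalPair_eq B Q R δ π m)

variable {δ π} in
theorem homological_equation (h : ∀ G, δ G - R (δ G) + π G = G) :
    evolve B Q R (normalGenerator B Q R δ π) + Q - normalGenerator B Q R δ π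
      = evolve B (normalGenerator B Q R δ π) LinearMap.id (normalForm B Q R δ π) := by
  funext m
  have horder := h (normalRhs B Q R δ π m)
  rw [← normalGenerator_eq B Q R δ π, ← normalForm_eq B Q R δ π] at horder
  cases m with
  | zero =>
    rw [normalRhs, homologicalRhs] at horder
    simp only [Pi.add_apply, Pi.sub_apply, evolve_zero, LinearMap.id_apply, ← horder]
    abel
  | succ m =>
    rw [normalRhs, homologicalRhs, Finset.sum_sub_distrib] at horder
    simp only [Pi.add_apply, Pi.sub_apply, evolve_succ, LinearMap.id_apply]
    rw [← sub_eq_zero] at horder ⊢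
    rw [← neg_eq_zero, ← horder]
    abel

/-- The formal integral that starts at `I`: the pull-back of `I` by the normalizing
transformation. -/
def formalIntegral (I : L) (m : ℕ) : L :=
  evol B (normalGenerator B Q R δ π) LinearMap.id m I

theorem formalIntegral_zero (I : L) : formalIntegral B Q R δ π I 0 = I := by
  rw [formalIntegral, evol_zero, LinearMap.id_apply]

variable [CharZero k] {B R}

theorem evolve_evolve_eq {Q Y Z : ℕ → L} (hB : IsLeibniz B)
    (hR : ∀ F G, R (B F G) = B (R F) (R G))
    (hYZ : evolve B Q R Y + Q - Y = evolve B Y LinearMap.id Z) {I : ℕ → L}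
    (hI : formalDeriv I = 0) (hRI : R (I 0) = I 0) (hIZ : cauchyProd B I Z = 0) :
    evolve B Q R (evolve B Y LinearMap.id I) = evolve B Y LinearMap.id I := by
  set J := evolve B Y LinearMap.id I with hJ
  set W := evolve B Y LinearMap.id Z with hW
  have hQY : evolve B Q R Y + Q = W + Y := by rw [← hYZ, sub_add_cancel]
  have hevolve0 (R : L →ₗ[k] L) (V : ℕ → L) : evolve B V R 0 = 0 := by
    funext m
    simp [evolve, cauchyProd]
  have hdJ : formalDeriv J = cauchyProd B J Y := by
    rw [hJ, formalDeriv_evolve, hI, hevolve0, add_zero]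
  have hJW : cauchyProd B J W = 0 := by
    rw [hJ, hW, ← evolve_cauchyProd Y hB fun _ _ => rfl, hIZ, hevolve0]
  refine eq_of_formalDeriv_eq_cauchyProd B (V := W + Y) ?_ ?_ ?_
  · rw [evolve_zero, hJ, evolve_zero, LinearMap.id_apply, hRI]
  · rw [formalDeriv_evolve, hdJ, evolve_cauchyProd Q hB hR, ← cauchyProd_add_right, add_comm Q,
      hQY]
  · rw [hdJ, cauchyProd_add_right, hJW, zero_add]

variable {δ π}

theorem evolve_formalIntegral (hB : IsLeibniz B) (hR : ∀ F G, R (B F G) = B (R F) (R G))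
    (h : ∀ G, δ G - R (δ G) + π G = G) {I : L} (hRI : R I = I) (hI : ∀ G, B I (π G) = 0) :
    evolve B Q R (formalIntegral B Q R δ π I) = formalIntegral B Q R δ π I := by
  have hJ : formalIntegral B Q R δ π I
      = evolve B (normalGenerator B Q R δ π) LinearMap.id (Pi.single 0 I) :=
    (evolve_single_zero B _ _ I).symm
  rw [hJ]
  refine evolve_evolve_eq hB hR (homological_equation B Q R h) ?_ ?_ ?_
  · funext m
    simp [formalDeriv]
  · simpa using hRI
  · funext m
    refine Finset.sum_eq_zero fun p _ => ?_
    rw [normalForm_eq]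
    cases p.1 with
    | zero => rw [Pi.single_eq_same, hI]
    | succ i => rw [Pi.single_eq_of_ne i.succ_ne_zero, map_zero, LinearMap.zero_apply]

end NormalForm

section PoissonBracket

variable {A : Type}

@[simp]
theorem bar_bar (j : A × ℤˣ) : bar (bar j) = j := by
  simp [bar]

theorem bar_involutive : Function.Involutive (bar : A × ℤˣ → A × ℤˣ) := bar_bar

/-- The coefficients of the Poisson structure: `-i` at `(a, 1)` and `i` at `(a, -1)`. -/
def symp (j : A × ℤˣ) : ℂ := -Complex.I * ((j.2 : ℤ) : ℂ)

theorem symp_bar (j : A × ℤˣ) : symp (bar j) = -symp j := by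
  simp [symp, bar]

theorem norm_symp (j : A × ℤˣ) : ‖symp j‖ = 1 := by
  rcases Int.units_eq_one_or j.2 with h | h <;> simp [symp, h]

variable [Fintype A] {S : Type*} [CommRing S] [Algebra ℂ S] (D : A × ℤˣ → Derivation ℂ S S)

/-- The Poisson bracket `∑ j, symp j • ∂_j F * ∂_{bar j} G`, for any family `D` of derivations in
the role of the partial derivatives. -/
def poissonBracket : S →ₗ[ℂ] S →ₗ[ℂ] S :=
  ∑ j, symp j • (LinearMap.mul ℂ S).compl₁₂ (D j : S →ₗ[ℂ] S) (D (bar j) : S →ₗ[ℂ] S)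

theorem poissonBracket_apply (F G : S) :
    poissonBracket D F G = ∑ j, symp j • (D j F * D (bar j) G) := by
  simp [poissonBracket, LinearMap.sum_apply]

theorem poissonBracket_mul_left (F G H : S) :
    poissonBracket D (F * G) H = poissonBracket D F H * G + F * poissonBracket D G H := by
  simp only [poissonBracket_apply, Derivation.leibniz, smul_eq_mul, Finset.sum_mul,
    Finset.mul_sum, ← Finset.sum_add_distrib, smul_mul_assoc, mul_smul_comm, ← smul_add]
  exact Finset.sum_congr rfl fun j _ => by ring_nf

theorem derivation_poissonBracket {d : Derivation ℂ S S} (hd : ∀ j F, d (D j F) = D j (d F))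
    (F G : S) :
    d (poissonBracket D F G) = poissonBracket D (d F) G + poissonBracket D F (d G) := by
  simp only [poissonBracket_apply, map_sum, Derivation.map_smul, Derivation.leibniz, smul_eq_mul,
    hd, smul_add, Finset.sum_add_distrib]
  rw [add_comm]
  exact congrArg (· + _) (Finset.sum_congr rfl fun j _ => by rw [mul_comm])

variable {D}

/-- The second derivatives of `H` in the Jacobi identity cancel, since they are symmetric and
`symp` is odd under `bar`. -/
theorem sum_second_derivations_eq_zero (hD : ∀ i j F, D i (D j F) = D j (D i F)) (F G H : S) :
    ∑ j, symp j • (poissonBracket D F (D j H) * D (bar j) G)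
      + ∑ j, symp j • (D j F * poissonBracket D G (D (bar j) H)) = 0 := by
  have hleft : ∑ j, symp j • (poissonBracket D F (D j H) * D (bar j) G)
      = ∑ j, ∑ k, (symp j * symp k) • (D k F * D (bar j) G * D j (D (bar k) H)) := by
    refine Finset.sum_congr rfl fun j _ => ?_
    rw [poissonBracket_apply, Finset.sum_mul, Finset.smul_sum]
    refine Finset.sum_congr rfl fun k _ => ?_
    rw [smul_mul_assoc, smul_smul, hD j, mul_right_comm]
  have hright : ∑ j, symp j • (D j F * poissonBracket D G (D (bar j) H))
      = ∑ j, ∑ k, -(symp j * symp k) • (D k F * D (bar j) G * D j (D (bar k) H)) := by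
    rw [Finset.sum_comm]
    refine Finset.sum_congr rfl fun k _ => ?_
    rw [poissonBracket_apply, Finset.mul_sum, Finset.smul_sum,
      ← Equiv.sum_comp (bar_involutive (A := A)).toPerm]
    refine Finset.sum_congr rfl fun j _ => ?_
    rw [Function.Involutive.coe_toPerm, bar_bar, symp_bar, mul_smul_comm, smul_smul, mul_neg,
      mul_comm (symp k), mul_assoc]
  rw [hleft, hright, ← Finset.sum_add_distrib]
  refine Finset.sum_eq_zero fun j _ => ?_
  rw [← Finset.sum_add_distrib]
  exact Finset.sum_eq_zero fun k _ => by rw [neg_smul, add_neg_cancel]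

theorem poissonBracket_isLeibniz (hD : ∀ i j F, D i (D j F) = D j (D i F)) :
    IsLeibniz (poissonBracket D) := by
  intro F G H
  have hD' (j) := derivation_poissonBracket D (d := D j) (fun i X => hD j i X)
  have hFG : poissonBracket D (poissonBracket D F G) H
      = ∑ j, symp j • (poissonBracket D (D j F) H * D (bar j) G)
        + ∑ j, symp j • (D j F * poissonBracket D (D (bar j) G) H) := by
    conv_lhs => rw [poissonBracket_apply D F G]
    simp only [map_sum, map_smul, LinearMap.sum_apply, LinearMap.smul_apply,
      poissonBracket_mul_left, smul_add, Finset.sum_add_distrib]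
  have hFH : poissonBracket D (poissonBracket D F H) G
      = ∑ j, symp j • (poissonBracket D (D j F) H * D (bar j) G)
        + ∑ j, symp j • (poissonBracket D F (D j H) * D (bar j) G) := by
    conv_lhs => rw [poissonBracket_apply D _ G]
    simp only [hD', add_mul, smul_add, Finset.sum_add_distrib]
  have hGH : poissonBracket D F (poissonBracket D G H)
      = ∑ j, symp j • (D j F * poissonBracket D (D (bar j) G) H)
        + ∑ j, symp j • (D j F * poissonBracket D G (D (bar j) H)) := by
    conv_lhs => rw [poissonBracket_apply D F]
    simp only [hD', mul_add, smul_add, Finset.sum_add_distrib]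
  rw [hFG, hFH, hGH]
  linear_combination -sum_second_derivations_eq_zero hD F G H

end PoissonBracket

section PolynomialNorm

variable {σ 𝕜 : Type*} [NormedField 𝕜]

/-- The `ℓ¹` norm of the coefficients of a polynomial. -/
def coeffNorm (F : MvPolynomial σ 𝕜) : ℝ := ∑ μ ∈ F.support, ‖F.coeff μ‖

theorem coeffNorm_eq_sum_of_subset {F : MvPolynomial σ 𝕜} {s : Finset (σ →₀ ℕ)}
    (h : F.support ⊆ s) : coeffNorm F = ∑ μ ∈ s, ‖F.coeff μ‖ :=
  Finset.sum_subset h fun μ _ hμ => by rw [MvPolynomial.notMem_support_iff.mp hμ, norm_zero]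

theorem coeffNorm_nonneg (F : MvPolynomial σ 𝕜) : 0 ≤ coeffNorm F :=
  Finset.sum_nonneg fun _ _ => norm_nonneg _

@[simp]
theorem coeffNorm_zero : coeffNorm (0 : MvPolynomial σ 𝕜) = 0 := by
  simp [coeffNorm]

theorem coeffNorm_add_le (F G : MvPolynomial σ 𝕜) :
    coeffNorm (F + G) ≤ coeffNorm F + coeffNorm G := by
  classical
  rw [coeffNorm_eq_sum_of_subset (MvPolynomial.support_add (p := F) (q := G)),
    coeffNorm_eq_sum_of_subset (Finset.subset_union_left (s₁ := F.support) (s₂ := G.support)),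
    coeffNorm_eq_sum_of_subset (Finset.subset_union_right (s₁ := F.support) (s₂ := G.support)),
    ← Finset.sum_add_distrib]
  exact Finset.sum_le_sum fun μ _ => (congrArg norm (MvPolynomial.coeff_add μ F G)).trans_le
    (norm_add_le _ _)

theorem coeffNorm_sum_le {ι : Type*} (s : Finset ι) (F : ι → MvPolynomial σ 𝕜) :
    coeffNorm (∑ i ∈ s, F i) ≤ ∑ i ∈ s, coeffNorm (F i) :=
  Finset.le_sum_of_subadditive _ coeffNorm_zero.le coeffNorm_add_le s F

theorem coeffNorm_smul (c : 𝕜) (F : MvPolynomial σ 𝕜) :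
    coeffNorm (c • F) = ‖c‖ * coeffNorm F := by
  rw [coeffNorm_eq_sum_of_subset MvPolynomial.support_smul, coeffNorm, Finset.mul_sum]
  exact Finset.sum_congr rfl fun μ _ => by rw [MvPolynomial.coeff_smul, smul_eq_mul, norm_mul]

theorem coeffNorm_monomial (μ : σ →₀ ℕ) (c : 𝕜) :
    coeffNorm (MvPolynomial.monomial μ c) = ‖c‖ := by
  classical
  rw [coeffNorm_eq_sum_of_subset MvPolynomial.support_monomial_subset, Finset.sum_singleton,
    MvPolynomial.coeff_monomial, if_pos rfl]

theorem coeffNorm_map_le (T : MvPolynomial σ 𝕜 →ₗ[𝕜] MvPolynomial σ 𝕜) (F : MvPolynomial σ 𝕜)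
    {k : ℝ} (h : ∀ μ ∈ F.support, ∀ c, coeffNorm (T (MvPolynomial.monomial μ c)) ≤ k * ‖c‖) :
    coeffNorm (T F) ≤ k * coeffNorm F := by
  conv_lhs => rw [F.as_sum, map_sum]
  refine (coeffNorm_sum_le _ _).trans ?_
  rw [coeffNorm, Finset.mul_sum]
  exact Finset.sum_le_sum fun μ hμ => h μ hμ _

theorem coeffNorm_mul_le (F G : MvPolynomial σ 𝕜) :
    coeffNorm (F * G) ≤ coeffNorm F * coeffNorm G := by
  rw [mul_comm, mul_comm (coeffNorm F)]
  refine coeffNorm_map_le (LinearMap.mulLeft 𝕜 G) F fun μ _ c => ?_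
  rw [LinearMap.mulLeft_apply, mul_comm, mul_comm (coeffNorm G)]
  refine coeffNorm_map_le (LinearMap.mulLeft 𝕜 (MvPolynomial.monomial μ c)) G fun ν _ d => ?_
  rw [LinearMap.mulLeft_apply, MvPolynomial.monomial_mul, coeffNorm_monomial, norm_mul]

theorem coeffNorm_pderiv_le (j : σ) (F : MvPolynomial σ 𝕜) :
    coeffNorm (MvPolynomial.pderiv j F) ≤ F.totalDegree * coeffNorm F := by
  refine coeffNorm_map_le (MvPolynomial.pderiv j : Derivation 𝕜 (MvPolynomial σ 𝕜) _).toLinearMap F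
    fun μ hμ c => ?_
  rw [Derivation.coeFn_coe, MvPolynomial.pderiv_monomial, coeffNorm_monomial, norm_mul,
    mul_comm (F.totalDegree : ℝ)]
  gcongr
  have hμj : μ j ≤ F.totalDegree :=
    (Finsupp.le_degree j μ).trans (MvPolynomial.le_totalDegree hμ)
  calc ‖((μ j : ℕ) : 𝕜)‖ ≤ μ j := (Nat.norm_cast_le (α := 𝕜) (μ j)).trans_eq (by simp)
    _ ≤ F.totalDegree := Nat.cast_le.mpr hμj

theorem norm_eval_le {n : ℕ} {F : MvPolynomial σ 𝕜} (hF : F ∈ idealOfVars σ 𝕜 ^ n) {z : σ → 𝕜}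
    {ρ : ℝ} (hz : ∀ j, ‖z j‖ ≤ ρ) (hρ0 : 0 ≤ ρ) (hρ : ρ ≤ 1) :
    ‖MvPolynomial.eval z F‖ ≤ coeffNorm F * ρ ^ n := by
  rw [MvPolynomial.eval_eq, coeffNorm, Finset.sum_mul]
  refine (norm_sum_le _ _).trans (Finset.sum_le_sum fun μ hμ => ?_)
  rw [norm_mul, norm_prod]
  gcongr
  calc ∏ i ∈ μ.support, ‖z i ^ μ i‖ ≤ ∏ i ∈ μ.support, ρ ^ μ i :=
        Finset.prod_le_prod (fun _ _ => norm_nonneg _) fun i _ =>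
          (norm_pow (z i) _).trans_le (pow_le_pow_left₀ (norm_nonneg _) (hz i) _)
    _ = ρ ^ μ.degree := by rw [Finset.prod_pow_eq_pow_sum, Finsupp.degree_apply]
    _ ≤ ρ ^ n := pow_le_pow_of_le_one hρ0 hρ ((MvPolynomial.mem_pow_idealOfVars_iff _ _).mp hF μ hμ)

end PolynomialNorm

section PartialDerivatives

variable {σ R : Type*} [CommSemiring R]

theorem pderiv_comm (i j : σ) (F : MvPolynomial σ R) :
    MvPolynomial.pderiv i (MvPolynomial.pderiv j F)
      = MvPolynomial.pderiv j (MvPolynomial.pderiv i F) := by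
  rcases eq_or_ne i j with rfl | hij
  · rfl
  · ext μ
    simp [MvPolynomial.coeff_pderiv, hij, hij.symm, add_right_comm μ, mul_right_comm]

theorem pderiv_mem_pow_idealOfVars (j : σ) {n : ℕ} {F : MvPolynomial σ R}
    (hF : F ∈ idealOfVars σ R ^ (n + 1)) : MvPolynomial.pderiv j F ∈ idealOfVars σ R ^ n := by
  rw [MvPolynomial.mem_pow_idealOfVars_iff'] at hF ⊢
  intro μ hμ
  rw [MvPolynomial.coeff_pderiv, hF, zero_mul]
  simpa using hμ

theorem totalDegree_pderiv_le (j : σ) (F : MvPolynomial σ R) :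
    (MvPolynomial.pderiv j F).totalDegree ≤ F.totalDegree := by
  refine Finset.sup_le fun μ hμ => ?_
  rw [MvPolynomial.mem_support_iff, MvPolynomial.coeff_pderiv] at hμ
  calc μ.degree ≤ (μ + Finsupp.single j 1).degree := by simp
    _ ≤ F.totalDegree := MvPolynomial.le_totalDegree
        (MvPolynomial.mem_support_iff.mpr (left_ne_zero_of_mul hμ))

end PartialDerivatives

section Diagonal

variable {σ R : Type*} [CommSemiring R]

/-- The operator that multiplies the monomial with exponent `μ` by `w μ`. -/
def diag (w : (σ →₀ ℕ) → R) : MvPolynomial σ R →ₗ[R] MvPolynomial σ R :=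
  (MvPolynomial.basisMonomials σ R).constr R fun μ => MvPolynomial.monomial μ (w μ)

@[simp]
theorem diag_monomial (w : (σ →₀ ℕ) → R) (μ : σ →₀ ℕ) (c : R) :
    diag w (MvPolynomial.monomial μ c) = MvPolynomial.monomial μ (w μ * c) := by
  have h : MvPolynomial.monomial μ c = c • MvPolynomial.basisMonomials σ R μ := by
    simp [MvPolynomial.smul_monomial]
  rw [h, map_smul, diag, Module.Basis.constr_basis, MvPolynomial.smul_monomial, smul_eq_mul,
    mul_comm]

@[simp]
theorem coeff_diag (w : (σ →₀ ℕ) → R) (F : MvPolynomial σ R) (μ : σ →₀ ℕ) :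
    (diag w F).coeff μ = w μ * F.coeff μ := by
  classical
  induction F using MvPolynomial.induction_on' with
  | monomial ν c =>
    rw [diag_monomial, MvPolynomial.coeff_monomial, MvPolynomial.coeff_monomial]
    split_ifs with h
    · rw [h]
    · rw [mul_zero]
  | add F G hF hG => rw [map_add, MvPolynomial.coeff_add, MvPolynomial.coeff_add, hF, hG, mul_add]

variable (w : (σ →₀ ℕ) → R)

theorem support_diag_subset (F : MvPolynomial σ R) : (diag w F).support ⊆ F.support := by
  intro μ hμ
  rw [MvPolynomial.mem_support_iff, coeff_diag] at hμ
  exact MvPolynomial.mem_support_iff.mpr (right_ne_zero_of_mul hμ)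

theorem diag_mem_pow_idealOfVars {n : ℕ} {F : MvPolynomial σ R} (hF : F ∈ idealOfVars σ R ^ n) :
    diag w F ∈ idealOfVars σ R ^ n := by
  rw [MvPolynomial.mem_pow_idealOfVars_iff] at hF ⊢
  exact fun μ hμ => hF μ (support_diag_subset w F hμ)

theorem totalDegree_diag_le (F : MvPolynomial σ R) : (diag w F).totalDegree ≤ F.totalDegree :=
  Finset.sup_mono (support_diag_subset w F)

theorem coeffNorm_diag_le {𝕜 : Type*} [NormedField 𝕜] (w : (σ →₀ ℕ) → 𝕜) (F : MvPolynomial σ 𝕜)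
    {k : ℝ} (h : ∀ μ ∈ F.support, ‖w μ‖ ≤ k) : coeffNorm (diag w F) ≤ k * coeffNorm F := by
  refine coeffNorm_map_le _ F fun μ hμ c => ?_
  rw [diag_monomial, coeffNorm_monomial, norm_mul]
  exact mul_le_mul_of_nonneg_right (h μ hμ) (norm_nonneg c)

end Diagonal

section Polynomials

variable {A : Type}

/-- Polynomials in the variables `z_j`. -/
abbrev Poly (A : Type) : Type := MvPolynomial (A × ℤˣ) ℂ

/-- The partial derivatives of a polynomial. -/
abbrev pd (j : A × ℤˣ) : Derivation ℂ (Poly A) (Poly A) := MvPolynomial.pderiv j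

/-- The polynomials that vanish to order `n` at the origin. -/
abbrev vanishingTo (A : Type) (n : ℕ) : Ideal (Poly A) := idealOfVars (A × ℤˣ) ℂ ^ n

/-- The linear form `Ω(μ) = ∑ δ_j ω_j μ_j` on exponents. -/
def freq (ω : A → ℝ) : (A × ℤˣ →₀ ℕ) →+ ℝ :=
  Finsupp.liftAddHom fun j => (AddMonoidHom.mulLeft (((j.2 : ℤ) : ℝ) * ω j.1)).comp
    (Nat.castAddMonoidHom ℝ)

@[simp]
theorem freq_single (ω : A → ℝ) (j : A × ℤˣ) (n : ℕ) :
    freq ω (Finsupp.single j n) = ((j.2 : ℤ) : ℝ) * ω j.1 * n := by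
  simp [freq]

/-- An exponent is resonant if its monomial is a product of actions. -/
def Resonant (μ : A × ℤˣ →₀ ℕ) : Prop := ∀ a, μ (a, 1) = μ (a, -1)

/-- The eigenvalue of the linear step on the monomial with exponent `μ`. -/
def eigen (ω : A → ℝ) (h : ℝ) (μ : A × ℤˣ →₀ ℕ) : ℂ :=
  Complex.exp (-(Complex.I * ((h * freq ω μ : ℝ) : ℂ)))

/-- The composition of polynomials with the linear step. -/
def rotOp (ω : A → ℝ) (h : ℝ) : Poly A →ₗ[ℂ] Poly A := diag (eigen ω h)

open Classical in
/-- The projection to the resonant monomials. -/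
def resOp : Poly A →ₗ[ℂ] Poly A := diag fun μ => if Resonant μ then 1 else 0

open Classical in
/-- The inverse of `1 - rotOp` on the nonresonant monomials, extended by zero. -/
def divOp (ω : A → ℝ) (h : ℝ) : Poly A →ₗ[ℂ] Poly A :=
  diag fun μ => if Resonant μ then 0 else (1 - eigen ω h μ)⁻¹

/-- The action `ξ_a η_a` as a polynomial. -/
def actionPoly (a : A) : Poly A := MvPolynomial.X (a, 1) * MvPolynomial.X (a, -1)

theorem eval_actionPoly [Fintype A] (a : A) (z : Phase A) :
    MvPolynomial.eval z (actionPoly a) = action a z := by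
  rw [actionPoly, map_mul, MvPolynomial.eval_X, MvPolynomial.eval_X, action]

theorem actionPoly_eq_monomial (a : A) : actionPoly a
    = MvPolynomial.monomial (Finsupp.single (a, 1) 1 + Finsupp.single (a, -1) 1) 1 := by
  rw [actionPoly, MvPolynomial.X, MvPolynomial.X, MvPolynomial.monomial_mul, one_mul]

theorem actionPoly_mem_vanishingTo (a : A) : actionPoly a ∈ vanishingTo A 2 := by
  rw [actionPoly, vanishingTo, pow_two]
  exact Ideal.mul_mem_mul (Ideal.subset_span ⟨_, rfl⟩) (Ideal.subset_span ⟨_, rfl⟩)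

theorem totalDegree_actionPoly_le (a : A) : (actionPoly a).totalDegree ≤ 2 := by
  refine (MvPolynomial.totalDegree_mul _ _).trans ?_
  rw [MvPolynomial.totalDegree_X, MvPolynomial.totalDegree_X]

theorem coeffNorm_actionPoly (a : A) : coeffNorm (actionPoly a) = 1 := by
  rw [actionPoly_eq_monomial, coeffNorm_monomial, norm_one]

section Eigenvalues

variable (ω : A → ℝ) (h : ℝ)

theorem eigen_zero : eigen ω h 0 = 1 := by
  simp [eigen]

theorem eigen_add (μ ν : A × ℤˣ →₀ ℕ) : eigen ω h (μ + ν) = eigen ω h μ * eigen ω h ν := by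
  rw [eigen, eigen, eigen, ← Complex.exp_add, map_add]
  congr 1
  push_cast
  ring

@[simp]
theorem norm_eigen (μ : A × ℤˣ →₀ ℕ) : ‖eigen ω h μ‖ = 1 := by
  rw [eigen, mul_comm, ← neg_mul, ← Complex.ofReal_neg, Complex.norm_exp_ofReal_mul_I]

theorem eigen_single_add_single_bar (j : A × ℤˣ) :
    eigen ω h (Finsupp.single j 1 + Finsupp.single (bar j) 1) = 1 := by
  simp [eigen, bar]

theorem rotOp_actionPoly (a : A) : rotOp ω h (actionPoly a) = actionPoly a := by
  have hres : eigen ω h (Finsupp.single (a, 1) 1 + Finsupp.single (a, -1) 1) = 1 :=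
    eigen_single_add_single_bar ω h (a, 1)
  rw [actionPoly_eq_monomial, rotOp, diag_monomial, hres, mul_one]

variable {ω h} in
theorem divOp_sub_rotOp_add_resOp (hne : ∀ μ, ¬ Resonant μ → eigen ω h μ ≠ 1) (G : Poly A) :
    divOp ω h G - rotOp ω h (divOp ω h G) + resOp G = G := by
  ext μ
  simp only [divOp, rotOp, resOp, MvPolynomial.coeff_add, MvPolynomial.coeff_sub, coeff_diag]
  by_cases hμ : Resonant μ
  · simp [hμ]
  · have := sub_ne_zero.mpr (hne μ hμ).symm
    simp only [if_neg hμ]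
    field_simp
    ring

end Eigenvalues

variable [Fintype A]

/-- The Poisson bracket of polynomials. -/
abbrev bracket : Poly A →ₗ[ℂ] Poly A →ₗ[ℂ] Poly A := poissonBracket pd

theorem bracket_isLeibniz : IsLeibniz (bracket (A := A)) :=
  poissonBracket_isLeibniz fun i j F => pderiv_comm i j F

theorem bracket_mem_vanishingTo {m n : ℕ} {F G : Poly A} (hF : F ∈ vanishingTo A (m + 1))
    (hG : G ∈ vanishingTo A (n + 1)) : bracket F G ∈ vanishingTo A (m + n) := by
  rw [poissonBracket_apply, vanishingTo, pow_add]
  exact Submodule.sum_mem _ fun j _ => Submodule.smul_of_tower_mem _ _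
    (Ideal.mul_mem_mul (pderiv_mem_pow_idealOfVars j hF) (pderiv_mem_pow_idealOfVars _ hG))

theorem totalDegree_bracket_le (F G : Poly A) :
    (bracket F G).totalDegree ≤ F.totalDegree + G.totalDegree := by
  rw [poissonBracket_apply]
  refine MvPolynomial.totalDegree_finsetSum_le fun j _ => ?_
  exact (MvPolynomial.totalDegree_smul_le _ _).trans ((MvPolynomial.totalDegree_mul _ _).trans
    (add_le_add (totalDegree_pderiv_le _ _) (totalDegree_pderiv_le _ _)))

theorem coeffNorm_bracket_le (F G : Poly A) : coeffNorm (bracket F G)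
    ≤ Fintype.card (A × ℤˣ) * ((F.totalDegree * coeffNorm F) * (G.totalDegree * coeffNorm G)) := by
  rw [poissonBracket_apply]
  refine (coeffNorm_sum_le _ _).trans ?_
  rw [← nsmul_eq_mul]
  refine Finset.sum_le_card_nsmul _ _ _ fun j _ => ?_
  rw [coeffNorm_smul, norm_symp, one_mul]
  exact (coeffNorm_mul_le _ _).trans (mul_le_mul (coeffNorm_pderiv_le j F)
    (coeffNorm_pderiv_le _ G) (coeffNorm_nonneg _) (mul_nonneg (Nat.cast_nonneg _)
      (coeffNorm_nonneg _)))

theorem rotOp_bracket (ω : A → ℝ) (h : ℝ) (F G : Poly A) :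
    rotOp ω h (bracket F G) = bracket (rotOp ω h F) (rotOp ω h G) := by
  induction F using MvPolynomial.induction_on' with
  | add F F' hF hF' => simp only [map_add, LinearMap.add_apply, hF, hF']
  | monomial μ c =>
    induction G using MvPolynomial.induction_on' with
    | add G G' hG hG' => simp only [map_add, hG, hG']
    | monomial ν d =>
      simp only [rotOp, diag_monomial, poissonBracket_apply, map_sum, map_smul]
      refine Finset.sum_congr rfl fun j _ => ?_
      simp only [MvPolynomial.pderiv_monomial, MvPolynomial.monomial_mul, diag_monomial]
      congr 2
      by_cases hμ : μ j = 0
      · simp [hμ]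
      by_cases hν : ν (bar j) = 0
      · simp [hν]
      have heigen : eigen ω h (μ - Finsupp.single j 1 + (ν - Finsupp.single (bar j) 1))
          = eigen ω h μ * eigen ω h ν := by
        rw [← eigen_add, ← mul_one (eigen ω h (_ + (_ - _))), ← eigen_single_add_single_bar ω h j,
          ← eigen_add, add_add_add_comm,
          tsub_add_cancel_of_le (Finsupp.single_le_iff.mpr (Nat.one_le_iff_ne_zero.mpr hμ)),
          tsub_add_cancel_of_le (Finsupp.single_le_iff.mpr (Nat.one_le_iff_ne_zero.mpr hν))]
      rw [heigen]
      ring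

theorem bracket_actionPoly_monomial (a : A) (ν : A × ℤˣ →₀ ℕ) (c : ℂ) :
    bracket (actionPoly a) (MvPolynomial.monomial ν c)
      = (Complex.I * (ν (a, 1) - ν (a, -1))) • MvPolynomial.monomial ν c := by
  classical
  rw [poissonBracket_apply, Fintype.sum_prod_type, Finset.sum_eq_single a]
  · rw [show (Finset.univ : Finset ℤˣ) = {1, -1} from rfl, Finset.sum_pair (by decide)]
    have hη : pd (a, 1) (actionPoly a) = MvPolynomial.X (a, -1) := by
      simp [actionPoly, MvPolynomial.pderiv_X]
    have hξ : pd (a, -1) (actionPoly a) = MvPolynomial.X (a, 1) := by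
      simp [actionPoly, MvPolynomial.pderiv_X]
    rw [hη, hξ, bar, bar, neg_neg, MvPolynomial.X_mul_pderiv_monomial,
      MvPolynomial.X_mul_pderiv_monomial, ← Nat.cast_smul_eq_nsmul ℂ, ← Nat.cast_smul_eq_nsmul ℂ,
      smul_smul, smul_smul, ← add_smul]
    congr 1
    simp only [symp, Units.val_one, Units.val_neg, Int.cast_one, Int.cast_neg]
    ring
  · intro a' _ ha'
    refine Finset.sum_eq_zero fun δ _ => ?_
    have hzero : pd (a', δ) (actionPoly a) = 0 := by
      simp [actionPoly, MvPolynomial.pderiv_X, ha'.symm]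
    rw [hzero, zero_mul, smul_zero]
  · simp

theorem bracket_actionPoly_resOp (a : A) (G : Poly A) : bracket (actionPoly a) (resOp G) = 0 := by
  classical
  induction G using MvPolynomial.induction_on' with
  | add G G' hG hG' => simp only [map_add, hG, hG', add_zero]
  | monomial ν c =>
    rw [resOp, diag_monomial, bracket_actionPoly_monomial]
    by_cases hν : Resonant ν
    · rw [hν a, sub_self, mul_zero, zero_smul]
    · rw [if_neg hν, zero_mul, map_zero, smul_zero]

end Polynomials

section Orders

variable {A : Type} [Fintype A] {Q : ℕ → Poly A} {R : Poly A →ₗ[ℂ] Poly A}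

theorem evol_mem_vanishingTo {Y : ℕ → Poly A}
    (hR : ∀ n, ∀ F ∈ vanishingTo A n, R F ∈ vanishingTo A n) {n : ℕ} {F : Poly A}
    (hF : F ∈ vanishingTo A (n + 2)) {m : ℕ} (hY : ∀ k < m, Y k ∈ vanishingTo A (k + 3)) :
    evol bracket Y R m F ∈ vanishingTo A (n + m + 2) := by
  induction m using Nat.strong_induction_on with
  | _ m ih =>
    cases m with
    | zero =>
      rw [evol_zero]
      exact hR _ _ hF
    | succ m =>
      rw [evol_succ_apply]
      refine Submodule.smul_of_tower_mem _ _ (Submodule.sum_mem _ fun p hp => ?_)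
      rw [mem_antidiagonal] at hp
      refine Ideal.pow_le_pow_right ?_ (bracket_mem_vanishingTo (m := n + p.1 + 1) (n := p.2 + 2)
        (ih p.1 (by omega) fun k hk => hY k (by omega)) (hY p.2 (by omega)))
      omega

theorem homologicalRhs_mem_vanishingTo {Y Z : ℕ → Poly A}
    (hR : ∀ n, ∀ F ∈ vanishingTo A n, R F ∈ vanishingTo A n)
    (hQ : ∀ k, Q k ∈ vanishingTo A (k + 3)) {m : ℕ} (hY : ∀ k < m, Y k ∈ vanishingTo A (k + 3))
    (hZ : ∀ k < m, Z k ∈ vanishingTo A (k + 3)) :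
    homologicalRhs bracket Q R Y Z m ∈ vanishingTo A (m + 3) := by
  cases m with
  | zero => exact hQ 0
  | succ m =>
    refine add_mem (hQ _) (Submodule.sum_mem _ fun p hp => ?_)
    rw [mem_antidiagonal] at hp
    have hp' : p.2 + 1 + (p.1 + 1) + 2 = m + 1 + 3 := by omega
    rw [← hp']
    exact sub_mem (evol_mem_vanishingTo hR (hY p.2 (by omega)) fun k _ => hQ k)
      (evol_mem_vanishingTo (fun _ _ hF => hF) (hZ p.2 (by omega)) fun k hk => hY k (by omega))

variable {δ π : Poly A → Poly A}

theorem normalPair_mem_vanishingTo (hR : ∀ n, ∀ F ∈ vanishingTo A n, R F ∈ vanishingTo A n)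
    (hδ : ∀ n, ∀ F ∈ vanishingTo A n, δ F ∈ vanishingTo A n)
    (hπ : ∀ n, ∀ F ∈ vanishingTo A n, π F ∈ vanishingTo A n)
    (hQ : ∀ k, Q k ∈ vanishingTo A (k + 3)) (m : ℕ) :
    normalGenerator bracket Q R δ π m ∈ vanishingTo A (m + 3) ∧
      normalForm bracket Q R δ π m ∈ vanishingTo A (m + 3) := by
  induction m using Nat.strong_induction_on with
  | _ m ih =>
    have hG : normalRhs bracket Q R δ π m ∈ vanishingTo A (m + 3) :=
      homologicalRhs_mem_vanishingTo hR hQ (fun k hk => (ih k hk).1) fun k hk => (ih k hk).2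
    rw [normalGenerator_eq, normalForm_eq]
    exact ⟨hδ _ _ hG, hπ _ _ hG⟩

theorem formalIntegral_mem_vanishingTo (hR : ∀ n, ∀ F ∈ vanishingTo A n, R F ∈ vanishingTo A n)
    (hδ : ∀ n, ∀ F ∈ vanishingTo A n, δ F ∈ vanishingTo A n)
    (hπ : ∀ n, ∀ F ∈ vanishingTo A n, π F ∈ vanishingTo A n)
    (hQ : ∀ k, Q k ∈ vanishingTo A (k + 3)) {I : Poly A} (hI : I ∈ vanishingTo A 2) (m : ℕ) :
    formalIntegral bracket Q R δ π I m ∈ vanishingTo A (m + 2) := by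
  have hevol := evol_mem_vanishingTo (n := 0) (R := LinearMap.id) (fun _ _ hF => hF) hI (m := m)
    fun k _ => (normalPair_mem_vanishingTo hR hδ hπ hQ k).1
  rwa [zero_add] at hevol

end Orders

section Models

/-- Degree and coefficients of `F` are bounded in terms of the large parameter `Λ`. -/
def PolyBound {σ : Type*} (Λ : ℝ) (p : ℕ) (F : MvPolynomial σ ℂ) : Prop :=
  F.totalDegree ≤ p ∧ coeffNorm F ≤ Λ ^ p

theorem PolyBound.mono {σ : Type*} {Λ : ℝ} (hΛ : 1 ≤ Λ) {p q : ℕ} (hpq : p ≤ q)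
    {F : MvPolynomial σ ℂ} (hF : PolyBound Λ p F) : PolyBound Λ q F :=
  ⟨hF.1.trans hpq, hF.2.trans (pow_le_pow_right₀ hΛ hpq)⟩

theorem natCast_le_pow {Λ : ℝ} (hΛ : 2 ≤ Λ) (p : ℕ) : (p : ℝ) ≤ Λ ^ p :=
  calc (p : ℝ) ≤ 2 ^ p := by exact_mod_cast Nat.lt_two_pow_self.le
    _ ≤ Λ ^ p := pow_le_pow_left₀ zero_le_two hΛ p

/-- A splitting step with polynomial perturbation `Q`. All its data are bounded by fixed powers of
the large parameter `Λ`, so that bounds with exponents depending only on `c` and `b` are uniform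
over all models. -/
structure Model (c : ℕ) (b : ℕ → ℕ) where
  /-- The sites. -/
  A : Type
  [fin : Fintype A]
  [dec : DecidableEq A]
  /-- The frequencies. -/
  ω : A → ℝ
  /-- The step size. -/
  h : ℝ
  /-- The large parameter. -/
  Λ : ℝ
  /-- The perturbation. -/
  Q : Poly A
  two_le : 2 ≤ Λ
  card_le : (Fintype.card (A × ℤˣ) : ℝ) ≤ Λ ^ c
  h_pos : 0 < h
  h_le : h ≤ Λ ^ c
  polyBound_Q : PolyBound Λ c Q
  Q_mem : Q ∈ vanishingTo A 3
  nonres : ∀ μ : A × ℤˣ →₀ ℕ, ¬ Resonant μ → h ≤ Λ ^ b μ.degree * ‖1 - eigen ω h μ‖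

attribute [instance] Model.fin Model.dec

namespace Model

variable {c : ℕ} {b : ℕ → ℕ} (m : Model c b)

theorem one_le : 1 ≤ m.Λ := one_le_two.trans m.two_le

theorem h_ne_zero : (m.h : ℂ) ≠ 0 := by exact_mod_cast m.h_pos.ne'

theorem norm_h_le : ‖(m.h : ℂ)‖ ≤ m.Λ ^ c := by
  rw [Complex.norm_real, Real.norm_of_nonneg m.h_pos.le]
  exact m.h_le

theorem norm_one_sub_eigen_pos {μ : m.A × ℤˣ →₀ ℕ} (hμ : ¬ Resonant μ) :
    0 < ‖1 - eigen m.ω m.h μ‖ :=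
  pos_of_mul_pos_right (m.h_pos.trans_le (m.nonres μ hμ)) (pow_nonneg (by linarith [m.one_le]) _)

theorem eigen_ne_one (μ : m.A × ℤˣ →₀ ℕ) (hμ : ¬ Resonant μ) : eigen m.ω m.h μ ≠ 1 := fun h =>
  (m.norm_one_sub_eigen_pos hμ).ne' (by rw [h, sub_self, norm_zero])

/-- The composition of polynomials with the linear step of the model. -/
def rot : Poly m.A →ₗ[ℂ] Poly m.A := rotOp m.ω m.h

/-- The formal power series `h Q`, constant in the order parameter. -/
def step : ℕ → Poly m.A := Pi.single 0 ((m.h : ℂ) • m.Q)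

/-- The generator of the normalizing transformation of the model. -/
def generator : ℕ → Poly m.A :=
  normalGenerator bracket m.step m.rot (divOp m.ω m.h) resOp

/-- The resonant normal form of the model. -/
def resonantForm : ℕ → Poly m.A := normalForm bracket m.step m.rot (divOp m.ω m.h) resOp

/-- The formal integral of the model that starts at the action `I_a`. -/
def integral (a : m.A) : ℕ → Poly m.A :=
  formalIntegral bracket m.step m.rot (divOp m.ω m.h) resOp (actionPoly a)

theorem evol_step (q : ℕ) (F : Poly m.A) : evol bracket m.step m.rot q F
    = ((m.h : ℂ) ^ q / (q.factorial : ℂ)) • (bracket.flip m.Q)^[q] (m.rot F) := by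
  rw [step, evol_single_zero, map_smul, ← Module.End.pow_apply, smul_pow, LinearMap.smul_apply,
    Module.End.pow_apply, smul_smul, inv_mul_eq_div]

theorem integral_zero (a : m.A) : m.integral a 0 = actionPoly a := formalIntegral_zero ..

theorem evolve_integral (a : m.A) :
    evolve bracket m.step m.rot (m.integral a) = m.integral a :=
  evolve_formalIntegral _ bracket_isLeibniz (rotOp_bracket m.ω m.h)
    (divOp_sub_rotOp_add_resOp m.eigen_ne_one) (rotOp_actionPoly m.ω m.h a)
    (bracket_actionPoly_resOp a)

theorem rot_mem_vanishingTo (n : ℕ) (F : Poly m.A) (hF : F ∈ vanishingTo m.A n) :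
    m.rot F ∈ vanishingTo m.A n := diag_mem_pow_idealOfVars _ hF

theorem step_mem_vanishingTo (k : ℕ) : m.step k ∈ vanishingTo m.A (k + 3) := by
  rw [step]
  rcases eq_or_ne k 0 with rfl | hk
  · rw [Pi.single_eq_same]
    exact Submodule.smul_of_tower_mem _ _ m.Q_mem
  · rw [Pi.single_eq_of_ne hk]
    exact zero_mem _

theorem integral_mem_vanishingTo (a : m.A) (k : ℕ) : m.integral a k ∈ vanishingTo m.A (k + 2) :=
  formalIntegral_mem_vanishingTo m.rot_mem_vanishingTo (fun _ _ => diag_mem_pow_idealOfVars _)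
    (fun _ _ => diag_mem_pow_idealOfVars _) m.step_mem_vanishingTo (actionPoly_mem_vanishingTo a) k

end Model

end Models

section Tame

variable {c : ℕ} {b : ℕ → ℕ} {ι : Type*}

/-- A family of polynomials is tame if it is bounded uniformly in terms of `Λ`. -/
def Tame (s : ι → Model c b) (F : ∀ i, Poly (s i).A) : Prop :=
  ∃ p, ∀ i, PolyBound (s i).Λ p (F i)

variable {s : ι → Model c b}

namespace Tame

theorem zero : Tame s fun _ => 0 :=
  ⟨0, fun i => ⟨by simp, by simp⟩⟩

variable {F G : ∀ i, Poly (s i).A}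

theorem add (hF : Tame s F) (hG : Tame s G) : Tame s fun i => F i + G i := by
  obtain ⟨p, hp⟩ := hF
  obtain ⟨q, hq⟩ := hG
  refine ⟨max p q + 1, fun i => ?_⟩
  obtain ⟨hFdeg, hFnorm⟩ := (hp i).mono (s i).one_le (le_max_left p q)
  obtain ⟨hGdeg, hGnorm⟩ := (hq i).mono (s i).one_le (le_max_right p q)
  refine ⟨(MvPolynomial.totalDegree_add _ _).trans (by omega), ?_⟩
  calc coeffNorm (F i + G i) ≤ (s i).Λ ^ max p q + (s i).Λ ^ max p q :=
        (coeffNorm_add_le _ _).trans (add_le_add hFnorm hGnorm)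
    _ = (s i).Λ ^ max p q * 2 := (mul_two _).symm
    _ ≤ (s i).Λ ^ (max p q + 1) := by
        rw [pow_succ]
        exact mul_le_mul_of_nonneg_left (s i).two_le (pow_nonneg (by linarith [(s i).one_le]) _)

theorem smul (hF : Tame s F) {k : ι → ℂ} {q : ℕ} (hk : ∀ i, ‖k i‖ ≤ (s i).Λ ^ q) :
    Tame s fun i => k i • F i := by
  obtain ⟨p, hp⟩ := hF
  refine ⟨q + p, fun i => ⟨(MvPolynomial.totalDegree_smul_le _ _).trans
    ((hp i).1.trans (Nat.le_add_left p q)), ?_⟩⟩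
  rw [coeffNorm_smul, pow_add]
  exact mul_le_mul (hk i) (hp i).2 (coeffNorm_nonneg _)
    (pow_nonneg (by linarith [(s i).one_le]) _)

theorem sub (hF : Tame s F) (hG : Tame s G) : Tame s fun i => F i - G i := by
  simpa [sub_eq_add_neg] using hF.add (hG.smul (k := fun _ => -1) (q := 0) (by simp))

theorem sum {κ : Type*} (t : Finset κ) {F : κ → ∀ i, Poly (s i).A}
    (hF : ∀ k ∈ t, Tame s (F k)) : Tame s fun i => ∑ k ∈ t, F k i := by
  classical
  induction t using Finset.induction_on with
  | empty => exact zero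
  | insert k t hk ih =>
    simp only [Finset.sum_insert hk]
    exact (hF k (Finset.mem_insert_self k t)).add
      (ih fun k' hk' => hF k' (Finset.mem_insert_of_mem hk'))

protected theorem bracket (hF : Tame s F) (hG : Tame s G) :
    Tame s fun i => bracket (F i) (G i) := by
  obtain ⟨p, hp⟩ := hF
  obtain ⟨q, hq⟩ := hG
  refine ⟨c + ((p + p) + (q + q)), fun i => ⟨?_, ?_⟩⟩
  · exact (totalDegree_bracket_le _ _).trans ((add_le_add (hp i).1 (hq i).1).trans (by omega))
  · have hΛ := (s i).one_le
    have hdeg {n : ℕ} {F : Poly (s i).A} (hn : F.totalDegree ≤ n) :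
        (F.totalDegree : ℝ) ≤ (s i).Λ ^ n :=
      (Nat.cast_le.mpr hn).trans (natCast_le_pow (s i).two_le n)
    have hcF := coeffNorm_nonneg (F i)
    have hcG := coeffNorm_nonneg (G i)
    refine (coeffNorm_bracket_le _ _).trans ?_
    rw [pow_add, pow_add _ (p + p), pow_add _ p, pow_add _ q]
    gcongr
    exacts [(s i).card_le, hdeg (hp i).1, (hp i).2, hdeg (hq i).1, (hq i).2]

theorem iterate_bracket (hF : Tame s F) (hG : Tame s G) (q : ℕ) :
    Tame s fun i => (bracket.flip (G i))^[q] (F i) := by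
  induction q with
  | zero => exact hF
  | succ q ih =>
    simp only [Function.iterate_succ_apply', LinearMap.flip_apply]
    exact ih.bracket hG

protected theorem diag (hF : Tame s F) {w : ∀ i, ((s i).A × ℤˣ →₀ ℕ) → ℂ} {k : ℕ → ℕ}
    (hw : ∀ i μ, ‖w i μ‖ ≤ (s i).Λ ^ k μ.degree) : Tame s fun i => diag (w i) (F i) := by
  obtain ⟨p, hp⟩ := hF
  set q := ∑ n ∈ Finset.range (p + 1), k n
  refine ⟨q + p, fun i => ⟨(totalDegree_diag_le _ _).trans ((hp i).1.trans (Nat.le_add_left p q)),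
    ?_⟩⟩
  have hΛ := (s i).one_le
  have hweight : ∀ μ ∈ (F i).support, ‖w i μ‖ ≤ (s i).Λ ^ q := fun μ hμ => by
    refine (hw i μ).trans (pow_le_pow_right₀ hΛ ?_)
    exact Finset.single_le_sum (f := k) (fun _ _ => Nat.zero_le _)
      (Finset.mem_range_succ_iff.mpr ((MvPolynomial.le_totalDegree hμ).trans (hp i).1))
  rw [pow_add]
  exact (coeffNorm_diag_le (w i) (F i) hweight).trans
    (mul_le_mul_of_nonneg_left (hp i).2 (by positivity))

theorem rot (hF : Tame s F) : Tame s fun i => (s i).rot (F i) :=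
  hF.diag (k := fun _ => 0) fun i μ => by simp

protected theorem resOp (hF : Tame s F) : Tame s fun i => resOp (F i) := by
  classical
  refine hF.diag (k := fun _ => 0) fun i μ => ?_
  split_ifs <;> simp

/-- The small divisors are of order `h`, so `divOp` costs a factor `h⁻¹`. -/
protected theorem divOp (hF : Tame s fun i => ((s i).h : ℂ)⁻¹ • F i) :
    Tame s fun i => divOp (s i).ω (s i).h (F i) := by
  classical
  have hdiag : Tame s fun i => diag (fun μ => if Resonant μ then 0 else
      ((s i).h : ℂ) * (1 - eigen (s i).ω (s i).h μ)⁻¹) (((s i).h : ℂ)⁻¹ • F i) := by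
    refine hF.diag (k := b) fun i μ => ?_
    split_ifs with hμ
    · rw [norm_zero]
      exact pow_nonneg (by linarith [(s i).one_le]) _
    · rw [norm_mul, norm_inv, Complex.norm_real, Real.norm_of_nonneg (s i).h_pos.le,
        ← div_eq_mul_inv, div_le_iff₀ ((s i).norm_one_sub_eigen_pos hμ)]
      exact (s i).nonres μ hμ
  convert hdiag using 2 with i
  have hne := (s i).h_ne_zero
  ext μ
  simp only [divOp, coeff_diag, MvPolynomial.coeff_smul, smul_eq_mul]
  split_ifs
  · simp
  · field_simp

theorem evol_id {Y : ℕ → ∀ i, Poly (s i).A} (hF : Tame s F) {m : ℕ}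
    (hY : ∀ k < m, Tame s (Y k)) :
    Tame s fun i => evol bracket (fun k => Y k i) LinearMap.id m (F i) := by
  induction m using Nat.strong_induction_on with
  | _ m ih =>
    cases m with
    | zero => simpa only [evol_zero, LinearMap.id_apply] using hF
    | succ m =>
      simp only [evol_succ_apply]
      refine (sum _ fun p hp => ?_).smul (q := 0) fun i => ?_
      · rw [mem_antidiagonal] at hp
        exact (ih p.1 (by omega) fun k hk => hY k (by omega)).bracket (hY p.2 (by omega))
      · rw [norm_inv, Complex.norm_natCast, pow_zero]
        exact inv_le_one_of_one_le₀ (by exact_mod_cast Nat.le_add_left 1 m)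

protected theorem Q : Tame s fun i => (s i).Q := ⟨c, fun i => (s i).polyBound_Q⟩

protected theorem actionPoly (a : ∀ i, (s i).A) : Tame s fun i => actionPoly (a i) :=
  ⟨2, fun i => ⟨totalDegree_actionPoly_le _, (coeffNorm_actionPoly _).trans_le
    (one_le_pow₀ (s i).one_le)⟩⟩

theorem pow_div_factorial_smul (hF : Tame s F) (l q : ℕ) :
    Tame s fun i => (((s i).h : ℂ) ^ l / (q.factorial : ℂ)) • F i := by
  refine hF.smul (q := c * l) fun i => ?_
  rw [norm_div, norm_pow, Complex.norm_natCast, pow_mul]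
  exact (div_le_self (by positivity) (by exact_mod_cast q.factorial_pos)).trans
    (pow_le_pow_left₀ (norm_nonneg _) (s i).norm_h_le l)

theorem evol_step (hF : Tame s F) (q : ℕ) :
    Tame s fun i => evol bracket (s i).step (s i).rot q (F i) := by
  simp only [Model.evol_step]
  exact (hF.rot.iterate_bracket Tame.Q q).pow_div_factorial_smul q q

theorem inv_smul_evol_step_succ (hF : Tame s F) (q : ℕ) :
    Tame s fun i => ((s i).h : ℂ)⁻¹ • evol bracket (s i).step (s i).rot (q + 1) (F i) := by
  have heq (i) : ((s i).h : ℂ)⁻¹ • evol bracket (s i).step (s i).rot (q + 1) (F i)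
      = (((s i).h : ℂ) ^ q / ((q + 1).factorial : ℂ)) •
        (bracket.flip (s i).Q)^[q + 1] ((s i).rot (F i)) := by
    rw [Model.evol_step, smul_smul, pow_succ', mul_div_assoc, inv_mul_cancel_left₀ (s i).h_ne_zero]
  simp only [heq]
  exact (hF.rot.iterate_bracket Tame.Q (q + 1)).pow_div_factorial_smul q (q + 1)

theorem inv_smul_homologicalRhs {Y Z : ∀ i, ℕ → Poly (s i).A} {m : ℕ}
    (hY : ∀ k < m, Tame s fun i => Y i k)
    (hZ : ∀ k < m, Tame s fun i => ((s i).h : ℂ)⁻¹ • Z i k) :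
    Tame s fun i => ((s i).h : ℂ)⁻¹ •
      homologicalRhs bracket (s i).step (s i).rot (Y i) (Z i) m := by
  cases m with
  | zero =>
    have hQ (i) : ((s i).h : ℂ)⁻¹ • (s i).step 0 = (s i).Q := by
      rw [Model.step, Pi.single_eq_same, inv_smul_smul₀ (s i).h_ne_zero]
    simpa only [homologicalRhs, hQ] using Tame.Q
  | succ m =>
    have hstep (i) : (s i).step (m + 1) = 0 := Pi.single_eq_of_ne m.succ_ne_zero _
    simp only [homologicalRhs, hstep, zero_add, Finset.smul_sum, smul_sub, ← map_smul]
    refine sum _ fun p hp => ?_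
    rw [mem_antidiagonal] at hp
    simp only [map_smul]
    refine ((hY p.2 (by omega)).inv_smul_evol_step_succ p.1).sub ?_
    simp only [← map_smul]
    exact (hZ p.2 (by omega)).evol_id (Y := fun k i => Y i k) fun k hk => hY k (by omega)

/-- The resonant form, like the perturbation `h Q` it comes from, is of order `h`. -/
theorem generator_resonantForm (m : ℕ) : Tame s (fun i => (s i).generator m) ∧
    Tame s fun i => ((s i).h : ℂ)⁻¹ • (s i).resonantForm m := by
  induction m using Nat.strong_induction_on with
  | _ m ih =>
    have hG := inv_smul_homologicalRhs (fun k hk => (ih k hk).1) fun k hk => (ih k hk).2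
    simp only [Model.generator, Model.resonantForm, normalGenerator_eq, normalForm_eq, ← map_smul]
    exact ⟨Tame.divOp hG, hG.resOp⟩

theorem integral (a : ∀ i, (s i).A) (m : ℕ) : Tame s fun i => (s i).integral (a i) m :=
  (Tame.actionPoly a).evol_id (Y := fun k i => (s i).generator k)
    fun k _ => (generator_resonantForm k).1

variable {n : ℕ}

theorem exists_norm_eval_le (hF : Tame s F) (hn : ∀ i, F i ∈ vanishingTo (s i).A n) :
    ∃ p : ℕ, ∀ i (z : Phase (s i).A) (ρ : ℝ), ‖z‖ ≤ ρ → ρ ≤ 1 →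
      ‖MvPolynomial.eval z (F i)‖ ≤ (s i).Λ ^ p * ρ ^ n := by
  obtain ⟨p, hp⟩ := hF
  refine ⟨p, fun i z ρ hz hρ => ?_⟩
  have hρ0 := (norm_nonneg z).trans hz
  exact (norm_eval_le (hn i) (fun j => (PiLp.norm_apply_le z j).trans hz) hρ0 hρ).trans
    (mul_le_mul_of_nonneg_right (hp i).2 (pow_nonneg hρ0 n))

theorem exists_norm_eval_pd_le (hF : Tame s F) (hn : ∀ i, F i ∈ vanishingTo (s i).A (n + 1)) :
    ∃ p : ℕ, ∀ i (z : Phase (s i).A) (ρ : ℝ) j, ‖z‖ ≤ ρ → ρ ≤ 1 →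
      ‖MvPolynomial.eval z (pd j (F i))‖ ≤ (s i).Λ ^ p * ρ ^ n := by
  obtain ⟨p, hp⟩ := hF
  refine ⟨p + p, fun i z ρ j hz hρ => ?_⟩
  have hρ0 := (norm_nonneg z).trans hz
  have hΛ := (s i).one_le
  have hcoeff : coeffNorm (pd j (F i)) ≤ (s i).Λ ^ (p + p) :=
    calc coeffNorm (pd j (F i)) ≤ (F i).totalDegree * coeffNorm (F i) := coeffNorm_pderiv_le j _
      _ ≤ (s i).Λ ^ p * (s i).Λ ^ p := mul_le_mul
          ((Nat.cast_le.mpr (hp i).1).trans (natCast_le_pow (s i).two_le p)) (hp i).2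
          (coeffNorm_nonneg _) (by positivity)
      _ = (s i).Λ ^ (p + p) := (pow_add _ _ _).symm
  exact (norm_eval_le (pderiv_mem_pow_idealOfVars j (hn i))
    (fun j => (PiLp.norm_apply_le z j).trans hz) hρ0 hρ).trans
    (mul_le_mul_of_nonneg_right hcoeff (pow_nonneg hρ0 n))

end Tame

end Tame

section Evaluation

theorem hasFDerivAt_eval {σ 𝕜 : Type*} [Fintype σ] [NontriviallyNormedField 𝕜]
    (F : MvPolynomial σ 𝕜) (z : σ → 𝕜) :
    HasFDerivAt (fun z : σ → 𝕜 => MvPolynomial.eval z F)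
      (∑ j, MvPolynomial.eval z (MvPolynomial.pderiv j F) •
        (ContinuousLinearMap.proj j : (σ → 𝕜) →L[𝕜] 𝕜)) z := by
  classical
  induction F using MvPolynomial.induction_on with
  | C c =>
    simp only [MvPolynomial.eval_C]
    refine (hasFDerivAt_const c z).congr_fderiv ?_
    ext v
    simp
  | add F G hF hG =>
    simp only [map_add]
    refine (hF.add hG).congr_fderiv ?_
    ext v
    simp [add_mul, Finset.sum_add_distrib]
  | mul_X F i hF =>
    simp only [map_mul, MvPolynomial.eval_X]
    refine (hF.mul (hasFDerivAt_apply i z)).congr_fderiv ?_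
    ext v
    simp [MvPolynomial.pderiv_X, Pi.single_apply, apply_ite (MvPolynomial.eval z), add_mul,
      Finset.sum_add_distrib, Finset.mul_sum, mul_assoc]

theorem hasDerivWithinAt_eval {σ : Type*} [Fintype σ] (F : MvPolynomial σ ℂ) {γ : ℝ → σ → ℂ}
    {v : σ → ℂ} {s : Set ℝ} {t : ℝ} (hγ : ∀ j, HasDerivWithinAt (fun t => γ t j) (v j) s t) :
    HasDerivWithinAt (fun t => MvPolynomial.eval (γ t) F)
      (∑ j, MvPolynomial.eval (γ t) (MvPolynomial.pderiv j F) * v j) s t := by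
  refine (((hasFDerivAt_eval F (γ t)).restrictScalars ℝ).comp_hasDerivWithinAt t
    (hasDerivWithinAt_pi.mpr hγ)).congr_deriv ?_
  simp

variable {A : Type} [Fintype A]

/-- The linear step `z_j ↦ exp (-i h δ_j ω_j) z_j`. -/
def rotMap (ω : A → ℝ) (h : ℝ) (z : Phase A) : Phase A :=
  WithLp.toLp 2 fun j => eigen ω h (Finsupp.single j 1) * z j

theorem eigen_eq_prod {A : Type} (ω : A → ℝ) (h : ℝ) (μ : A × ℤˣ →₀ ℕ) :
    eigen ω h μ = μ.prod fun j n => eigen ω h (Finsupp.single j 1) ^ n := by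
  classical
  induction μ using Finsupp.induction_linear with
  | zero => simp [eigen_zero]
  | add μ ν hμ hν =>
    rw [eigen_add, Finsupp.prod_add_index' (by simp) (fun _ _ _ => pow_add _ _ _), hμ, hν]
  | single j n =>
    rw [Finsupp.prod_single_index (by simp)]
    induction n with
    | zero => simp [eigen_zero]
    | succ n ih => rw [Finsupp.single_add, eigen_add, ih, pow_succ]

theorem eval_rotOp (ω : A → ℝ) (h : ℝ) (F : Poly A) (z : Phase A) :
    MvPolynomial.eval z (rotOp ω h F) = MvPolynomial.eval (rotMap ω h z) F := by
  induction F using MvPolynomial.induction_on' with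
  | add F G hF hG => simp only [map_add, hF, hG]
  | monomial μ c =>
    rw [rotOp, diag_monomial, MvPolynomial.eval_monomial, MvPolynomial.eval_monomial,
      eigen_eq_prod]
    simp only [rotMap, mul_pow, Finsupp.prod_mul]
    ring

variable [DecidableEq A]

/-- The value at `z` of the Poisson bracket of the polynomial `F` with `P - Q`. -/
def bracketError (P : Phase A → ℂ) (Q F : Poly A) (z : Phase A) : ℂ :=
  ∑ j, symp j * (MvPolynomial.eval z (pd j F) *
    (fderiv ℂ P z (EuclideanSpace.single (bar j) 1) - MvPolynomial.eval z (pd (bar j) Q)))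

theorem norm_bracketError_le {P : Phase A → ℂ} {Q F : Poly A} {z : Phase A} {D E : ℝ}
    (hF : ∀ j, ‖MvPolynomial.eval z (pd j F)‖ ≤ D)
    (hPQ : ∀ j, ‖fderiv ℂ P z (EuclideanSpace.single j 1) - MvPolynomial.eval z (pd j Q)‖ ≤ E) :
    ‖bracketError P Q F z‖ ≤ Fintype.card (A × ℤˣ) * (D * E) := by
  rw [← nsmul_eq_mul, ← Finset.card_univ, ← Finset.sum_const]
  refine norm_sum_le_of_le _ fun j _ => ?_
  rw [norm_mul, norm_symp, one_mul, norm_mul]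
  exact mul_le_mul (hF j) (hPQ _) (norm_nonneg _) ((norm_nonneg _).trans (hF j))

theorem hamVF_apply (P : Phase A → ℂ) (z : Phase A) (j : A × ℤˣ) :
    hamVF P z j = symp j * fderiv ℂ P z (EuclideanSpace.single (bar j) 1) := rfl

theorem hasDerivWithinAt_eval_hamVF (P : Phase A → ℂ) (Q F : Poly A)
    {γ : ℝ → Phase A} {s : Set ℝ} {t : ℝ} (hγ : HasDerivWithinAt γ (hamVF P (γ t)) s t) :
    HasDerivWithinAt (fun t => MvPolynomial.eval (γ t) F)
      (MvPolynomial.eval (γ t) (bracket F Q) + bracketError P Q F (γ t)) s t := by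
  refine (hasDerivWithinAt_eval F (γ := fun t j => γ t j) (v := fun j => hamVF P (γ t) j)
    (fun j => ?_)).congr_deriv (Eq.symm ?_)
  · exact ((EuclideanSpace.proj j : Phase A →L[ℂ] ℂ).restrictScalars ℝ).hasFDerivAt
      |>.comp_hasDerivWithinAt t hγ
  · rw [poissonBracket_apply, bracketError, map_sum, ← Finset.sum_add_distrib]
    refine Finset.sum_congr rfl fun j _ => ?_
    rw [MvPolynomial.smul_eval, map_mul, hamVF_apply]
    ring

end Evaluation

section TaylorChain

theorem hasDerivAt_sub_pow_div_factorial (h : ℂ) (q : ℕ) (t : ℝ) :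
    HasDerivAt (fun t : ℝ => (h - t) ^ (q + 1) / ((q + 1).factorial : ℂ))
      (-((h - t) ^ q / (q.factorial : ℂ))) t := by
  have hsub : HasDerivAt (fun t : ℝ => h - t) (-1) t := by
    simpa using (Complex.ofRealCLM.hasDerivAt (x := t)).const_sub h
  refine ((hsub.pow (q + 1)).div_const ((q + 1).factorial : ℂ)).congr_deriv (Eq.symm ?_)
  have hfac : (q.factorial : ℂ) ≠ 0 := Nat.cast_ne_zero.mpr q.factorial_ne_zero
  have hsucc : (q : ℂ) + 1 ≠ 0 := Nat.cast_add_one_ne_zero q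
  rw [Nat.factorial_succ]
  push_cast
  field_simp

theorem hasDerivWithinAt_sum_sub_pow_mul {f : ℕ → ℝ → ℂ} {e : ℕ → ℂ} {s : Set ℝ} {t : ℝ}
    (h : ℂ) {M : ℕ} (hf : ∀ q ≤ M, HasDerivWithinAt (f q) (f (q + 1) t + e q) s t) :
    HasDerivWithinAt
      (fun t : ℝ => ∑ q ∈ Finset.range (M + 1), ((h - t) ^ q / (q.factorial : ℂ)) * f q t)
      (((h - t) ^ M / (M.factorial : ℂ)) * f (M + 1) t
        + ∑ q ∈ Finset.range (M + 1), ((h - t) ^ q / (q.factorial : ℂ)) * e q) s t := by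
  induction M with
  | zero => simpa using hf 0 le_rfl
  | succ M ih =>
    have hlast := (hasDerivAt_sub_pow_div_factorial h M t).hasDerivWithinAt.mul (hf (M + 1) le_rfl)
    simp only [Finset.sum_range_succ _ (M + 1)]
    exact ((ih fun q hq => hf q (hq.trans M.le_succ)).add hlast).congr_deriv (by ring)

theorem norm_sub_pow_div_factorial_le {h H t : ℝ} (ht : t ∈ Set.Icc 0 h) (hH : h ≤ H)
    (hH1 : 1 ≤ H) {q M : ℕ} (hq : q ≤ M) : ‖((h : ℂ) - t) ^ q / (q.factorial : ℂ)‖ ≤ H ^ M := by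
  have hsub : 0 ≤ h - t := sub_nonneg.mpr ht.2
  rw [norm_div, norm_pow, ← Complex.ofReal_sub, Complex.norm_real, Real.norm_of_nonneg hsub,
    Complex.norm_natCast]
  calc (h - t) ^ q / (q.factorial : ℝ) ≤ (h - t) ^ q :=
        div_le_self (pow_nonneg hsub _) (by exact_mod_cast q.factorial_pos)
    _ ≤ H ^ q := pow_le_pow_left₀ hsub (by linarith [ht.1]) _
    _ ≤ H ^ M := pow_le_pow_right₀ hH1 hq

theorem norm_sub_sum_pow_mul_le {f e : ℕ → ℝ → ℂ} {h H B : ℝ} (M : ℕ) (h0 : 0 ≤ h)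
    (hH : h ≤ H) (hH1 : 1 ≤ H)
    (hf : ∀ q ≤ M, ∀ t ∈ Set.Icc 0 h,
      HasDerivWithinAt (f q) (f (q + 1) t + e q t) (Set.Icc 0 h) t)
    (hfB : ∀ t ∈ Set.Icc 0 h, ‖f (M + 1) t‖ ≤ B)
    (heB : ∀ q ≤ M, ∀ t ∈ Set.Icc 0 h, ‖e q t‖ ≤ B) :
    ‖f 0 h - ∑ q ∈ Finset.range (M + 1), ((h : ℂ) ^ q / (q.factorial : ℂ)) * f q 0‖
      ≤ (M + 2) * H ^ (M + 1) * B := by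
  have hHM : 0 ≤ H ^ M := by positivity
  have hB0 : 0 ≤ B := (norm_nonneg _).trans (hfB 0 ⟨le_rfl, h0⟩)
  have hend : ∑ q ∈ Finset.range (M + 1), (((h : ℂ) - (h : ℝ)) ^ q / (q.factorial : ℂ)) * f q h
      = f 0 h := by
    rw [Finset.sum_range_succ']
    simp
  have hmean := norm_image_sub_le_of_norm_deriv_le_segment' (C := (M + 2) * H ^ M * B)
    (fun t ht => hasDerivWithinAt_sum_sub_pow_mul (h : ℂ) fun _ hq => hf _ hq t ht)
    (fun t ht => ?_) h ⟨h0, le_rfl⟩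
  · simp only [hend, Complex.ofReal_zero, sub_zero] at hmean
    calc _ ≤ (M + 2) * H ^ M * B * h := hmean
      _ ≤ (M + 2) * H ^ M * B * H := by gcongr
      _ = (M + 2) * H ^ (M + 1) * B := by ring
  · have ht' : t ∈ Set.Icc 0 h := ⟨ht.1, ht.2.le⟩
    have hterm {q : ℕ} (hq : q ≤ M) {w : ℂ} (hw : ‖w‖ ≤ B) :
        ‖((h : ℂ) - t) ^ q / (q.factorial : ℂ) * w‖ ≤ H ^ M * B := by
      rw [norm_mul]
      exact mul_le_mul (norm_sub_pow_div_factorial_le ht' hH hH1 hq) hw (norm_nonneg _) hHM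
    calc _ ≤ H ^ M * B + ∑ _q ∈ Finset.range (M + 1), H ^ M * B :=
          (norm_add_le _ _).trans (add_le_add (hterm le_rfl (hfB t ht'))
            (norm_sum_le_of_le _ fun _ hq =>
              have hq' := Finset.mem_range_succ_iff.mp hq
              hterm hq' (heB _ hq' t ht')))
      _ = (M + 2) * H ^ M * B := by
          rw [Finset.sum_const, Finset.card_range, nsmul_eq_mul]
          push_cast
          ring

end TaylorChain

section OneStep

variable {c : ℕ} {b : ℕ → ℕ}

namespace Model

variable (m : Model c b) (M : ℕ) (a : m.A)

/-- The truncation at order `M` of the formal integral that starts at the action `I_a`. -/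
def approxInt : Poly m.A := ∑ k ∈ Finset.range (M + 1), m.integral a k

/-- The part of order larger than `M` in the formal image of `approxInt` under the step. -/
def remainder : Poly m.A :=
  ∑ q ∈ Finset.range (M + 1), ∑ k ∈ Finset.Ico (M + 1 - q) (M + 1),
    evol bracket m.step m.rot q (m.integral a k)

theorem sum_evol_approxInt :
    ∑ q ∈ Finset.range (M + 1), evol bracket m.step m.rot q (m.approxInt M a)
      = m.approxInt M a + m.remainder M a := by
  have hinvariant (k : ℕ) : m.integral a k
      = ∑ q ∈ Finset.range (k + 1), evol bracket m.step m.rot q (m.integral a (k - q)) := by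
    rw [← Finset.Nat.sum_antidiagonal_eq_sum_range_succ
      fun q l => evol bracket m.step m.rot q (m.integral a l)]
    exact (congrFun (m.evolve_integral a) k).symm
  have hlow : m.approxInt M a = ∑ q ∈ Finset.range (M + 1), ∑ k ∈ Finset.range (M + 1 - q),
      evol bracket m.step m.rot q (m.integral a k) := by
    rw [← Finset.sum_range_diag_flip, approxInt]
    exact Finset.sum_congr rfl fun k _ => hinvariant k
  conv_rhs => rw [hlow]
  rw [remainder, ← Finset.sum_add_distrib]
  refine Finset.sum_congr rfl fun q _ => ?_
  rw [Finset.sum_range_add_sum_Ico _ (Nat.sub_le _ _), approxInt, map_sum]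

theorem approxInt_mem_vanishingTo : m.approxInt M a ∈ vanishingTo m.A 2 :=
  Submodule.sum_mem _ fun k _ => Ideal.pow_le_pow_right (by omega) (m.integral_mem_vanishingTo a k)

theorem approxInt_sub_actionPoly_mem_vanishingTo :
    m.approxInt M a - actionPoly a ∈ vanishingTo m.A 3 := by
  rw [approxInt, Finset.sum_range_succ', integral_zero, add_sub_cancel_right]
  exact Submodule.sum_mem _ fun k _ =>
    Ideal.pow_le_pow_right (by omega) (m.integral_mem_vanishingTo a (k + 1))

theorem remainder_mem_vanishingTo : m.remainder M a ∈ vanishingTo m.A (M + 3) := by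
  refine Submodule.sum_mem _ fun q hq => Submodule.sum_mem _ fun k hk => ?_
  rw [Finset.mem_range] at hq
  rw [Finset.mem_Ico] at hk
  exact Ideal.pow_le_pow_right (by omega) (evol_mem_vanishingTo (n := k) m.rot_mem_vanishingTo
    (m.integral_mem_vanishingTo a k) fun l _ => m.step_mem_vanishingTo l)

theorem iterate_bracket_mem_vanishingTo {F : Poly m.A} {n : ℕ}
    (hF : F ∈ vanishingTo m.A (n + 1)) (q : ℕ) :
    (bracket.flip m.Q)^[q] F ∈ vanishingTo m.A (n + q + 1) := by
  induction q with
  | zero => exact hF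
  | succ q ih =>
    rw [Function.iterate_succ_apply']
    exact Ideal.pow_le_pow_right (by omega) (bracket_mem_vanishingTo (n := 2) ih m.Q_mem)

end Model

/-- The Hamiltonian `P` is approximated to order `M + 3` at the origin by the polynomial of the
model, on a ball whose radius is bounded below by a power of `Λ⁻¹`. -/
structure Model.Approximates (m : Model c b) (M : ℕ) (V : Set (Phase m.A)) (P : Phase m.A → ℂ) :
    Prop where
  isOpen : IsOpen V
  contDiffOn : ContDiffOn ℂ ((⊤ : ℕ∞) : WithTop ℕ∞) P V
  isRealHam : IsRealHam V P
  ball_subset : Metric.ball 0 (1 / m.Λ ^ c) ⊆ V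
  norm_fderiv_sub_le : ∀ z τ, 0 < τ → ‖z‖ ≤ τ → m.Λ ^ c * τ ≤ 1 → ∀ j,
    ‖fderiv ℂ P z (EuclideanSpace.single j 1) - MvPolynomial.eval z (pd j m.Q)‖
      ≤ m.Λ ^ c * τ ^ (M + 2)
  norm_hamVF_le : ∀ z τ, 0 < τ → ‖z‖ ≤ τ → m.Λ ^ c * τ ≤ 1 → ‖hamVF P z‖ ≤ m.Λ ^ c * τ ^ 2

variable {ι : Type*} {s : ι → Model c b}

namespace Tame

theorem approxInt (M : ℕ) (a : ∀ i, (s i).A) : Tame s fun i => (s i).approxInt M (a i) :=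
  sum _ fun k _ => integral a k

theorem remainder (M : ℕ) (a : ∀ i, (s i).A) : Tame s fun i => (s i).remainder M (a i) :=
  sum _ fun q _ => sum _ fun k _ => (integral a k).evol_step q

variable {F : ∀ i, Poly (s i).A}

theorem exists_norm_bracketError_le (hF : Tame s F)
    (hF2 : ∀ i, F i ∈ vanishingTo (s i).A 2) (M : ℕ) :
    ∃ p : ℕ, ∀ i V P, (s i).Approximates M V P → ∀ (z : Phase (s i).A) (ρ : ℝ), 0 < ρ →
      (s i).Λ ^ c * ρ ≤ 1 → ‖z‖ ≤ ρ →
      ‖bracketError P (s i).Q (F i) z‖ ≤ (s i).Λ ^ p * ρ ^ (M + 3) := by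
  obtain ⟨p, hp⟩ := hF.exists_norm_eval_pd_le hF2
  refine ⟨c + p + c, fun i V P hP z ρ hρ0 hsmall hz => ?_⟩
  have hΛ := (s i).one_le
  have hρ : ρ ≤ 1 := (le_mul_of_one_le_left hρ0.le (one_le_pow₀ hΛ)).trans hsmall
  calc ‖bracketError P (s i).Q (F i) z‖
      ≤ Fintype.card ((s i).A × ℤˣ) * (((s i).Λ ^ p * ρ ^ 1) * ((s i).Λ ^ c * ρ ^ (M + 2))) :=
        norm_bracketError_le (fun j => hp i z ρ j hz hρ)
          (hP.norm_fderiv_sub_le z ρ hρ0 hz hsmall)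
    _ ≤ (s i).Λ ^ c * (((s i).Λ ^ p * ρ ^ 1) * ((s i).Λ ^ c * ρ ^ (M + 2))) :=
        mul_le_mul_of_nonneg_right (s i).card_le (by positivity)
    _ = (s i).Λ ^ (c + p + c) * ρ ^ (M + 3) := by ring

theorem exists_norm_eval_sub_taylor_le (hF : Tame s F)
    (hF2 : ∀ i, F i ∈ vanishingTo (s i).A 2) (M : ℕ) :
    ∃ p : ℕ, ∀ i V P, (s i).Approximates M V P → ∀ (z : Phase (s i).A) γ (ρ : ℝ), 0 < ρ →
      (s i).Λ ^ c * ρ ≤ 1 → IsTrajectory V P (s i).h z γ → (∀ t ∈ Set.Icc 0 (s i).h, ‖γ t‖ ≤ ρ) →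
      ‖MvPolynomial.eval (γ (s i).h) (F i) - ∑ q ∈ Finset.range (M + 1),
        (((s i).h : ℂ) ^ q / (q.factorial : ℂ)) *
          MvPolynomial.eval z ((bracket.flip (s i).Q)^[q] (F i))‖
        ≤ (s i).Λ ^ p * ρ ^ (M + 3) := by
  have hmem (q i) : (bracket.flip (s i).Q)^[q] (F i) ∈ vanishingTo (s i).A (1 + q + 1) :=
    (s i).iterate_bracket_mem_vanishingTo (hF2 i) q
  have htame (q) := hF.iterate_bracket Tame.Q q
  obtain ⟨p₁, hp₁⟩ := (htame (M + 1)).exists_norm_eval_le (hmem (M + 1))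
  choose p₂ hp₂ using fun q => (htame q).exists_norm_bracketError_le
    (fun i => Ideal.pow_le_pow_right (by omega) (hmem q i)) M
  set p := p₁ + ∑ q ∈ Finset.range (M + 1), p₂ q
  refine ⟨(M + 2) + c * (M + 1) + p, fun i V P hP z γ ρ hρ0 hsmall hγ hγρ => ?_⟩
  have hΛ := (s i).one_le
  have hρ : ρ ≤ 1 := (le_mul_of_one_le_left hρ0.le (one_le_pow₀ hΛ)).trans hsmall
  have hmono {q : ℕ} (hq : q ≤ p) :
      (s i).Λ ^ q * ρ ^ (M + 3) ≤ (s i).Λ ^ p * ρ ^ (M + 3) := by gcongr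
  have htaylor := norm_sub_sum_pow_mul_le M
    (f := fun q t => MvPolynomial.eval (γ t) ((bracket.flip (s i).Q)^[q] (F i)))
    (e := fun q t => bracketError P (s i).Q ((bracket.flip (s i).Q)^[q] (F i)) (γ t))
    (B := (s i).Λ ^ p * ρ ^ (M + 3)) (s i).h_pos.le (s i).h_le (one_le_pow₀ hΛ)
    (fun q _ t ht => by
      simp only [Function.iterate_succ_apply', LinearMap.flip_apply]
      exact hasDerivWithinAt_eval_hamVF P _ _ (hγ.2 t ht).2)
    (fun t ht => (hp₁ i (γ t) ρ (hγρ t ht) hρ).trans (by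
      rw [show 1 + (M + 1) + 1 = M + 3 by ring]
      exact hmono (Nat.le_add_right ..)))
    (fun q hq t ht => (hp₂ q i V P hP (γ t) ρ hρ0 hsmall (hγρ t ht)).trans
      (hmono ((Finset.single_le_sum (fun _ _ => Nat.zero_le _)
        (Finset.mem_range_succ_iff.mpr hq)).trans (Nat.le_add_left ..))))
  rw [hγ.1] at htaylor
  calc _ ≤ ((M : ℝ) + 2) * ((s i).Λ ^ c) ^ (M + 1) * ((s i).Λ ^ p * ρ ^ (M + 3)) := htaylor
    _ ≤ (s i).Λ ^ (M + 2) * ((s i).Λ ^ c) ^ (M + 1) * ((s i).Λ ^ p * ρ ^ (M + 3)) := by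
        gcongr
        exact_mod_cast natCast_le_pow (s i).two_le (M + 2)
    _ = (s i).Λ ^ ((M + 2) + c * (M + 1) + p) * ρ ^ (M + 3) := by ring

end Tame

theorem exists_norm_approxInt_step_le (M : ℕ) (a : ∀ i, (s i).A) :
    ∃ p : ℕ, ∀ i V P, (s i).Approximates M V P → ∀ (z : Phase (s i).A) γ (ρ : ℝ), 0 < ρ →
      (s i).Λ ^ c * ρ ≤ 1 → IsTrajectory V P (s i).h z γ → (∀ t ∈ Set.Icc 0 (s i).h, ‖γ t‖ ≤ ρ) →
      ‖MvPolynomial.eval (rotMap (s i).ω (s i).h (γ (s i).h)) ((s i).approxInt M (a i))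
        - MvPolynomial.eval z ((s i).approxInt M (a i))‖ ≤ (s i).Λ ^ p * ρ ^ (M + 3) := by
  obtain ⟨p₁, hp₁⟩ := (Tame.approxInt M a).rot.exists_norm_eval_sub_taylor_le
    (fun i => (s i).rot_mem_vanishingTo 2 _ ((s i).approxInt_mem_vanishingTo M (a i))) M
  obtain ⟨p₂, hp₂⟩ := (Tame.remainder M a).exists_norm_eval_le
    fun i => (s i).remainder_mem_vanishingTo M (a i)
  refine ⟨max p₁ p₂ + 1, fun i V P hP z γ ρ hρ0 hsmall hγ hγρ => ?_⟩
  have hΛ := (s i).one_le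
  have hρ : ρ ≤ 1 := (le_mul_of_one_le_left hρ0.le (one_le_pow₀ hΛ)).trans hsmall
  have hz : ‖z‖ ≤ ρ := hγ.1 ▸ hγρ 0 ⟨le_rfl, (s i).h_pos.le⟩
  have htaylor := hp₁ i V P hP z γ ρ hρ0 hsmall hγ hγρ
  have hsum : ∑ q ∈ Finset.range (M + 1), (((s i).h : ℂ) ^ q / (q.factorial : ℂ)) *
      MvPolynomial.eval z ((bracket.flip (s i).Q)^[q] ((s i).rot ((s i).approxInt M (a i))))
      = MvPolynomial.eval z ((s i).approxInt M (a i))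
        + MvPolynomial.eval z ((s i).remainder M (a i)) := by
    simp only [← map_add, ← Model.sum_evol_approxInt, map_sum, Model.evol_step,
      MvPolynomial.smul_eval]
  rw [hsum, Model.rot, eval_rotOp] at htaylor
  set v := MvPolynomial.eval (rotMap (s i).ω (s i).h (γ (s i).h)) ((s i).approxInt M (a i))
  set v₀ := MvPolynomial.eval z ((s i).approxInt M (a i))
  set w := MvPolynomial.eval z ((s i).remainder M (a i))
  have hmono {q : ℕ} (hq : q ≤ max p₁ p₂) :
      (s i).Λ ^ q * ρ ^ (M + 3) ≤ (s i).Λ ^ max p₁ p₂ * ρ ^ (M + 3) := by gcongr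
  calc ‖v - v₀‖ = ‖(v - (v₀ + w)) + w‖ := by ring_nf
    _ ≤ (s i).Λ ^ max p₁ p₂ * ρ ^ (M + 3) + (s i).Λ ^ max p₁ p₂ * ρ ^ (M + 3) :=
        (norm_add_le _ _).trans (add_le_add (htaylor.trans (hmono (le_max_left _ _)))
          ((hp₂ i z ρ hz hρ).trans (hmono (le_max_right _ _))))
    _ = (s i).Λ ^ max p₁ p₂ * ρ ^ (M + 3) * 2 := (mul_two _).symm
    _ ≤ (s i).Λ ^ max p₁ p₂ * ρ ^ (M + 3) * (s i).Λ :=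
        mul_le_mul_of_nonneg_left (s i).two_le (by positivity)
    _ = (s i).Λ ^ (max p₁ p₂ + 1) * ρ ^ (M + 3) := by ring

theorem exists_norm_approxInt_sub_action_le (M : ℕ) (a : ∀ i, (s i).A) :
    ∃ p : ℕ, ∀ i (z : Phase (s i).A) (ρ : ℝ), ‖z‖ ≤ ρ → ρ ≤ 1 →
      ‖MvPolynomial.eval z ((s i).approxInt M (a i)) - action (a i) z‖
        ≤ (s i).Λ ^ p * ρ ^ 3 := by
  simp only [← eval_actionPoly, ← map_sub]
  exact ((Tame.approxInt M a).sub (Tame.actionPoly a)).exists_norm_eval_le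
    fun i => (s i).approxInt_sub_actionPoly_mem_vanishingTo M (a i)

end OneStep

section CauchyEstimates

open scoped ContDiff

variable {E F : Type*} [NormedAddCommGroup E] [NormedSpace ℂ E] [NormedAddCommGroup F]
  [NormedSpace ℂ F]

theorem norm_fderiv_le_of_forall_closedBall {g : E → F} {z : E} {δ C : ℝ} (hδ : 0 < δ)
    (hg : ∀ w ∈ Metric.closedBall z δ, DifferentiableAt ℂ g w)
    (hC : ∀ w ∈ Metric.closedBall z δ, ‖g w‖ ≤ C) : ‖fderiv ℂ g z‖ ≤ C / δ := by
  have hC0 : 0 ≤ C := (norm_nonneg _).trans (hC z (Metric.mem_closedBall_self hδ.le))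
  refine ContinuousLinearMap.opNorm_le_bound _ (by positivity) fun v => ?_
  rcases eq_or_ne v 0 with rfl | hv
  · simp
  have hv0 : 0 < ‖v‖ := norm_pos_iff.mpr hv
  have hmem : ∀ t ∈ Metric.closedBall (0 : ℂ) (δ / ‖v‖), z + t • v ∈ Metric.closedBall z δ := by
    intro t ht
    rw [mem_closedBall_zero_iff, le_div_iff₀ hv0] at ht
    simpa [norm_smul] using ht
  have hder : ∀ t ∈ Metric.closedBall (0 : ℂ) (δ / ‖v‖),
      HasDerivAt (fun t : ℂ => g (z + t • v)) (fderiv ℂ g (z + t • v) v) t := fun t ht =>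
    (hg _ (hmem t ht)).hasFDerivAt.comp_hasDerivAt t
      (by simpa using ((hasDerivAt_id t).smul_const v).const_add z)
  have hcauchy := Complex.norm_deriv_le_of_forall_mem_sphere_norm_le (div_pos hδ hv0)
    (DifferentiableOn.diffContOnCl_ball
      (fun t ht => (hder t ht).differentiableAt.differentiableWithinAt) subset_rfl)
    (fun t ht => hC _ (hmem t (Metric.sphere_subset_closedBall ht)))
  rw [(hder 0 (Metric.mem_closedBall_self (by positivity))).deriv, zero_smul, add_zero] at hcauchy
  exact hcauchy.trans_eq (by field_simp)

variable {P : E → F} {ρ : ℝ}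

theorem contDiffAt_of_norm_lt {n : WithTop ℕ∞} (hP : ContDiffOn ℂ n P (Metric.ball 0 ρ)) {z : E}
    (hz : ‖z‖ < ρ) : ContDiffAt ℂ n P z :=
  hP.contDiffAt (Metric.isOpen_ball.mem_nhds (mem_ball_zero_iff.mpr hz))

theorem differentiableAt_iteratedFDeriv (hP : ContDiffOn ℂ ∞ P (Metric.ball 0 ρ)) (k : ℕ) {z : E}
    (hz : ‖z‖ < ρ) : DifferentiableAt ℂ (iteratedFDeriv ℂ k P) z :=
  (contDiffAt_of_norm_lt hP hz).differentiableAt_iteratedFDeriv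
    (by exact_mod_cast WithTop.coe_lt_top k)

theorem norm_iteratedFDeriv_add_le (hρ : 0 < ρ) (hP : ContDiffOn ℂ ∞ P (Metric.ball 0 ρ)) {n : ℕ}
    {B : ℝ} (hB : ∀ z : E, ‖z‖ < ρ → ‖iteratedFDeriv ℂ n P z‖ ≤ B) (k : ℕ) {z : E}
    (hz : ‖z‖ < ρ / 2 ^ k) : ‖iteratedFDeriv ℂ (n + k) P z‖ ≤ B * (2 ^ k / ρ) ^ k := by
  induction k generalizing z with
  | zero => simpa using hB z (by simpa using hz)
  | succ k ih =>
    have hB0 : 0 ≤ B := (norm_nonneg _).trans (hB 0 (by simpa using hρ))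
    have hle : ρ / 2 ^ k ≤ ρ := div_le_self hρ.le (one_le_pow₀ one_le_two)
    have hsplit : ρ / 2 ^ (k + 1) + ρ / 2 ^ (k + 1) = ρ / 2 ^ k := by
      rw [pow_succ]
      field_simp
      ring
    have hmem : ∀ w ∈ Metric.closedBall z (ρ / 2 ^ (k + 1)), ‖w‖ < ρ / 2 ^ k := fun w hw =>
      (norm_le_of_mem_closedBall hw).trans_lt (by linarith)
    rw [← add_assoc, ← norm_fderiv_iteratedFDeriv]
    calc _ ≤ B * (2 ^ k / ρ) ^ k / (ρ / 2 ^ (k + 1)) :=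
          norm_fderiv_le_of_forall_closedBall (by positivity)
            (fun w hw => differentiableAt_iteratedFDeriv hP _ ((hmem w hw).trans_le hle))
            (fun w hw => ih (hmem w hw))
      _ = B * ((2 ^ k / ρ) ^ k * (2 ^ (k + 1) / ρ)) := by field_simp
      _ ≤ B * ((2 ^ (k + 1) / ρ) ^ k * (2 ^ (k + 1) / ρ)) := by
          gcongr
          · exact one_le_two
          · exact k.le_succ
      _ = B * (2 ^ (k + 1) / ρ) ^ (k + 1) := by rw [pow_succ (_ / _) k]

end CauchyEstimates

section TaylorPolynomial

theorem sum_smul_single {ι : Type*} [Fintype ι] [DecidableEq ι] (v : EuclideanSpace ℂ ι) :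
    ∑ j, v j • EuclideanSpace.single j (1 : ℂ) = v := by
  ext l
  simp [Finset.sum_apply, Pi.single_apply]

theorem norm_le_sum_norm {ι : Type*} [Fintype ι] (v : EuclideanSpace ℂ ι) :
    ‖v‖ ≤ ∑ j, ‖v j‖ := by
  classical
  conv_lhs => rw [← sum_smul_single v]
  exact norm_sum_le_of_le _ fun j _ => by simp [norm_smul]

section Multilinear

variable {ι : Type*} [Fintype ι] [DecidableEq ι] {k : ℕ}
  (f : ContinuousMultilinearMap ℂ (fun _ : Fin k => EuclideanSpace ℂ ι) ℂ)

theorem multilinear_eq_sum (v : Fin k → EuclideanSpace ℂ ι) :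
    f v = ∑ j : Fin k → ι, (∏ i, v i (j i)) *
      f fun i => EuclideanSpace.single (j i) (1 : ℂ) := by
  conv_lhs => rw [← funext fun i => sum_smul_single (v i), ContinuousMultilinearMap.map_sum]
  refine Finset.sum_congr rfl fun j _ => ?_
  rw [ContinuousMultilinearMap.map_smul_univ, smul_eq_mul]

theorem norm_multilinear_le {C : ℝ} (hC : 0 ≤ C)
    (h : ∀ j : Fin k → ι, ‖f fun i => EuclideanSpace.single (j i) (1 : ℂ)‖ ≤ C) :
    ‖f‖ ≤ (Fintype.card ι : ℝ) ^ k * C := by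
  refine ContinuousMultilinearMap.opNorm_le_bound (by positivity) fun v => ?_
  rw [multilinear_eq_sum f v]
  refine (norm_sum_le_of_le (n := fun _ => (∏ i, ‖v i‖) * C) _ fun j _ => ?_).trans_eq ?_
  · rw [norm_mul, norm_prod]
    exact mul_le_mul (Finset.prod_le_prod (fun _ _ => norm_nonneg _)
      fun i _ => PiLp.norm_apply_le (v i) (j i)) (h j) (norm_nonneg _)
      (Finset.prod_nonneg fun _ _ => norm_nonneg _)
  · rw [Finset.sum_const, Finset.card_univ, Fintype.card_fun, Fintype.card_fin, nsmul_eq_mul]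
    push_cast
    ring

end Multilinear

variable {A : Type} [Fintype A] [DecidableEq A]

/-- The homogeneous part of degree `k` of the Taylor polynomial of `P` at `0`. -/
def taylorPart (P : Phase A → ℂ) (k : ℕ) : Poly A :=
  ∑ j : Fin k → A × ℤˣ, MvPolynomial.monomial (∑ i, Finsupp.single (j i) 1)
    ((k.factorial : ℂ)⁻¹ * partialDeriv P j 0)

/-- The Taylor polynomial of `P` at `0` of degree less than `n`. -/
def taylorPoly (P : Phase A → ℂ) (n : ℕ) : Poly A := ∑ k ∈ Finset.range n, taylorPart P k

theorem eval_taylorPart (P : Phase A → ℂ) (k : ℕ) (z : Phase A) :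
    MvPolynomial.eval z (taylorPart P k)
      = (k.factorial : ℂ)⁻¹ * iteratedFDeriv ℂ k P 0 fun _ => z := by
  rw [taylorPart, map_sum, multilinear_eq_sum, Finset.mul_sum]
  refine Finset.sum_congr rfl fun j _ => ?_
  have hprod : (∑ i, Finsupp.single (j i) 1 : A × ℤˣ →₀ ℕ).prod (fun l e => z l ^ e)
      = ∏ i, z (j i) := by
    rw [← Finsupp.prod_finsetSum_index (fun _ => pow_zero _) (fun _ _ _ => pow_add _ _ _)]
    simp
  rw [MvPolynomial.eval_monomial, hprod, partialDeriv]
  ring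

theorem taylorPart_mem_vanishingTo (P : Phase A → ℂ) (k : ℕ) :
    taylorPart P k ∈ vanishingTo A k :=
  Ideal.sum_mem _ fun j _ => (MvPolynomial.mem_pow_idealOfVars_iff' _ _).mpr fun μ hμ => by
    rw [MvPolynomial.coeff_monomial, if_neg]
    rintro rfl
    simp at hμ

theorem totalDegree_taylorPart_le (P : Phase A → ℂ) (k : ℕ) :
    (taylorPart P k).totalDegree ≤ k :=
  MvPolynomial.totalDegree_finsetSum_le fun j _ => by
    have hdeg : (∑ i, Finsupp.single (j i) 1 : A × ℤˣ →₀ ℕ).degree = k := by simp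
    exact (MvPolynomial.totalDegree_monomial_le _ _).trans hdeg.le

theorem coeffNorm_taylorPart_le (P : Phase A → ℂ) (k : ℕ) :
    coeffNorm (taylorPart P k) ≤ (Fintype.card (A × ℤˣ) : ℝ) ^ k * ‖iteratedFDeriv ℂ k P 0‖ := by
  refine (coeffNorm_sum_le _ _).trans ((Finset.sum_le_card_nsmul _ _ ‖iteratedFDeriv ℂ k P 0‖
    fun j _ => ?_).trans_eq ?_)
  · rw [coeffNorm_monomial, norm_mul, norm_inv, Complex.norm_natCast]
    have hinv : ((k.factorial : ℝ))⁻¹ ≤ 1 :=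
      inv_le_one_of_one_le₀ (by exact_mod_cast k.factorial_pos)
    have hop := (iteratedFDeriv ℂ k P 0).le_opNorm fun i => EuclideanSpace.single (j i) (1 : ℂ)
    simp only [PiLp.norm_single, norm_one, Finset.prod_const_one, mul_one] at hop
    exact (mul_le_of_le_one_left (norm_nonneg _) hinv).trans hop
  · rw [Finset.card_univ, Fintype.card_fun, Fintype.card_fin, nsmul_eq_mul]
    push_cast
    ring

theorem taylorPoly_mem_vanishingTo {P : Phase A → ℂ} {m : ℕ}
    (h0 : ∀ k < m, iteratedFDeriv ℂ k P 0 = 0) (n : ℕ) : taylorPoly P n ∈ vanishingTo A m := by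
  refine Ideal.sum_mem _ fun k _ => ?_
  rcases lt_or_ge k m with hk | hk
  · have hzero : taylorPart P k = 0 := by simp [taylorPart, partialDeriv, h0 k hk]
    rw [hzero]
    exact Submodule.zero_mem _
  · exact Ideal.pow_le_pow_right hk (taylorPart_mem_vanishingTo P k)

theorem totalDegree_taylorPoly_le (P : Phase A → ℂ) (n : ℕ) :
    (taylorPoly P n).totalDegree ≤ n :=
  MvPolynomial.totalDegree_finsetSum_le fun k hk =>
    (totalDegree_taylorPart_le P k).trans (Finset.mem_range.mp hk).le

section PhaseEval

variable {A : Type} [Fintype A] (F : Poly A) (z : Phase A)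

theorem hasFDerivAt_eval_phase : HasFDerivAt (fun z : Phase A => MvPolynomial.eval z F)
    (∑ j, MvPolynomial.eval z (pd j F) • (EuclideanSpace.proj j : Phase A →L[ℂ] ℂ)) z := by
  refine ((hasFDerivAt_eval F z).comp z
    (PiLp.continuousLinearEquiv 2 ℂ fun _ : A × ℤˣ => ℂ).hasFDerivAt).congr_fderiv ?_
  ext v
  simp

theorem fderiv_eval_single [DecidableEq A] (j : A × ℤˣ) :
    fderiv ℂ (fun z : Phase A => MvPolynomial.eval z F) z (EuclideanSpace.single j 1)
      = MvPolynomial.eval z (pd j F) := by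
  rw [(hasFDerivAt_eval_phase F z).fderiv]
  simp

end PhaseEval

section TaylorRemainder

open scoped ContDiff

variable {P : Phase A → ℂ} {ρ : ℝ}

theorem hasDerivAt_iteratedFDeriv_line {E F : Type*} [NormedAddCommGroup E] [NormedSpace ℂ E]
    [NormedAddCommGroup F] [NormedSpace ℂ F] {P : E → F}
    (hP : ContDiffOn ℂ ∞ P (Metric.ball 0 ρ)) (k : ℕ) (z : E) (t : ℝ)
    (hz : ‖(t : ℂ) • z‖ < ρ) :
    HasDerivAt (fun t : ℝ => iteratedFDeriv ℂ k P ((t : ℂ) • z) fun _ => z)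
      (iteratedFDeriv ℂ (k + 1) P ((t : ℂ) • z) fun _ => z) t := by
  have hline : HasDerivAt (fun t : ℝ => (t : ℂ) • z) z t := by
    simpa using (Complex.ofRealCLM.hasDerivAt (x := t)).smul_const z
  have hcomp := ((differentiableAt_iteratedFDeriv hP k hz).hasFDerivAt.restrictScalars
    ℝ).comp_hasDerivAt t hline
  have happly := ((ContinuousMultilinearMap.apply ℂ (fun _ : Fin k => E) F
    fun _ => z).restrictScalars ℝ).hasFDerivAt.comp_hasDerivAt t hcomp
  exact happly.congr_deriv (by rw [iteratedFDeriv_succ_apply_left]; rfl)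

theorem norm_sub_eval_taylorPoly_le (hP : ContDiffOn ℂ ∞ P (Metric.ball 0 ρ)) (n : ℕ) {B : ℝ}
    {z : Phase A} (hz : ‖z‖ < ρ)
    (hB : ∀ w : Phase A, ‖w‖ ≤ ‖z‖ → ‖iteratedFDeriv ℂ (n + 1) P w‖ ≤ B) :
    ‖P z - MvPolynomial.eval z (taylorPoly P (n + 1))‖ ≤ (n + 2) * (B * ‖z‖ ^ (n + 1)) := by
  have hle : ∀ t ∈ Set.Icc (0 : ℝ) 1, ‖(t : ℂ) • z‖ ≤ ‖z‖ := by
    intro t ht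
    rw [norm_smul, Complex.norm_real, Real.norm_eq_abs, abs_of_nonneg ht.1]
    exact mul_le_of_le_one_left (norm_nonneg _) ht.2
  have hB0 : 0 ≤ B := (norm_nonneg _).trans (hB z le_rfl)
  have htaylor := norm_sub_sum_pow_mul_le n (h := 1) (H := 1) (B := B * ‖z‖ ^ (n + 1))
    (f := fun k t => iteratedFDeriv ℂ k P ((t : ℂ) • z) fun _ => z) (e := fun _ _ => 0)
    zero_le_one le_rfl le_rfl
    (fun q _ t ht => by
      rw [add_zero]
      exact (hasDerivAt_iteratedFDeriv_line hP q z t ((hle t ht).trans_lt hz)).hasDerivWithinAt)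
    (fun t ht => by
      refine (ContinuousMultilinearMap.le_opNorm _ _).trans ?_
      rw [Finset.prod_const, Finset.card_univ, Fintype.card_fin]
      gcongr
      exact hB _ (hle t ht))
    (fun q _ t _ => by rw [norm_zero]; positivity)
  rw [one_pow, mul_one] at htaylor
  convert htaylor using 3
  · simp
  · rw [taylorPoly, map_sum]
    refine Finset.sum_congr rfl fun k _ => ?_
    rw [eval_taylorPart]
    simp

theorem norm_fderiv_sub_eval_taylorPoly_le (hP : ContDiffOn ℂ ∞ P (Metric.ball 0 ρ)) (n : ℕ)
    {B : ℝ} (hB : ∀ w : Phase A, ‖w‖ < ρ → ‖iteratedFDeriv ℂ (n + 1) P w‖ ≤ B) {z : Phase A}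
    {τ : ℝ} (hτ : 0 < τ) (hzτ : ‖z‖ ≤ τ) (hτρ : 2 * τ < ρ) :
    ‖fderiv ℂ (fun w : Phase A => P w - MvPolynomial.eval w (taylorPoly P (n + 1))) z‖
      ≤ (n + 2) * (B * 2 ^ (n + 1)) * τ ^ n := by
  have hB0 : 0 ≤ B := (norm_nonneg _).trans (hB z (by linarith))
  have hmem : ∀ w ∈ Metric.closedBall z τ, ‖w‖ ≤ 2 * τ := fun w hw =>
    (norm_le_of_mem_closedBall hw).trans (by linarith)
  calc _ ≤ (n + 2) * (B * (2 * τ) ^ (n + 1)) / τ := by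
        refine norm_fderiv_le_of_forall_closedBall hτ (fun w hw => ?_) (fun w hw => ?_)
        · exact ((contDiffAt_of_norm_lt hP ((hmem w hw).trans_lt hτρ)).differentiableAt
            (by simp)).sub (hasFDerivAt_eval_phase _ w).differentiableAt
        · refine (norm_sub_eval_taylorPoly_le hP n ((hmem w hw).trans_lt hτρ)
            fun x hx => hB x (hx.trans_lt ((hmem w hw).trans_lt hτρ))).trans ?_
          gcongr
          exact hmem w hw
    _ = (n + 2) * (B * 2 ^ (n + 1)) * τ ^ n := by
        rw [mul_pow]
        field_simp
        ring

theorem norm_fderiv_single_sub_eval_pd_le (hP : ContDiffOn ℂ ∞ P (Metric.ball 0 ρ)) (n : ℕ)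
    {B : ℝ} (hB : ∀ w : Phase A, ‖w‖ < ρ → ‖iteratedFDeriv ℂ (n + 1) P w‖ ≤ B) {z : Phase A}
    {τ : ℝ} (hτ : 0 < τ) (hzτ : ‖z‖ ≤ τ) (hτρ : 2 * τ < ρ) (j : A × ℤˣ) :
    ‖fderiv ℂ P z (EuclideanSpace.single j 1)
      - MvPolynomial.eval z (pd j (taylorPoly P (n + 1)))‖
        ≤ (n + 2) * (B * 2 ^ (n + 1)) * τ ^ n := by
  have hPz : DifferentiableAt ℂ P z :=
    (contDiffAt_of_norm_lt hP (by linarith)).differentiableAt (by simp)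
  have hop := ContinuousLinearMap.le_opNorm (fderiv ℂ (fun w : Phase A =>
    P w - MvPolynomial.eval w (taylorPoly P (n + 1))) z) (EuclideanSpace.single j 1)
  rw [PiLp.norm_single, norm_one, mul_one] at hop
  refine le_trans ?_ (hop.trans (norm_fderiv_sub_eval_taylorPoly_le hP n hB hτ hzτ hτρ))
  rw [fderiv_fun_sub hPz (hasFDerivAt_eval_phase _ z).differentiableAt, sub_apply,
    fderiv_eval_single]

end TaylorRemainder

end TaylorPolynomial

section DifferentialEquations

variable {E : Type*} [NormedAddCommGroup E] [NormedSpace ℝ E]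

theorem eq_zero_of_local_gronwall {u u' : ℝ → E} {T : ℝ} (h0 : u 0 = 0)
    (hu : ∀ t ∈ Set.Icc 0 T, HasDerivWithinAt u (u' t) (Set.Icc 0 T) t)
    (hloc : ∀ t ∈ Set.Ico 0 T, u t = 0 →
      ∃ K : ℝ, ∀ᶠ s in 𝓝[Set.Icc 0 T] t, ‖u' s‖ ≤ K * ‖u s‖) :
    ∀ t ∈ Set.Icc 0 T, u t = 0 := by
  have hcont : ContinuousOn u (Set.Icc 0 T) := fun t ht => (hu t ht).continuousWithinAt
  have hclosed : IsClosed ({t | u t = 0} ∩ Set.Icc 0 T) := by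
    rw [Set.inter_comm]
    exact hcont.preimage_isClosed_of_isClosed isClosed_Icc isClosed_singleton
  refine fun t ht => (hclosed.Icc_subset_of_forall_exists_gt h0 ?_) ht
  rintro x ⟨hx0, hx⟩ y hy
  obtain ⟨K, hK⟩ := hloc x hx hx0
  have hK' : ∀ᶠ s in 𝓝[≥] x, ‖u' s‖ ≤ K * ‖u s‖ := by
    rw [← nhdsWithin_inter_of_mem (Icc_mem_nhdsGE_of_mem hx)]
    exact hK.filter_mono (nhdsWithin_mono _ Set.inter_subset_left)
  obtain ⟨w, hw, hws⟩ := mem_nhdsGE_iff_exists_Ico_subset.mp hK'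
  set b := min w (min y T)
  have hxb : x < b := lt_min hw (lt_min hy hx.2)
  have hbT : b ≤ T := (min_le_right _ _).trans (min_le_right _ _)
  have hsub : Set.Icc x b ⊆ Set.Icc 0 T := Set.Icc_subset_Icc hx.1 hbT
  refine ⟨b, ?_, hxb, (min_le_right _ _).trans (min_le_left _ _)⟩
  refine eq_zero_of_abs_deriv_le_mul_abs_self_of_eq_zero_right (K := K) (f' := u')
    (hcont.mono hsub) (fun s hs => ?_) hx0
    (fun s hs => hws ⟨hs.1, hs.2.trans_le (min_le_left _ _)⟩) b ⟨hxb.le, le_rfl⟩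
  have hs' : s ∈ Set.Ico 0 T := ⟨hx.1.trans hs.1, hs.2.trans_le hbT⟩
  exact (hu s ⟨hs'.1, hs'.2.le⟩).mono_of_mem_nhdsWithin (Icc_mem_nhdsGE_of_mem hs')

theorem exists_solution_mem_closedBall [CompleteSpace E] {f : ℝ → E → E} {tmin tmax : ℝ}
    {t₀ : Set.Icc tmin tmax} {x₀ : E} {a L K : NNReal} (hf : IsPicardLindelof f t₀ x₀ a 0 L K) :
    ∃ α : ℝ → E, α t₀ = x₀ ∧ ∀ t ∈ Set.Icc tmin tmax, α t ∈ Metric.closedBall x₀ a ∧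
      HasDerivWithinAt α (f t (α t)) (Set.Icc tmin tmax) t := by
  have hx : x₀ ∈ Metric.closedBall x₀ ((0 : NNReal) : ℝ) := Metric.mem_closedBall_self le_rfl
  obtain ⟨α, hα⟩ := ODE.FunSpace.exists_isFixedPt_next hf hx
  refine ⟨α.compProj, by rw [ODE.FunSpace.compProj_val, ← hα, ODE.FunSpace.next_apply₀],
    fun t ht => ⟨α.compProj_mem_closedBall hf.mul_max_le, ?_⟩⟩
  refine (ODE.hasDerivWithinAt_picard_Icc t₀.2 hf.continuousOn_uncurry
    α.continuous_compProj.continuousOn (fun _ _ => α.compProj_mem_closedBall hf.mul_max_le)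
    x₀ ht).congr_of_mem ?_ ht
  intro t' ht'
  nth_rw 1 [← hα]
  rw [ODE.FunSpace.compProj_of_mem ht', ODE.FunSpace.next_apply]

end DifferentialEquations

section Conjugation

variable {A : Type} [Fintype A] {U : Set (Phase A)} {z : Phase A}

/-- The conjugation of phase space whose fixed points are the real points. -/
def conjPhase : Phase A →ₗᵢ[ℝ] Phase A where
  toFun z := WithLp.toLp 2 fun j => (starRingEnd ℂ) (z (bar j))
  map_add' z w := by ext j; simp
  map_smul' c z := by ext j; simp
  norm_map' z := by
    simp only [LinearMap.coe_mk, AddHom.coe_mk, EuclideanSpace.norm_eq, RCLike.norm_conj]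
    exact congrArg _ (Equiv.sum_comp (bar_involutive (A := A)).toPerm fun j => ‖z j‖ ^ 2)

theorem conjPhase_apply (z : Phase A) (j : A × ℤˣ) :
    conjPhase z j = (starRingEnd ℂ) (z (bar j)) := rfl

theorem isReal_iff_conjPhase : IsReal z ↔ conjPhase z = z := by
  refine ⟨fun hz => ?_, fun hz j => ?_⟩
  · ext j
    rw [conjPhase_apply, hz j, Complex.conj_conj]
  · nth_rw 1 [← hz]
    rw [conjPhase_apply, bar_bar]

@[simp]
theorem conjPhase_conjPhase (z : Phase A) : conjPhase (conjPhase z) = z := by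
  ext j
  simp [conjPhase_apply]

theorem conjPhase_complex_smul (c : ℂ) (z : Phase A) :
    conjPhase (c • z) = (starRingEnd ℂ) c • conjPhase z := by
  ext j
  simp [conjPhase_apply]

theorem conjPhase_single [DecidableEq A] (j : A × ℤˣ) :
    conjPhase (EuclideanSpace.single j (1 : ℂ)) = EuclideanSpace.single (bar j) 1 := by
  ext l
  simp only [conjPhase_apply, PiLp.single_apply, bar_involutive.eq_iff, apply_ite (starRingEnd ℂ),
    map_one, map_zero]

theorem isReal_half_smul_add_conjPhase (z : Phase A) :
    IsReal ((1 / 2 : ℝ) • (z + conjPhase z)) := by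
  rw [isReal_iff_conjPhase, map_smul, map_add, conjPhase_conjPhase, add_comm]

theorem apply_conjPhase_of_im_eq_zero {L : Phase A →L[ℂ] ℂ} (hL : ∀ v, IsReal v → (L v).im = 0)
    (v : Phase A) : L (conjPhase v) = (starRingEnd ℂ) (L v) := by
  have hsum : (L (v + conjPhase v)).im = 0 := hL _ <| isReal_iff_conjPhase.mpr <| by
    rw [map_add, conjPhase_conjPhase, add_comm]
  have hdiff : (L (Complex.I • (v - conjPhase v))).im = 0 := hL _ <| isReal_iff_conjPhase.mpr <| by
    rw [conjPhase_complex_smul, map_sub, conjPhase_conjPhase, Complex.conj_I, neg_smul, ← smul_neg,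
      neg_sub]
  rw [map_add, Complex.add_im] at hsum
  rw [map_smul, map_sub, smul_eq_mul, Complex.I_mul_im, Complex.sub_re] at hdiff
  apply Complex.ext
  · rw [Complex.conj_re]
    linarith
  · rw [Complex.conj_im]
    linarith

theorem im_fderiv_eq_zero {P : Phase A → ℂ} (hU : IsOpen U) (hP : IsRealHam U P)
    (hd : DifferentiableAt ℂ P z) (hzU : z ∈ U) (hz : IsReal z) {v : Phase A} (hv : IsReal v) :
    (fderiv ℂ P z v).im = 0 := by
  have hline : HasDerivAt (fun t : ℝ => z + (t : ℂ) • v) v 0 := by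
    simpa using ((Complex.ofRealCLM.hasDerivAt (x := 0)).smul_const v).const_add z
  have hz0 : z + ((0 : ℝ) : ℂ) • v = z := by simp
  have hPline : HasDerivAt (fun t : ℝ => P (z + (t : ℂ) • v)) (fderiv ℂ P z v) 0 := by
    have hd' : HasFDerivAt P ((fderiv ℂ P z).restrictScalars ℝ) (z + ((0 : ℝ) : ℂ) • v) := by
      rw [hz0]
      exact hd.hasFDerivAt.restrictScalars ℝ
    exact hd'.comp_hasDerivAt (0 : ℝ) hline
  have him := Complex.imCLM.hasFDerivAt.comp_hasDerivAt (0 : ℝ) hPline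
  refine him.unique ((hasDerivAt_const (0 : ℝ) (0 : ℝ)).congr_of_eventuallyEq ?_)
  have hmem : ∀ᶠ t : ℝ in 𝓝 0, z + (t : ℂ) • v ∈ U :=
    hline.continuousAt.eventually (by simp only [hz0]; exact hU.mem_nhds hzU)
  filter_upwards [hmem] with t ht
  exact hP _ ht fun j => by simp [hz j, hv j]

end Conjugation

section Trajectories

open scoped ContDiff

variable {A : Type} [Fintype A] [DecidableEq A] {U : Set (Phase A)} {H : Phase A → ℂ} {T : ℝ}
  {z : Phase A} {γ γ' : ℝ → Phase A}

theorem contDiffAt_hamVF (hH : ContDiffAt ℂ ∞ H z) : ContDiffAt ℂ 1 (hamVF H) z := by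
  rw [contDiffAt_euclidean]
  intro j
  simp only [hamVF_apply]
  have htop : (1 : WithTop ℕ∞) + 1 ≤ ∞ := WithTop.coe_le_coe.mpr (le_top (a := (1 : ℕ∞) + 1))
  exact contDiffAt_const.mul ((hH.fderiv_right htop).clm_apply contDiffAt_const)

theorem IsTrajectory.unique (hU : IsOpen U) (hH : ContDiffOn ℂ ∞ H U)
    (h : IsTrajectory U H T z γ) (h' : IsTrajectory U H T z γ') :
    ∀ t ∈ Set.Icc 0 T, γ t = γ' t := by
  intro t ht
  rw [← sub_eq_zero]
  refine eq_zero_of_local_gronwall (u := fun t => γ t - γ' t)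
    (u' := fun t => hamVF H (γ t) - hamVF H (γ' t)) (by simp [h.1, h'.1])
    (fun t ht => (h.2 t ht).2.sub (h'.2 t ht).2) (fun t ht h0 => ?_) t ht
  have ht' : t ∈ Set.Icc 0 T := ⟨ht.1, ht.2.le⟩
  rw [sub_eq_zero] at h0
  obtain ⟨K, N, hN, hK⟩ := (contDiffAt_hamVF
    (hH.contDiffAt (hU.mem_nhds (h.2 t ht').1))).exists_lipschitzOnWith
  refine ⟨K, ?_⟩
  filter_upwards [(h.2 t ht').2.continuousWithinAt.tendsto.eventually hN,
    (h'.2 t ht').2.continuousWithinAt.tendsto.eventually (h0 ▸ hN)] with s hs hs'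
  exact hK.norm_sub_le hs hs'

theorem flow_eq_some (hU : IsOpen U) (hH : ContDiffOn ℂ ∞ H U) (hT : 0 ≤ T)
    (h : IsTrajectory U H T z γ) : flow U H T z = Part.some (γ T) :=
  Part.ext' (iff_of_true ⟨γ, h⟩ trivial) fun hz _ =>
    IsTrajectory.unique hU hH hz.choose_spec h T ⟨hT, le_rfl⟩

theorem exists_isTrajectory_of_mem_flow {w : Phase A} (hw : w ∈ flow U H T z) :
    ∃ γ, IsTrajectory U H T z γ ∧ w = γ T := by
  obtain ⟨hz, rfl⟩ := hw
  exact ⟨hz.choose, hz.choose_spec, rfl⟩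

theorem conjPhase_hamVF (hU : IsOpen U) (hH : IsRealHam U H) (hd : DifferentiableAt ℂ H z)
    (hzU : z ∈ U) (hz : IsReal z) : conjPhase (hamVF H z) = hamVF H z := by
  ext j
  have hconj := apply_conjPhase_of_im_eq_zero
    (fun _ hv => im_fderiv_eq_zero hU hH hd hzU hz hv) (EuclideanSpace.single j 1)
  rw [conjPhase_single] at hconj
  rw [conjPhase_apply, hamVF_apply, hamVF_apply, bar_bar, map_mul, symp_bar, hconj, symp]
  simp

/- `hamVF H` commutes with the conjugation at the real point halfway between `w` and its
conjugate, and it is Lipschitz near `z`. -/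
theorem exists_norm_hamVF_sub_conjPhase_le (hU : IsOpen U) (hH : ContDiffOn ℂ ∞ H U)
    (hreal : IsRealHam U H) (hzU : z ∈ U) (hz : IsReal z) :
    ∃ K : ℝ, ∀ᶠ w in 𝓝 z, ‖hamVF H w - conjPhase (hamVF H w)‖ ≤ K * ‖w - conjPhase w‖ := by
  have hUz := hU.mem_nhds hzU
  obtain ⟨K, N, hN, hK⟩ := (contDiffAt_hamVF (hH.contDiffAt hUz)).exists_lipschitzOnWith
  have htend : Tendsto (fun w : Phase A => (1 / 2 : ℝ) • (w + conjPhase w)) (𝓝 z) (𝓝 z) := by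
    have hcont : Continuous fun w : Phase A => (1 / 2 : ℝ) • (w + conjPhase w) :=
      (continuous_id'.add conjPhase.continuous).const_smul (1 / 2 : ℝ)
    have hfix : (1 / 2 : ℝ) • (z + conjPhase z) = z := by
      rw [isReal_iff_conjPhase.mp hz]
      module
    simpa only [hfix] using hcont.tendsto z
  refine ⟨K, ?_⟩
  filter_upwards [hN, htend.eventually hN, htend.eventually hUz] with w hwN hw₀N hw₀U
  set w₀ := (1 / 2 : ℝ) • (w + conjPhase w) with hw₀
  have hX₀ : conjPhase (hamVF H w₀) = hamVF H w₀ :=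
    conjPhase_hamVF hU hreal ((hH.contDiffAt (hU.mem_nhds hw₀U)).differentiableAt (by simp)) hw₀U
      (isReal_half_smul_add_conjPhase w)
  calc ‖hamVF H w - conjPhase (hamVF H w)‖
      = ‖(hamVF H w - hamVF H w₀) - conjPhase (hamVF H w - hamVF H w₀)‖ := by
        rw [map_sub, hX₀]
        congr 1
        abel
    _ ≤ 2 * ‖hamVF H w - hamVF H w₀‖ := by
        refine (norm_sub_le _ _).trans_eq ?_
        rw [LinearIsometry.norm_map, two_mul]
    _ ≤ 2 * (K * ‖w - w₀‖) := by gcongr; exact hK.norm_sub_le hwN hw₀N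
    _ = K * ‖w - conjPhase w‖ := by
        have hhalf : w - w₀ = (1 / 2 : ℝ) • (w - conjPhase w) := by
          rw [hw₀]
          module
        rw [hhalf, norm_smul, Real.norm_of_nonneg (by norm_num)]
        ring

theorem IsTrajectory.isReal (hU : IsOpen U) (hH : ContDiffOn ℂ ∞ H U) (hreal : IsRealHam U H)
    (h : IsTrajectory U H T z γ) (hz : IsReal z) : ∀ t ∈ Set.Icc 0 T, IsReal (γ t) := by
  intro t ht
  rw [isReal_iff_conjPhase, eq_comm, ← sub_eq_zero]
  refine eq_zero_of_local_gronwall (u := fun t => γ t - conjPhase (γ t))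
    (u' := fun t => hamVF H (γ t) - conjPhase (hamVF H (γ t)))
    (by simp [h.1, isReal_iff_conjPhase.mp hz])
    (fun t ht => (h.2 t ht).2.sub (HasFDerivAt.comp_hasDerivWithinAt t
      (conjPhase (A := A)).toContinuousLinearMap.hasFDerivAt (h.2 t ht).2)) (fun t ht h0 => ?_) t ht
  have hγt := h.2 t ⟨ht.1, ht.2.le⟩
  obtain ⟨K, hK⟩ := exists_norm_hamVF_sub_conjPhase_le hU hH hreal hγt.1
    (isReal_iff_conjPhase.mpr (sub_eq_zero.mp h0).symm)
  exact ⟨K, hγt.2.continuousWithinAt.tendsto.eventually hK⟩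

theorem exists_isTrajectory {ρ a L : ℝ} (hU : Metric.ball 0 ρ ⊆ U)
    (hH : ContDiffOn ℂ ∞ H (Metric.ball 0 ρ)) (hT : 0 ≤ T) (ha : 0 ≤ a) (hza : ‖z‖ + a < ρ)
    (hL : ∀ w ∈ Metric.closedBall z a, ‖hamVF H w‖ ≤ L) (hLT : L * T ≤ a) :
    ∃ γ, IsTrajectory U H T z γ ∧ ∀ t ∈ Set.Icc 0 T, γ t ∈ Metric.closedBall z a := by
  have hsub : Metric.closedBall z a ⊆ Metric.ball 0 ρ := fun w hw =>
    mem_ball_zero_iff.mpr ((norm_le_of_mem_closedBall hw).trans_lt hza)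
  have hL0 : 0 ≤ L := (norm_nonneg _).trans (hL z (Metric.mem_closedBall_self ha))
  obtain ⟨K, hK⟩ : ∃ K, LipschitzOnWith K (hamVF H) (Metric.closedBall z a) := by
    have hloc : LocallyLipschitzOn (Metric.closedBall z a) (hamVF H) := fun w hw => by
      obtain ⟨K, N, hN, hK⟩ := (contDiffAt_hamVF (contDiffAt_of_norm_lt hH
        (mem_ball_zero_iff.mp (hsub hw)))).exists_lipschitzOnWith
      exact ⟨K, N, mem_nhdsWithin_of_mem_nhds hN, hK⟩
    exact hloc.exists_lipschitzOnWith_of_compact (isCompact_closedBall z a)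
  lift a to NNReal using ha
  lift L to NNReal using hL0
  have hpl : IsPicardLindelof (fun _ => hamVF H) (tmin := 0) (tmax := T)
      ⟨0, ⟨le_rfl, hT⟩⟩ z a 0 L K :=
    { lipschitzOnWith := fun _ _ => hK
      continuousOn := fun _ _ => continuousOn_const
      norm_le := fun _ _ w hw => hL w hw
      mul_max_le := by simpa [hT] using hLT }
  obtain ⟨γ, h0, hγ⟩ := exists_solution_mem_closedBall hpl
  exact ⟨γ, ⟨h0, fun t ht => ⟨hU (hsub (hγ t ht).1), (hγ t ht).2⟩⟩, fun t ht => (hγ t ht).1⟩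

end Trajectories

section LinearFlow

variable {A : Type} (ω : A → ℝ)

theorem hasDerivAt_eigen_single (j : A × ℤˣ) (t : ℝ) :
    HasDerivAt (fun t : ℝ => eigen ω t (Finsupp.single j 1))
      (symp j * ω j.1 * eigen ω t (Finsupp.single j 1)) t := by
  have hfreq : HasDerivAt (fun t : ℝ => -(Complex.I * ((t * freq ω
      (Finsupp.single j 1) : ℝ) : ℂ))) (symp j * ω j.1) t := by
    refine ((((hasDerivAt_id t).mul_const (freq ω (Finsupp.single j 1))).ofReal_comp).const_mul
      Complex.I).neg.congr_deriv ?_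
    simp [symp, mul_assoc]
  exact hfreq.cexp.congr_deriv (by rw [eigen, mul_comm])

variable [Fintype A]

/-- The quadratic Hamiltonian `H₀` as a polynomial. -/
def quadPoly : Poly A := ∑ a, MvPolynomial.C (ω a : ℂ) * actionPoly a

theorem eval_quadPoly (z : Phase A) : MvPolynomial.eval z (quadPoly ω) = quadHam ω z := by
  simp only [quadHam, quadPoly, map_sum, map_mul, MvPolynomial.eval_C, eval_actionPoly]

theorem pd_bar_quadPoly (j : A × ℤˣ) :
    pd (bar j) (quadPoly ω) = MvPolynomial.C (ω j.1 : ℂ) * MvPolynomial.X j := by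
  classical
  obtain ⟨a, δ⟩ := j
  rw [quadPoly, map_sum, Finset.sum_eq_single a]
  · rcases Int.units_eq_one_or δ with rfl | rfl <;>
      simp [actionPoly, bar, Derivation.leibniz]
  · intro b _ hb
    simp [actionPoly, bar, Derivation.leibniz, hb]
  · simp

theorem contDiff_quadHam {n : WithTop ℕ∞} : ContDiff ℂ n (quadHam ω) := by
  have hproj (j : A × ℤˣ) : ContDiff ℂ n fun z : Phase A => z j :=
    (EuclideanSpace.proj j : Phase A →L[ℂ] ℂ).contDiff
  exact ContDiff.sum fun a _ => contDiff_const.mul ((hproj (a, 1)).mul (hproj (a, -1)))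

theorem hamVF_quadHam [DecidableEq A] (z : Phase A) (j : A × ℤˣ) :
    hamVF (quadHam ω) z j = symp j * (ω j.1 * z j) := by
  rw [hamVF_apply, ← funext (eval_quadPoly ω), fderiv_eval_single, pd_bar_quadPoly, map_mul,
    MvPolynomial.eval_C, MvPolynomial.eval_X]

theorem hasDerivAt_rotMap [DecidableEq A] (z : Phase A) (t : ℝ) :
    HasDerivAt (fun t => rotMap ω t z) (hamVF (quadHam ω) (rotMap ω t z)) t := by
  refine (PiLp.continuousLinearEquiv 2 ℝ fun _ : A × ℤˣ => ℂ).symm.toContinuousLinearMap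
    |>.hasFDerivAt.comp_hasDerivAt t (f := fun t j => eigen ω t (Finsupp.single j 1) * z j)
      (f' := fun j => hamVF (quadHam ω) (rotMap ω t z) j) (hasDerivAt_pi.mpr fun j => ?_)
  refine ((hasDerivAt_eigen_single ω j t).mul_const (z j)).congr_deriv ?_
  rw [hamVF_quadHam]
  simp only [rotMap]
  ring

theorem flow_quadHam [DecidableEq A] {T : ℝ} (hT : 0 ≤ T) (z : Phase A) :
    flow Set.univ (quadHam ω) T z = Part.some (rotMap ω T z) := by
  refine flow_eq_some (γ := fun t => rotMap ω t z) isOpen_univ (contDiff_quadHam ω).contDiffOn hT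
    ⟨?_, fun t _ => ⟨trivial, (hasDerivAt_rotMap ω z t).hasDerivWithinAt⟩⟩
  ext j
  simp [rotMap, eigen]

theorem isReal_rotMap (h : ℝ) {z : Phase A} (hz : IsReal z) : IsReal (rotMap ω h z) := by
  intro j
  have hconj : eigen ω h (Finsupp.single (bar j) 1)
      = (starRingEnd ℂ) (eigen ω h (Finsupp.single j 1)) := by
    simp [eigen, ← Complex.exp_conj, bar]
  simp only [rotMap, map_mul, hz j, hconj]

theorem norm_rotMap (h : ℝ) (z : Phase A) : ‖rotMap ω h z‖ = ‖z‖ := by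
  simp [EuclideanSpace.norm_eq, rotMap]

theorem norm_sq_eq_sum_action {z : Phase A} (hz : IsReal z) :
    ((‖z‖ ^ 2 : ℝ) : ℂ) = 2 * ∑ a, action a z := by
  rw [EuclideanSpace.norm_sq_eq, Fintype.sum_prod_type, Finset.mul_sum]
  push_cast
  refine Finset.sum_congr rfl fun a _ => ?_
  have hbar : z (a, -1) = (starRingEnd ℂ) (z (a, 1)) := hz (a, 1)
  rw [show (Finset.univ : Finset ℤˣ) = {1, -1} from rfl, Finset.sum_pair (by decide), action, hbar,
    RCLike.norm_conj, Complex.mul_conj, Complex.normSq_eq_norm_sq]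
  push_cast
  ring

end LinearFlow

section Projection

variable {d : ℕ} {N : Set (Fin d → ℤ)}

/-- The inclusion of the indices of finitely many coordinates. -/
def inclusion (NK : Finset N) : NK × ℤˣ ↪ N × ℤˣ :=
  (Function.Embedding.subtype _).prodMap (Function.Embedding.refl _)

/-- The section of `proj NK` that extends a point by zero to a square-summable family. -/
def extend (NK : Finset N) (w : Phase NK) : FullPhase N :=
  ∑ j, lp.single 2 (inclusion NK j) (w j)

theorem proj_extend (NK : Finset N) (w : Phase NK) : proj NK (extend NK w) = w := by
  ext j
  change (extend NK w) (inclusion NK j) = w j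
  have hsingle (i : NK × ℤˣ) : (lp.single 2 (inclusion NK i) (w i) : FullPhase N) (inclusion NK j)
      = if j = i then w i else 0 := by
    simp only [lp.single_apply, Pi.single_apply, (inclusion NK).injective.eq_iff]
  simp only [extend, lp.coeFn_sum, Finset.sum_apply, hsingle, Finset.sum_ite_eq, Finset.mem_univ,
    if_true]

theorem norm_extend (NK : Finset N) (w : Phase NK) : ‖extend NK w‖ = ‖w‖ := by
  have hsum := lp.norm_sum_single (E := fun _ => ℂ) (p := 2) (by norm_num)
    (Function.extend (inclusion NK) w 0) (Finset.univ.map (inclusion NK))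
  simp only [Finset.sum_map, (inclusion NK).injective.extend_apply, ENNReal.toReal_ofNat,
    Real.rpow_two] at hsum
  rwa [← EuclideanSpace.norm_sq_eq, sq_eq_sq₀ (norm_nonneg _) (norm_nonneg _)] at hsum

theorem proj_add (NK : Finset N) (u v : FullPhase N) : proj NK (u + v) = proj NK u + proj NK v :=
  rfl

theorem proj_zero (NK : Finset N) : proj NK (0 : FullPhase N) = 0 := rfl

theorem exists_ball_subset_image_proj {U : Set (FullPhase N)} (hU : IsOpen U) {u : FullPhase N}
    (hu : u ∈ U) : ∃ ρ > 0, ∀ NK : Finset N, Metric.ball (proj NK u) ρ ⊆ proj NK '' U := by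
  obtain ⟨ρ, hρ, hball⟩ := Metric.isOpen_iff.mp hU u hu
  refine ⟨ρ, hρ, fun NK w hw => ⟨u + extend NK (w - proj NK u), hball ?_, ?_⟩⟩
  · rw [mem_ball_iff_norm, add_sub_cancel_left, norm_extend]
    exact mem_ball_iff_norm.mp hw
  · rw [proj_add, proj_extend, add_sub_cancel]

theorem isOpen_image_proj {U : Set (FullPhase N)} (hU : IsOpen U) (NK : Finset N) :
    IsOpen (proj NK '' U) := by
  rw [Metric.isOpen_iff]
  rintro _ ⟨u, hu, rfl⟩
  obtain ⟨ρ, hρ, h⟩ := exists_ball_subset_image_proj hU hu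
  exact ⟨ρ, hρ, h NK⟩

end Projection

section NonResonance

variable {A : Type}

theorem exists_sum_single_one_eq {X : Type*} (μ : X →₀ ℕ) :
    ∃ j : Fin μ.degree → X, ∑ i, Finsupp.single (j i) 1 = μ := by
  classical
  obtain ⟨l, hl⟩ : ∃ l : List X, (l : Multiset X) = Finsupp.toMultiset μ :=
    ⟨_, Multiset.coe_toList _⟩
  have hlen : l.length = μ.degree := by
    rw [← Multiset.coe_card, hl, Finsupp.card_toMultiset]
    rfl
  rw [← hlen]
  refine ⟨l.get, Finsupp.orderIsoMultiset.injective ?_⟩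
  have hmap : Finset.univ.val.map l.get = (l : Multiset X) := by
    rw [Fin.univ_val_map, List.ofFn_get]
  rw [Finsupp.coe_orderIsoMultiset, ← hl, map_sum, ← hmap]
  simp only [Finsupp.toMultiset_single, one_nsmul]
  conv_rhs => rw [← Multiset.sum_map_singleton (Multiset.map _ _), Multiset.map_map]
  rfl

theorem DependsOnlyOnActions.resonant {s : ℕ} {j : Fin s → A × ℤˣ}
    (hj : DependsOnlyOnActions j) : Resonant (∑ i, Finsupp.single (j i) 1) := by
  classical
  obtain ⟨m, e, b, hb⟩ := hj
  intro a
  rw [← e.sum_comp, Fintype.sum_sum_type]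
  simp only [(hb _).1, (hb _).2, Finsupp.add_apply, Finsupp.finsetSum_apply, Finsupp.single_apply,
    Prod.mk.injEq]
  simp [add_comm]

theorem freq_sum_single_one (ω : A → ℝ) {s : ℕ} (j : Fin s → A × ℤˣ) :
    freq ω (∑ i, Finsupp.single (j i) 1) = Omega ω j := by
  simp [freq, Omega]

theorem norm_one_sub_eigen (ω : A → ℝ) (h : ℝ) (μ : A × ℤˣ →₀ ℕ) :
    ‖1 - eigen ω h μ‖ = ‖1 - Complex.exp (Complex.I * (h * freq ω μ : ℝ))‖ := by
  rw [eigen, ← Complex.norm_conj, map_sub, map_one, ← Complex.exp_conj]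
  simp

theorem exists_tuple_of_not_resonant (ω : A → ℝ) (h : ℝ) {μ : A × ℤˣ →₀ ℕ} (hμ : ¬ Resonant μ) :
    ∃ j : Fin μ.degree → A × ℤˣ, ¬ DependsOnlyOnActions j ∧
      ‖1 - eigen ω h μ‖ = ‖1 - Complex.exp (Complex.I * (h * Omega ω j : ℝ))‖ := by
  obtain ⟨j, hj⟩ := exists_sum_single_one_eq μ
  refine ⟨j, fun hd => hμ (hj ▸ hd.resonant), ?_⟩
  rw [norm_one_sub_eigen, ← freq_sum_single_one, hj]

end NonResonance

theorem card_le_of_forall_abs_le {d : ℕ} {N : Set (Fin d → ℤ)} (S : Finset N) {K : ℕ} (hK : 1 ≤ K)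
    (hS : ∀ a ∈ S, ∀ i, |(a : Fin d → ℤ) i| ≤ (K : ℤ)) :
    Fintype.card (S × ℤˣ) ≤ (2 * K) ^ (2 * d + 1) := by
  have hbox : S.card ≤ (2 * K + 1) ^ d := by
    calc S.card ≤ (Fintype.piFinset fun _ : Fin d => Finset.Icc (-(K : ℤ)) K).card :=
          Finset.card_le_card_of_injOn Subtype.val
            (fun a ha => Fintype.mem_piFinset.mpr fun i =>
              Finset.mem_Icc.mpr (abs_le.mp (hS a ha i)))
            Subtype.val_injective.injOn
      _ = (2 * K + 1) ^ d := by
          rw [Fintype.card_piFinset_const, Int.card_Icc]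
          congr 1
          omega
  have hsq : 2 * K + 1 ≤ (2 * K) ^ 2 := by nlinarith
  rw [Fintype.card_prod, Fintype.card_coe, show Fintype.card ℤˣ = 2 from rfl, pow_succ, pow_mul]
  exact Nat.mul_le_mul (hbox.trans (Nat.pow_le_pow_left hsq d)) (by omega)

section Iterates

variable {A : Type} [Fintype A] [DecidableEq A] {V : Set (Phase A)} {P : Phase A → ℂ} {ω : A → ℝ}
  {h : ℝ} {z₀ : Phase A}

theorem iterates_succ (n : ℕ) : iterates V ω P h z₀ (n + 1)
    = (iterates V ω P h z₀ n).bind fun z => (flow V P h z).bind fun w =>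
      flow Set.univ (quadHam ω) h w :=
  Function.iterate_succ_apply' _ _ _

theorem iterates_succ_eq_some (hV : IsOpen V) (hP : ContDiffOn ℂ ((⊤ : ℕ∞) : WithTop ℕ∞) P V)
    (hh : 0 ≤ h) {n : ℕ} {z : Phase A} (hz : iterates V ω P h z₀ n = Part.some z)
    {γ : ℝ → Phase A} (hγ : IsTrajectory V P h z γ) :
    iterates V ω P h z₀ (n + 1) = Part.some (rotMap ω h (γ h)) := by
  rw [iterates_succ, hz, Part.bind_some, flow_eq_some hV hP hh hγ, Part.bind_some,
    flow_quadHam ω hh]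

theorem isReal_of_mem_iterates (hV : IsOpen V) (hP : ContDiffOn ℂ ((⊤ : ℕ∞) : WithTop ℕ∞) P V)
    (hreal : IsRealHam V P) (hh : 0 ≤ h) (hz₀ : IsReal z₀) (n : ℕ) :
    ∀ z ∈ iterates V ω P h z₀ n, IsReal z := by
  induction n with
  | zero =>
    intro z hz
    rwa [Part.mem_some_iff.mp hz]
  | succ n ih =>
    intro z hz
    rw [iterates_succ] at hz
    obtain ⟨w, hw, hz⟩ := Part.mem_bind_iff.mp hz
    obtain ⟨v, hv, hz⟩ := Part.mem_bind_iff.mp hz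
    obtain ⟨γ, hγ, rfl⟩ := exists_isTrajectory_of_mem_flow hv
    rw [flow_quadHam ω hh, Part.mem_some_iff] at hz
    rw [hz]
    exact isReal_rotMap _ _ (hγ.isReal hV hP hreal (ih w hw) h ⟨hh, le_rfl⟩)

end Iterates

theorem abs_norm_sq_sub_norm_sq_le {A : Type} [Fintype A] {z z₀ : Phase A} (hz : IsReal z)
    (hz₀ : IsReal z₀) {η : ℝ} (hη : ∀ a, ‖action a z - action a z₀‖ ≤ η) :
    |‖z‖ ^ 2 - ‖z₀‖ ^ 2| ≤ Fintype.card (A × ℤˣ) * η := by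
  have hsum : ((‖z‖ ^ 2 - ‖z₀‖ ^ 2 : ℝ) : ℂ) = 2 * ∑ a, (action a z - action a z₀) := by
    rw [Complex.ofReal_sub, norm_sq_eq_sum_action hz, norm_sq_eq_sum_action hz₀,
      Finset.sum_sub_distrib, mul_sub]
  calc |‖z‖ ^ 2 - ‖z₀‖ ^ 2| = 2 * ‖∑ a, (action a z - action a z₀)‖ := by
        rw [← Real.norm_eq_abs, ← Complex.norm_real, hsum, norm_mul, Complex.norm_ofNat]
    _ ≤ 2 * ∑ _a : A, η := by
        gcongr
        exact norm_sum_le_of_le _ fun a _ => hη a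
    _ = Fintype.card (A × ℤˣ) * η := by
        rw [Finset.sum_const, Finset.card_univ, nsmul_eq_mul, Fintype.card_prod,
          show Fintype.card ℤˣ = 2 from rfl]
        push_cast
        ring

theorem norm_le_two_mul_of_action {A : Type} [Fintype A] {z z₀ : Phase A} (hz : IsReal z)
    (hz₀ : IsReal z₀) {ε η : ℝ} (hz₀ε : ‖z₀‖ ≤ ε) (hη : ∀ a, ‖action a z - action a z₀‖ ≤ η)
    (hηε : Fintype.card (A × ℤˣ) * η ≤ ε ^ 2) : ‖z‖ ≤ 2 * ε := by
  have hε : 0 ≤ ε := (norm_nonneg _).trans hz₀ε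
  have hsq := (le_abs_self _).trans ((abs_norm_sq_sub_norm_sq_le hz hz₀ hη).trans hηε)
  have hsq₀ : ‖z₀‖ ^ 2 ≤ ε ^ 2 := by gcongr
  exact le_of_sq_le_sq (by nlinarith) (by positivity)

section LongTime

variable {c : ℕ} {b : ℕ → ℕ}

namespace Model.Approximates

variable {m : Model c b} {M : ℕ} {V : Set (Phase m.A)} {P : Phase m.A → ℂ} {ε : ℝ}

theorem exists_isTrajectory (hm : m.Approximates M V P) (hε : 0 < ε)
    (hsmall : m.Λ ^ (2 * c + 4) * ε ≤ 1) {z : Phase m.A} (hz : ‖z‖ ≤ 2 * ε) :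
    ∃ γ, IsTrajectory V P m.h z γ ∧ ∀ t ∈ Set.Icc 0 m.h, ‖γ t‖ ≤ 3 * ε := by
  have hc : 1 ≤ m.Λ ^ c := one_le_pow₀ m.one_le
  have hpos : 0 < m.Λ ^ c := by positivity
  have hsq : m.Λ ^ c * (m.Λ ^ c * (9 * ε)) ≤ 1 := by
    have h16 : (9 : ℝ) ≤ m.Λ ^ 4 := by
      linarith [pow_le_pow_left₀ (by norm_num : (0 : ℝ) ≤ 2) m.two_le 4]
    calc m.Λ ^ c * (m.Λ ^ c * (9 * ε)) ≤ m.Λ ^ c * (m.Λ ^ c * (m.Λ ^ 4 * ε)) := by gcongr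
      _ = m.Λ ^ (2 * c + 4) * ε := by ring
      _ ≤ 1 := hsmall
  have hlin : m.Λ ^ c * (9 * ε) ≤ 1 := (le_mul_of_one_le_left (by positivity) hc).trans hsq
  have hball (w) (hw : w ∈ Metric.closedBall z ε) : ‖w‖ ≤ 3 * ε := by
    linarith [norm_le_of_mem_closedBall hw]
  have hlt : ‖z‖ + ε < 1 / m.Λ ^ c := by
    rw [lt_div_iff₀ hpos]
    nlinarith
  obtain ⟨γ, hγ, hγball⟩ := Splitting.exists_isTrajectory (L := m.Λ ^ c * (3 * ε) ^ 2)
    hm.ball_subset (hm.contDiffOn.mono hm.ball_subset) m.h_pos.le hε.le hlt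
    (fun w hw => hm.norm_hamVF_le w (3 * ε) (by positivity) (hball w hw) (by linarith)) (by
      calc m.Λ ^ c * (3 * ε) ^ 2 * m.h ≤ m.Λ ^ c * (3 * ε) ^ 2 * m.Λ ^ c := by
            gcongr
            exact m.h_le
        _ = m.Λ ^ c * (m.Λ ^ c * (9 * ε)) * ε := by ring
        _ ≤ ε := mul_le_of_le_one_left hε.le hsq)
  exact ⟨γ, hγ, fun t ht => hball _ (hγball t ht)⟩

/- As long as the quantities `J i` have drifted by at most `δ` per step, the orbit is trapped in a
ball in which the next step is defined. -/
theorem exists_iterates_eq_some (hm : m.Approximates M V P) (hε : 0 < ε)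
    (hsmall : m.Λ ^ (2 * c + 4) * ε ≤ 1) {z₀ : Phase m.A} (hz₀ : IsReal z₀) (hz₀ε : ‖z₀‖ ≤ ε)
    {ι : Type*} {J : ι → Phase m.A → ℂ} {δ : ℝ} {N : ℕ}
    (hstep : ∀ z γ, IsTrajectory V P m.h z γ → (∀ t ∈ Set.Icc 0 m.h, ‖γ t‖ ≤ 3 * ε) →
      ∀ i, ‖J i (rotMap m.ω m.h (γ m.h)) - J i z‖ ≤ δ)
    (htrap : ∀ n ≤ N, ∀ z, IsReal z → ‖z‖ ≤ 3 * ε → (∀ i, ‖J i z - J i z₀‖ ≤ n * δ) →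
      ‖z‖ ≤ 2 * ε) (n : ℕ) (hn : n ≤ N) :
    ∃ z, iterates V m.ω P m.h z₀ n = Part.some z ∧ IsReal z ∧ ‖z‖ ≤ 2 * ε ∧
      ∀ i, ‖J i z - J i z₀‖ ≤ n * δ := by
  induction n with
  | zero => exact ⟨z₀, rfl, hz₀, by linarith, fun i => by simp⟩
  | succ n ih =>
    obtain ⟨z, hz, hzr, hzε, hzJ⟩ := ih (Nat.le_of_succ_le hn)
    obtain ⟨γ, hγ, hγε⟩ := hm.exists_isTrajectory hε hsmall hzε
    have hh : m.h ∈ Set.Icc 0 m.h := ⟨m.h_pos.le, le_rfl⟩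
    set w := rotMap m.ω m.h (γ m.h)
    have hwr : IsReal w := isReal_rotMap _ _
      (hγ.isReal hm.isOpen hm.contDiffOn hm.isRealHam hzr _ hh)
    have hwJ (i) : ‖J i w - J i z₀‖ ≤ (n + 1 : ℕ) * δ := by
      calc ‖J i w - J i z₀‖ ≤ ‖J i w - J i z‖ + ‖J i z - J i z₀‖ :=
            norm_sub_le_norm_sub_add_norm_sub _ _ _
        _ ≤ δ + n * δ := add_le_add (hstep z γ hγ hγε i) (hzJ i)
        _ = (n + 1 : ℕ) * δ := by push_cast; ring
    have hwε : ‖w‖ ≤ 3 * ε := (norm_rotMap ..).trans_le (hγε _ hh)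
    exact ⟨w, iterates_succ_eq_some hm.isOpen hm.contDiffOn m.h_pos.le hz hγ, hwr,
      htrap _ hn w hwr hwε hwJ, hwJ⟩

end Model.Approximates

variable (c b)

theorem exists_approximate_integrals (M : ℕ) : ∃ p : ℕ, ∀ (m : Model c b) (ε : ℝ), 0 < ε →
    m.Λ ^ (c + 2) * ε ≤ 1 → ∃ J : m.A → Phase m.A → ℂ,
      (∀ V P, m.Approximates M V P → ∀ z γ, IsTrajectory V P m.h z γ →
        (∀ t ∈ Set.Icc 0 m.h, ‖γ t‖ ≤ 3 * ε) →
        ∀ a, ‖J a (rotMap m.ω m.h (γ m.h)) - J a z‖ ≤ m.Λ ^ p * ε ^ (M + 3)) ∧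
      ∀ z, ‖z‖ ≤ 3 * ε → ∀ a, ‖J a z - action a z‖ ≤ m.Λ ^ p * ε ^ 3 := by
  obtain ⟨p₁, hp₁⟩ := exists_norm_approxInt_step_le
    (s := fun i : Σ m : Model c b, m.A => i.1) M fun i => i.2
  obtain ⟨p₂, hp₂⟩ := exists_norm_approxInt_sub_action_le
    (s := fun i : Σ m : Model c b, m.A => i.1) M fun i => i.2
  refine ⟨max p₁ p₂ + 2 * (M + 3), fun m ε hε hsmall =>
    ⟨fun a z => MvPolynomial.eval z (m.approxInt M a), ?_⟩⟩
  have hΛ := m.one_le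
  have hthree : (3 : ℝ) ≤ m.Λ ^ 2 := by nlinarith [m.two_le]
  have hsmall' : m.Λ ^ c * (3 * ε) ≤ 1 := by
    calc m.Λ ^ c * (3 * ε) ≤ m.Λ ^ c * (m.Λ ^ 2 * ε) := by gcongr
      _ = m.Λ ^ (c + 2) * ε := by ring
      _ ≤ 1 := hsmall
  have hle1 : 3 * ε ≤ 1 := (le_mul_of_one_le_left (by positivity) (one_le_pow₀ hΛ)).trans hsmall'
  have habsorb {p k : ℕ} (hp : p ≤ max p₁ p₂) (hk : k ≤ M + 3) :
      m.Λ ^ p * (3 * ε) ^ k ≤ m.Λ ^ (max p₁ p₂ + 2 * (M + 3)) * ε ^ k := by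
    calc m.Λ ^ p * (3 * ε) ^ k ≤ m.Λ ^ p * (m.Λ ^ 2 * ε) ^ k := by gcongr
      _ = m.Λ ^ (p + 2 * k) * ε ^ k := by ring
      _ ≤ m.Λ ^ (max p₁ p₂ + 2 * (M + 3)) * ε ^ k := by gcongr
  exact ⟨fun V P hP z γ hγ hγε a => (hp₁ ⟨m, a⟩ V P hP z γ (3 * ε) (by positivity) hsmall' hγ
      hγε).trans (habsorb (le_max_left _ _) le_rfl),
    fun z hz a => (hp₂ ⟨m, a⟩ z (3 * ε) hz hle1).trans
      (habsorb (le_max_right _ _) (Nat.le_add_left ..))⟩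

theorem exists_action_iterates_sub_le (M : ℕ) :
    ∃ p : ℕ, ∀ (m : Model c b) (V : Set (Phase m.A)) (P : Phase m.A → ℂ),
      m.Approximates (M + 1) V P → ∀ ε : ℝ, 0 < ε → m.Λ ^ (2 * p) * ε ≤ 1 →
      ∀ z₀, IsReal z₀ → ‖z₀‖ ≤ ε → ∀ n : ℕ, n * ε ^ M ≤ 1 →
        ∃ z, iterates V m.ω P m.h z₀ n = Part.some z ∧ ‖z‖ ≤ 2 * ε ∧
          ∀ a, ‖action a z - action a z₀‖ ≤ m.Λ ^ p * ε ^ 3 := by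
  obtain ⟨q, hq⟩ := exists_approximate_integrals c b (M + 1)
  refine ⟨q + c + 2, fun m V P hm ε hε hsmall z₀ hz₀ hz₀ε N hN => ?_⟩
  have hΛ := m.one_le
  have hle {k} (hk : k ≤ 2 * (q + c + 2)) : m.Λ ^ k * ε ≤ 1 := le_trans (by gcongr) hsmall
  have hε1 : ε ≤ 1 := by simpa using hle (k := 0) (by omega)
  obtain ⟨J, hstep, hJ⟩ := hq m ε hε (hle (by omega))
  have hdrift {n : ℕ} (hn : n ≤ N) : n * (m.Λ ^ q * ε ^ (M + 1 + 3)) ≤ m.Λ ^ q * ε ^ 3 := by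
    calc n * (m.Λ ^ q * ε ^ (M + 1 + 3)) ≤ N * (m.Λ ^ q * ε ^ (M + 1 + 3)) := by gcongr
      _ = (N * ε ^ M) * ε * (m.Λ ^ q * ε ^ 3) := by ring
      _ ≤ 1 * 1 * (m.Λ ^ q * ε ^ 3) := by gcongr
      _ = m.Λ ^ q * ε ^ 3 := by ring
  have haction {n : ℕ} (hn : n ≤ N) {z : Phase m.A} (hz : ‖z‖ ≤ 3 * ε)
      (hzJ : ∀ a, ‖J a z - J a z₀‖ ≤ n * (m.Λ ^ q * ε ^ (M + 1 + 3))) (a) :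
      ‖action a z - action a z₀‖ ≤ m.Λ ^ (q + 2) * ε ^ 3 := by
    calc ‖action a z - action a z₀‖
        = ‖J a z - J a z₀ - (J a z - action a z) + (J a z₀ - action a z₀)‖ := by congr 1; ring
      _ ≤ m.Λ ^ q * ε ^ 3 + m.Λ ^ q * ε ^ 3 + m.Λ ^ q * ε ^ 3 :=
          norm_add_le_of_le (norm_sub_le_of_le ((hzJ a).trans (hdrift hn)) (hJ z hz a))
            (hJ z₀ (by linarith) a)
      _ = 3 * (m.Λ ^ q * ε ^ 3) := by ring
      _ ≤ m.Λ ^ 2 * (m.Λ ^ q * ε ^ 3) := by gcongr; nlinarith [m.two_le]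
      _ = m.Λ ^ (q + 2) * ε ^ 3 := by ring
  have hcard : Fintype.card (m.A × ℤˣ) * (m.Λ ^ (q + 2) * ε ^ 3) ≤ ε ^ 2 := by
    calc _ ≤ m.Λ ^ c * (m.Λ ^ (q + 2) * ε ^ 3) := by gcongr; exact m.card_le
      _ = m.Λ ^ (q + c + 2) * ε * ε ^ 2 := by ring
      _ ≤ ε ^ 2 := mul_le_of_le_one_left (by positivity) (hle (by omega))
  obtain ⟨z, hz, -, hzε, hzJ⟩ := hm.exists_iterates_eq_some hε (hle (by omega)) hz₀ hz₀ε
    (hstep V P hm)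
    (fun n hn z hzr hz hzJ => norm_le_two_mul_of_action hzr hz₀ hz₀ε (haction hn hz hzJ) hcard)
    N le_rfl
  refine ⟨z, hz, hzε, fun a => (haction le_rfl (by linarith) hzJ a).trans ?_⟩
  gcongr
  omega

end LongTime

/-- A splitting step with a smooth perturbation `P` of a rotation, all of whose data are bounded by
powers of `Λ` with exponents `e` and `b`. Derivatives of `P` of order above two are not bounded
here: Cauchy estimates control them. -/
structure Admissible (e : ℕ) (b : ℕ → ℕ) {A : Type} [Fintype A] [DecidableEq A] (ω : A → ℝ)
    (h Λ : ℝ) (V : Set (Phase A)) (P : Phase A → ℂ) : Prop where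
  two_le : 2 ≤ Λ
  card_le : (Fintype.card (A × ℤˣ) : ℝ) ≤ Λ ^ e
  h_pos : 0 < h
  h_le : h ≤ Λ ^ e
  nonres : ∀ μ : A × ℤˣ →₀ ℕ, ¬ Resonant μ → h ≤ Λ ^ b μ.degree * ‖1 - eigen ω h μ‖
  isOpen : IsOpen V
  contDiffOn : ContDiffOn ℂ ((⊤ : ℕ∞) : WithTop ℕ∞) P V
  isRealHam : IsRealHam V P
  iteratedFDeriv_zero : ∀ k < 3, iteratedFDeriv ℂ k P 0 = 0
  ball_subset : Metric.ball 0 (1 / Λ ^ e) ⊆ V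
  norm_le : ∀ z : Phase A, ‖z‖ < 1 / Λ ^ e → ‖iteratedFDeriv ℂ 2 P z‖ ≤ Λ ^ e

/-- The exponent in the Cauchy bounds for the derivatives up to order `L + 2`. -/
def derivExp (e L : ℕ) : ℕ := e + (L + e) * L

/-- An exponent large enough for the Taylor polynomial of degree `M + 2` and its remainder. -/
def taylorExp (e M : ℕ) : ℕ := derivExp e (M + 1) + (M + 3) * (e + 3) + e + 10

namespace Admissible

variable {e : ℕ} {b : ℕ → ℕ} {A : Type} [Fintype A] [DecidableEq A] {ω : A → ℝ} {h Λ : ℝ}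
  {V : Set (Phase A)} {P : Phase A → ℂ}

theorem one_le (hP : Admissible e b ω h Λ V P) : 1 ≤ Λ := one_le_two.trans hP.two_le

theorem ball_subset_of_le (hP : Admissible e b ω h Λ V P) {k : ℕ} (hk : e ≤ k) :
    Metric.ball 0 (1 / Λ ^ k) ⊆ V :=
  (Metric.ball_subset_ball (one_div_le_one_div_of_le (pow_pos (one_pos.trans_le hP.one_le) _)
    (pow_le_pow_right₀ hP.one_le hk))).trans hP.ball_subset

theorem norm_iteratedFDeriv_le (hP : Admissible e b ω h Λ V P) {k L : ℕ} (hk : k ≤ L)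
    {z : Phase A} (hz : ‖z‖ < 1 / Λ ^ (e + L)) :
    ‖iteratedFDeriv ℂ (2 + k) P z‖ ≤ Λ ^ derivExp e L := by
  have hΛ := hP.two_le
  have hΛ1 := hP.one_le
  have hz' : ‖z‖ < 1 / Λ ^ e / 2 ^ k := by
    refine hz.trans_le ?_
    rw [div_div, pow_add]
    have : (2 : ℝ) ^ k ≤ Λ ^ L :=
      (pow_le_pow_left₀ zero_le_two hΛ k).trans (pow_le_pow_right₀ hΛ1 hk)
    gcongr
  calc ‖iteratedFDeriv ℂ (2 + k) P z‖ ≤ Λ ^ e * (2 ^ k / (1 / Λ ^ e)) ^ k :=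
        norm_iteratedFDeriv_add_le (by positivity) (hP.contDiffOn.mono hP.ball_subset) hP.norm_le k
          hz'
    _ = Λ ^ e * (2 ^ k * Λ ^ e) ^ k := by rw [div_div_eq_mul_div, div_one]
    _ ≤ Λ ^ e * (Λ ^ k * Λ ^ e) ^ k := by gcongr
    _ = Λ ^ derivExp e k := by rw [derivExp, ← pow_add, ← pow_mul, ← pow_add]
    _ ≤ Λ ^ derivExp e L := by
        simp only [derivExp]
        gcongr

theorem coeffNorm_taylorPart_le (hP : Admissible e b ω h Λ V P) {k L : ℕ} (hk : k ≤ L + 2) :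
    coeffNorm (taylorPart P k) ≤ Λ ^ (e * (L + 2) + derivExp e L) := by
  have hΛ := hP.one_le
  have hcard : (Fintype.card (A × ℤˣ) : ℝ) ^ k ≤ (Λ ^ e) ^ (L + 2) :=
    (pow_le_pow_left₀ (by positivity) hP.card_le k).trans
      (pow_le_pow_right₀ (one_le_pow₀ hΛ) hk)
  have hderiv : ‖iteratedFDeriv ℂ k P 0‖ ≤ Λ ^ derivExp e L := by
    rcases lt_or_ge k 2 with h2 | h2
    · rw [hP.iteratedFDeriv_zero k (by omega), norm_zero]
      positivity
    · obtain ⟨l, rfl⟩ := Nat.exists_eq_add_of_le h2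
      exact hP.norm_iteratedFDeriv_le (by omega) (by rw [norm_zero]; positivity)
  refine (Splitting.coeffNorm_taylorPart_le P k).trans ?_
  rw [pow_add, pow_mul]
  gcongr

theorem polyBound_taylorPoly (hP : Admissible e b ω h Λ V P) (M : ℕ) :
    PolyBound Λ (taylorExp e M) (taylorPoly P (M + 3)) := by
  have hΛ := hP.one_le
  refine ⟨(totalDegree_taylorPoly_le P _).trans (by rw [taylorExp]; nlinarith), ?_⟩
  calc coeffNorm (taylorPoly P (M + 3))
      ≤ ∑ k ∈ Finset.range (M + 3), coeffNorm (taylorPart P k) := coeffNorm_sum_le _ _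
    _ ≤ (M + 3 : ℕ) * Λ ^ (e * (M + 3) + derivExp e (M + 1)) := by
        refine (Finset.sum_le_card_nsmul _ _ _ fun k hk => hP.coeffNorm_taylorPart_le
          (L := M + 1) (Finset.mem_range.mp hk).le).trans_eq ?_
        rw [Finset.card_range, nsmul_eq_mul]
    _ ≤ Λ ^ (M + 3) * Λ ^ (e * (M + 3) + derivExp e (M + 1)) := by
        gcongr
        exact natCast_le_pow hP.two_le _
    _ ≤ Λ ^ taylorExp e M := by
        rw [← pow_add, taylorExp]
        exact pow_le_pow_right₀ hΛ (by nlinarith)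

theorem two_mul_lt_of_pow_mul_le (hP : Admissible e b ω h Λ V P) {M : ℕ} {τ : ℝ} (hτ : 0 < τ)
    (hsmall : Λ ^ taylorExp e M * τ ≤ 1) : 2 * τ < 1 / Λ ^ (e + (M + 1)) := by
  have hΛ := hP.two_le
  have hΛ1 := hP.one_le
  rw [lt_div_iff₀ (by positivity)]
  calc 2 * τ * Λ ^ (e + (M + 1)) < Λ ^ 2 * τ * Λ ^ (e + (M + 1)) := by
        gcongr
        nlinarith
    _ = Λ ^ (2 + e + (M + 1)) * τ := by ring
    _ ≤ Λ ^ taylorExp e M * τ := by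
        gcongr
        rw [taylorExp]
        nlinarith
    _ ≤ 1 := hsmall

theorem norm_fderiv_sub_le (hP : Admissible e b ω h Λ V P) {n M : ℕ} (hn : 1 ≤ n) (hnM : n ≤ M + 2)
    {z : Phase A} {τ : ℝ} (hτ : 0 < τ) (hz : ‖z‖ ≤ τ) (hsmall : Λ ^ taylorExp e M * τ ≤ 1)
    (j : A × ℤˣ) :
    ‖fderiv ℂ P z (EuclideanSpace.single j 1)
      - MvPolynomial.eval z (pd j (taylorPoly P (n + 1)))‖
      ≤ Λ ^ (derivExp e (M + 1) + 2 * M + 7) * τ ^ n := by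
  have hΛ := hP.two_le
  have hΛ1 := hP.one_le
  have hderiv (w : Phase A) (hw : ‖w‖ < 1 / Λ ^ (e + (M + 1))) :
      ‖iteratedFDeriv ℂ (n + 1) P w‖ ≤ Λ ^ derivExp e (M + 1) := by
    obtain ⟨l, rfl⟩ := Nat.exists_eq_add_of_le' hn
    rw [show l + 1 + 1 = 2 + l by omega]
    exact hP.norm_iteratedFDeriv_le (by omega) hw
  refine (norm_fderiv_single_sub_eval_pd_le (hP.contDiffOn.mono (hP.ball_subset_of_le (by omega))) n
    hderiv hτ hz (hP.two_mul_lt_of_pow_mul_le hτ hsmall) j).trans ?_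
  gcongr
  calc ((n : ℝ) + 2) * (Λ ^ derivExp e (M + 1) * 2 ^ (n + 1))
      ≤ Λ ^ (n + 2) * (Λ ^ derivExp e (M + 1) * Λ ^ (n + 1)) := by
        gcongr
        exact_mod_cast natCast_le_pow hΛ (n + 2)
    _ = Λ ^ (derivExp e (M + 1) + 2 * n + 3) := by ring
    _ ≤ Λ ^ (derivExp e (M + 1) + 2 * M + 7) := pow_le_pow_right₀ hΛ1 (by omega)

theorem norm_hamVF_le (hP : Admissible e b ω h Λ V P) {M : ℕ} {z : Phase A} {τ : ℝ} (hτ : 0 < τ)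
    (hz : ‖z‖ ≤ τ) (hsmall : Λ ^ taylorExp e M * τ ≤ 1) :
    ‖hamVF P z‖ ≤ Λ ^ taylorExp e M * τ ^ 2 := by
  have hΛ := hP.one_le
  have hpoly : taylorPoly P (2 + 1) = 0 := Finset.sum_eq_zero fun k hk => by
    simp [taylorPart, partialDeriv, hP.iteratedFDeriv_zero k (Finset.mem_range.mp hk)]
  have hcoord (j : A × ℤˣ) :
      ‖hamVF P z j‖ ≤ Λ ^ (derivExp e (M + 1) + 2 * M + 7) * τ ^ 2 := by
    have := hP.norm_fderiv_sub_le (n := 2) one_le_two (by omega) hτ hz hsmall (bar j)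
    rw [hpoly, map_zero, map_zero, sub_zero] at this
    rwa [hamVF_apply, norm_mul, norm_symp, one_mul]
  calc ‖hamVF P z‖ ≤ ∑ j, ‖hamVF P z j‖ := norm_le_sum_norm _
    _ ≤ Fintype.card (A × ℤˣ) • (Λ ^ (derivExp e (M + 1) + 2 * M + 7) * τ ^ 2) :=
        Finset.sum_le_card_nsmul _ _ _ fun j _ => hcoord j
    _ ≤ Λ ^ e * (Λ ^ (derivExp e (M + 1) + 2 * M + 7) * τ ^ 2) := by
        rw [nsmul_eq_mul]
        gcongr
        exact hP.card_le
    _ = Λ ^ (e + (derivExp e (M + 1) + 2 * M + 7)) * τ ^ 2 := by ring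
    _ ≤ Λ ^ taylorExp e M * τ ^ 2 := by
        gcongr
        rw [taylorExp]
        nlinarith

/-- The polynomial model of an admissible splitting step: `P` is replaced by its Taylor polynomial
of degree `M + 2`. -/
def model (hP : Admissible e b ω h Λ V P) (M : ℕ) : Model (taylorExp e M) b where
  A := A
  ω := ω
  h := h
  Λ := Λ
  Q := taylorPoly P (M + 3)
  two_le := hP.two_le
  card_le := hP.card_le.trans (pow_le_pow_right₀ hP.one_le (by rw [taylorExp]; omega))
  h_pos := hP.h_pos
  h_le := hP.h_le.trans (pow_le_pow_right₀ hP.one_le (by rw [taylorExp]; omega))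
  polyBound_Q := hP.polyBound_taylorPoly M
  Q_mem := taylorPoly_mem_vanishingTo hP.iteratedFDeriv_zero _
  nonres := hP.nonres

theorem approximates_model (hP : Admissible e b ω h Λ V P) (M : ℕ) :
    (hP.model M).Approximates M V P where
  isOpen := hP.isOpen
  contDiffOn := hP.contDiffOn
  isRealHam := hP.isRealHam
  ball_subset := hP.ball_subset_of_le (by rw [taylorExp]; omega)
  norm_fderiv_sub_le z τ hτ hz hsmall j :=
    (hP.norm_fderiv_sub_le (Nat.le_add_left 1 _) le_rfl hτ hz hsmall j).trans
      (mul_le_mul_of_nonneg_right (pow_le_pow_right₀ hP.one_le (by rw [taylorExp]; nlinarith))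
        (by positivity))
  norm_hamVF_le _ _ := hP.norm_hamVF_le

end Admissible

theorem exists_iterates_of_admissible (e : ℕ) (b : ℕ → ℕ) (M : ℕ) :
    ∃ p : ℕ, ∀ {A : Type} [Fintype A] [DecidableEq A] {ω : A → ℝ} {h Λ : ℝ} {V : Set (Phase A)}
      {P : Phase A → ℂ}, Admissible e b ω h Λ V P → ∀ ε : ℝ, 0 < ε → Λ ^ (2 * p) * ε ≤ 1 →
      ∀ z₀ : Phase A, IsReal z₀ → ‖z₀‖ ≤ ε → ∀ n : ℕ, n * ε ^ M ≤ 1 →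
        ∃ z, iterates V ω P h z₀ n = Part.some z ∧ ‖z‖ ≤ 2 * ε ∧
          ∀ a, ‖action a z - action a z₀‖ ≤ Λ ^ p * ε ^ 3 := by
  obtain ⟨p, hp⟩ := exists_action_iterates_sub_le (taylorExp e (M + 1)) b M
  exact ⟨p, fun hP => hp (hP.model (M + 1)) _ _ (hP.approximates_model (M + 1))⟩

theorem le_pow_natCeil {Λ : ℝ} (hΛ : 2 ≤ Λ) (x : ℝ) : x ≤ Λ ^ ⌈x⌉₊ :=
  (Nat.le_ceil x).trans (natCast_le_pow hΛ _)

theorem rpow_le_pow_natCeil {κ Λ : ℝ} (hκ : 1 ≤ κ) (hκΛ : κ ≤ Λ) (x : ℝ) : κ ^ x ≤ Λ ^ ⌈x⌉₊ :=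
  calc κ ^ x ≤ κ ^ (⌈x⌉₊ : ℝ) := Real.rpow_le_rpow_of_exponent_le hκ (Nat.le_ceil x)
    _ = κ ^ ⌈x⌉₊ := Real.rpow_natCast _ _
    _ ≤ Λ ^ ⌈x⌉₊ := pow_le_pow_left₀ (by linarith) hκΛ _

theorem mul_rpow_le_pow_natCeil {κ Λ : ℝ} (hκ : 1 ≤ κ) (hκΛ : κ ≤ Λ) (hΛ : 2 ≤ Λ) (x y : ℝ) :
    x * κ ^ y ≤ Λ ^ (⌈x⌉₊ + ⌈y⌉₊) := by
  rw [pow_add]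
  exact mul_le_mul (le_pow_natCeil hΛ x) (rpow_le_pow_natCeil hκ hκΛ y) (by positivity)
    (by positivity)

theorem norm_iteratedFDeriv_le_of_forall_partialDeriv_le {A : Type} [Fintype A] [DecidableEq A]
    {P : Phase A → ℂ} {z : Phase A} {ℓ c : ℕ} {κ Λ C β : ℝ} (hκ : 1 ≤ κ) (hκΛ : κ ≤ Λ) (hΛ : 2 ≤ Λ)
    (hcard : (Fintype.card (A × ℤˣ) : ℝ) ≤ Λ ^ c)
    (hP : ∀ j : Fin ℓ → A × ℤˣ, ‖partialDeriv P j z‖ ≤ C * κ ^ β) :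
    ‖iteratedFDeriv ℂ ℓ P z‖ ≤ Λ ^ (c * ℓ + (⌈C⌉₊ + ⌈β⌉₊)) := by
  calc ‖iteratedFDeriv ℂ ℓ P z‖ ≤ (Fintype.card (A × ℤˣ) : ℝ) ^ ℓ * Λ ^ (⌈C⌉₊ + ⌈β⌉₊) :=
        norm_multilinear_le _ (by positivity) fun j =>
          (hP j).trans (mul_rpow_le_pow_natCeil hκ hκΛ hΛ C β)
    _ ≤ (Λ ^ c) ^ ℓ * Λ ^ (⌈C⌉₊ + ⌈β⌉₊) := by gcongr
    _ = Λ ^ (c * ℓ + (⌈C⌉₊ + ⌈β⌉₊)) := by rw [← pow_mul, ← pow_add]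

section Discretization

variable {d : ℕ} {N : Set (Fin d → ℤ)} {NK : ℕ → Finset N} {K : ℕ}

theorem NonResonant.le_pow_mul_norm {ω : N → ℝ} {h : ℝ} {γ α : ℕ → ℝ}
    (hnr : NonResonant NK ω h γ α) (hγ : ∀ s, 0 < γ s) (hK : 1 ≤ K) {μ : NK K × ℤˣ →₀ ℕ}
    (hμ : ¬ Resonant μ) : h ≤ (2 * K) ^ (⌈1 / γ μ.degree⌉₊ + ⌈α μ.degree⌉₊) *
      ‖1 - eigen (fun a : NK K => ω a) h μ‖ := by
  have hK' : (1 : ℝ) ≤ K := by exact_mod_cast hK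
  obtain ⟨j, hj, hnorm⟩ := exists_tuple_of_not_resonant (fun a : NK K => ω a) h hμ
  have hdiv := hnr μ.degree K hK j hj
  rw [← hnorm, div_le_iff₀ (by positivity)] at hdiv
  have hγμ := hγ μ.degree
  calc h = 1 / γ μ.degree * (h * γ μ.degree) := by field_simp
    _ ≤ 1 / γ μ.degree * (‖1 - eigen (fun a : NK K => ω a) h μ‖ * (K : ℝ) ^ α μ.degree) := by
        gcongr
    _ = 1 / γ μ.degree * (K : ℝ) ^ α μ.degree * ‖1 - eigen (fun a : NK K => ω a) h μ‖ := by ring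
    _ ≤ _ := by
        gcongr
        exact mul_rpow_le_pow_natCeil hK' (by linarith) (by linarith) _ _

variable (N) in
theorem exists_admissible {U : Set (FullPhase N)} (hU : IsOpen U) (hU0 : (0 : FullPhase N) ∈ U)
    (h₀ C β : ℝ) {γ : ℕ → ℝ} (α : ℕ → ℝ) (hγ : ∀ s, 0 < γ s) :
    ∃ (e : ℕ) (b : ℕ → ℕ), ∀ (NK : ℕ → Finset N),
      (∀ K, ∀ a ∈ NK K, ∀ i, |(a : Fin d → ℤ) i| ≤ (K : ℤ)) →
      ∀ (ω : N → ℝ) (h : ℝ), 0 < h → h < h₀ → NonResonant NK ω h γ α →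
      ∀ K : ℕ, 1 ≤ K → ∀ P : Phase (NK K) → ℂ,
        ContDiffOn ℂ ((⊤ : ℕ∞) : WithTop ℕ∞) P (proj (NK K) '' U) →
        IsRealHam (proj (NK K) '' U) P → (∀ k < 3, iteratedFDeriv ℂ k P 0 = 0) →
        (∀ j : Fin 2 → NK K × ℤˣ, ∀ z ∈ proj (NK K) '' U,
          ‖partialDeriv P j z‖ ≤ C * (K : ℝ) ^ β) →
        Admissible e b (fun a : NK K => ω a) h (2 * K) (proj (NK K) '' U) P := by
  obtain ⟨ρ, hρ, hball⟩ := exists_ball_subset_image_proj hU hU0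
  set e := (2 * d + 1) * 2 + (⌈C⌉₊ + ⌈β⌉₊) + ⌈h₀⌉₊ + ⌈1 / ρ⌉₊
  refine ⟨e, fun s => ⌈1 / γ s⌉₊ + ⌈α s⌉₊, fun NK hNK ω h hh hh₀ hnr K hK P hP hPr hP0 hP2 => ?_⟩
  have hK' : (1 : ℝ) ≤ K := by exact_mod_cast hK
  have hΛ : (2 : ℝ) ≤ 2 * K := by linarith
  have hmono {k : ℕ} (hk : k ≤ e) : (2 * K : ℝ) ^ k ≤ (2 * K) ^ e :=
    pow_le_pow_right₀ (by linarith) hk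
  have hcard : (Fintype.card (NK K × ℤˣ) : ℝ) ≤ (2 * K) ^ (2 * d + 1) := by
    exact_mod_cast card_le_of_forall_abs_le (NK K) hK (hNK K)
  have hsub : Metric.ball 0 (1 / (2 * (K : ℝ)) ^ e) ⊆ proj (NK K) '' U := by
    refine (Metric.ball_subset_ball ?_).trans ((proj_zero (NK K)) ▸ hball (NK K))
    rw [one_div_le (by positivity) hρ]
    exact (le_pow_natCeil hΛ _).trans (hmono (by omega))
  exact
    { two_le := hΛ
      card_le := hcard.trans (hmono (by omega))
      h_pos := hh
      h_le := hh₀.le.trans ((le_pow_natCeil hΛ _).trans (hmono (by omega)))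
      nonres := fun _ hμ => hnr.le_pow_mul_norm hγ hK hμ
      isOpen := isOpen_image_proj hU _
      contDiffOn := hP
      isRealHam := hPr
      iteratedFDeriv_zero := hP0
      ball_subset := hsub
      norm_le := fun z hz => (norm_iteratedFDeriv_le_of_forall_partialDeriv_le hK' (by linarith) hΛ
        hcard fun j => hP2 j z (hsub (mem_ball_zero_iff.mpr hz))).trans (hmono (by omega)) }

end Discretization

theorem two_mul_pow_mul_le_one (q : ℕ) {ε K : ℝ} (hε : 0 < ε) (hε0 : ε ≤ 1 / 4 ^ q) (hK : 1 ≤ K)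
    (hKε : K ≤ ε ^ (-(1 / (2 * (q + 1)) : ℝ))) : (2 * K) ^ q * ε ≤ 1 := by
  have hpow : K ^ (2 * q) ≤ ε⁻¹ := by
    calc K ^ (2 * q) ≤ K ^ (2 * (q + 1)) := pow_le_pow_right₀ hK (by omega)
      _ ≤ (ε ^ (-(1 / (2 * (q + 1)) : ℝ))) ^ (2 * (q + 1)) := by gcongr
      _ = ε⁻¹ := by
          rw [← Real.rpow_natCast, ← Real.rpow_mul hε.le, ← Real.rpow_neg_one]
          congr 1
          push_cast
          field_simp
  refine (sq_le_one_iff₀ (by positivity)).mp ?_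
  have hfour : (4 : ℝ) ^ q = 2 ^ (2 * q) := by
    rw [pow_mul]
    norm_num
  calc ((2 * K) ^ q * ε) ^ 2 = 4 ^ q * ε * (K ^ (2 * q) * ε) := by
        rw [hfour]
        ring
    _ ≤ 4 ^ q * (1 / 4 ^ q) * (ε⁻¹ * ε) := by gcongr
    _ = 1 := by field_simp

theorem pow_mul_pow_three_le_rpow {Λ ε : ℝ} (hε : 0 ≤ ε) (p : ℕ) (h : Λ ^ (2 * p) * ε ≤ 1) :
    Λ ^ p * ε ^ 3 ≤ ε ^ (5 / 2 : ℝ) := by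
  refine le_of_sq_le_sq ?_ (by positivity)
  calc (Λ ^ p * ε ^ 3) ^ 2 = Λ ^ (2 * p) * ε * ε ^ 5 := by ring
    _ ≤ ε ^ 5 := mul_le_of_le_one_left (by positivity) h
    _ = (ε ^ (5 / 2 : ℝ)) ^ 2 := by
        rw [← Real.rpow_mul_natCast hε, ← Real.rpow_natCast]
        norm_num

theorem natCast_mul_pow_le_one {r ε : ℝ} {M n : ℕ} (hrM : r - 1 ≤ M) (hε : 0 < ε) (hε1 : ε ≤ 1)
    (hn : (n : ℝ) ≤ ε ^ (1 - r)) : n * ε ^ M ≤ 1 :=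
  calc n * ε ^ M ≤ ε ^ (1 - r) * ε ^ M := by gcongr
    _ = ε ^ (1 - r + M) := by rw [← Real.rpow_natCast, ← Real.rpow_add hε]
    _ ≤ 1 := Real.rpow_le_one hε.le hε1 (by linarith)

end Splitting

end

open Splitting in
theorem theorem1_general {d : ℕ} {N : Set (Fin d → ℤ)} {U : Set (FullPhase N)} (hU : IsOpen U)
    (hU0 : (0 : FullPhase N) ∈ U) (r h₀ C β : ℝ) {γ : ℕ → ℝ} (α : ℕ → ℝ) (hγ : ∀ s, 0 < γ s) :
    ∃ σ ε₀ : ℝ, 0 < σ ∧ 0 < ε₀ ∧ ε₀ ≤ 1 ∧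
      ∀ (NK : ℕ → Finset N), (∀ K, ∀ a ∈ NK K, ∀ i, |(a : Fin d → ℤ) i| ≤ (K : ℤ)) →
      ∀ (ω : N → ℝ) (h : ℝ), 0 < h → h < h₀ → NonResonant NK ω h γ α →
      ∀ K : ℕ, 1 ≤ K → ∀ P : Phase (NK K) → ℂ,
        ContDiffOn ℂ ((⊤ : ℕ∞) : WithTop ℕ∞) P (proj (NK K) '' U) →
        IsRealHam (proj (NK K) '' U) P →
        (∀ k < 3, iteratedFDeriv ℂ k P 0 = 0) →
        (∀ j : Fin 2 → NK K × ℤˣ, ∀ z ∈ proj (NK K) '' U,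
          ‖partialDeriv P j z‖ ≤ C * (K : ℝ) ^ β) →
      ∀ ε : ℝ, 0 < ε → ε < ε₀ → (K : ℝ) ≤ ε ^ (-σ) →
      ∀ z₀ : Phase (NK K), IsReal z₀ → ‖z₀‖ ≤ ε →
        let zIter := iterates (proj (NK K) '' U) (fun a : NK K => ω a) P h z₀
        (∀ n, ∀ z ∈ zIter n, IsReal z) ∧
        ∀ n : ℕ, (n : ℝ) ≤ ε ^ (1 - r) → ∃ z ∈ zIter n, ‖z‖ ≤ 2 * ε ∧
          ∀ a : NK K, ‖action a z - action a z₀‖ ≤ ε ^ (5 / 2 : ℝ) := by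
  obtain ⟨e, b, hadm⟩ := exists_admissible N hU hU0 h₀ C β α hγ
  obtain ⟨p, hp⟩ := exists_iterates_of_admissible e b ⌈r - 1⌉₊
  have hε₀ : (1 : ℝ) / 4 ^ (2 * p) ≤ 1 :=
    div_le_one_of_le₀ (one_le_pow₀ (by norm_num)) (by positivity)
  refine ⟨1 / (2 * ((2 * p : ℕ) + 1)), 1 / 4 ^ (2 * p), by positivity, by positivity, hε₀, ?_⟩
  intro NK hNK ω h hh hh₀ hnr K hK P hP hPr hP0 hP2 ε hε hεε₀ hKε z₀ hz₀ hz₀ε zIter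
  have hA := hadm NK hNK ω h hh hh₀ hnr K hK P hP hPr hP0 hP2
  have hsmall := two_mul_pow_mul_le_one (2 * p) hε hεε₀.le (Nat.one_le_cast.mpr hK) hKε
  refine ⟨isReal_of_mem_iterates hA.isOpen hA.contDiffOn hA.isRealHam hh.le hz₀, fun n hn => ?_⟩
  obtain ⟨z, hz, hzε, hza⟩ := hp hA ε hε hsmall z₀ hz₀ hz₀ε n
    (natCast_mul_pow_le_one (Nat.le_ceil _) hε (hεε₀.le.trans hε₀) hn)
  exact ⟨z, Part.eq_some_iff.mp hz, hzε, fun a =>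
    (hza a).trans (pow_mul_pow_three_le_rpow hε.le p hsmall)⟩

open Splitting in
/-- `N` is the index set (e.g. `ℤ^d` or `ℕ^d`), `NK K` its finite part at level `K`, `P K` the
nonlinearity on the open set `U_K = proj (NK K) '' U`.  Only the derivative bounds of order
`ℓ = 2, …, max r 2` enter, so `σ`, `Cst`, `ε₀` depend on no other values of `C` and `β`. -/
theorem theorem1 (d : ℕ) (N : Set (Fin d → ℤ)) (U : Set (FullPhase N)) (hU : IsOpen U)
    (hU0 : (0 : FullPhase N) ∈ U) (r : ℕ) (hr : 1 ≤ r) (h₀ : ℝ)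
    (C β : ℕ → ℝ) (hC : ∀ ℓ, 0 ≤ C ℓ) (hβ : ∀ ℓ, 0 ≤ β ℓ)
    (γ α : ℕ → ℝ) (hγ : ∀ s, 0 < γ s) :
    ∃ σ Cst ε₀ : ℝ, 0 < σ ∧ 0 < Cst ∧ 0 < ε₀ ∧
      ∀ (NK : ℕ → Finset N), (∀ K, ∀ a ∈ NK K, ∀ i, |(a : Fin d → ℤ) i| ≤ (K : ℤ)) →
      ∀ (ω : N → ℝ) (P : ∀ K, Phase (NK K) → ℂ),
        (∀ K, ContDiffOn ℂ ((⊤ : ℕ∞) : WithTop ℕ∞) (P K) (proj (NK K) '' U)) →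
        (∀ K, IsRealHam (proj (NK K) '' U) (P K)) →
        (∀ K, ∀ k < 3, iteratedFDeriv ℂ k (P K) 0 = 0) →
        (∀ ℓ, 2 ≤ ℓ → ℓ ≤ max r 2 → ∀ K, 1 ≤ K → ∀ j : Fin ℓ → NK K × ℤˣ,
          ∀ z ∈ proj (NK K) '' U, ‖partialDeriv (P K) j z‖ ≤ C ℓ * (K : ℝ) ^ β ℓ) →
      ∀ h : ℝ, 0 < h → h < h₀ → NonResonant NK ω h γ α →
      ∀ ε : ℝ, 0 < ε → ε < ε₀ → ∀ K : ℕ, 1 ≤ K → (K : ℝ) ≤ ε ^ (-σ) →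
      ∀ z₀ : Phase (NK K), IsReal z₀ → ‖z₀‖ ≤ ε →
        let zIter := iterates (proj (NK K) '' U) (fun a : NK K => ω a) (P K) h z₀
        (∀ n, ∀ z ∈ zIter n, IsReal z) ∧
        (∀ n : ℕ, (n : ℝ) ≤ ε ^ (1 - (r : ℝ)) → ∃ z ∈ zIter n, ‖z‖ ≤ 2 * ε) ∧
        (∀ n : ℕ, (n : ℝ) ≤ ε ^ (2 - (r : ℝ)) → ∃ z ∈ zIter n, ∀ a : NK K,
          ‖action a z - action a z₀‖ ≤ Cst * ε ^ (5 / 2 : ℝ)) := by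
  obtain ⟨σ, ε₀, hσ, hε₀, hε₀1, hmain⟩ := theorem1_general hU hU0 r h₀ (C 2) (β 2) α hγ
  refine ⟨σ, 1, ε₀, hσ, one_pos, hε₀, ?_⟩
  intro NK hNK ω P hP hPr hP0 hPb h hh hh₀ hnr ε hε hεε₀ K hK hKε z₀ hz₀ hz₀ε zIter
  obtain ⟨hreal, hlong⟩ := hmain NK hNK ω h hh hh₀ hnr K hK (P K) (hP K) (hPr K) (hP0 K)
    (hPb 2 le_rfl (le_max_right _ _) K hK) ε hε hεε₀ hKε z₀ hz₀ hz₀ε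
  have hshorter : ε ^ (2 - (r : ℝ)) ≤ ε ^ (1 - (r : ℝ)) :=
    Real.rpow_le_rpow_of_exponent_ge hε (hεε₀.le.trans hε₀1) (by linarith)
  exact ⟨hreal, fun n hn => (hlong n hn).imp fun z hz => ⟨hz.1, hz.2.1⟩,
    fun n hn => (hlong n (hn.trans hshorter)).imp fun z hz => ⟨hz.1, by simpa using hz.2.2⟩⟩
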